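/- For $n\in\mathbb N$ and $p\in[0,1]$ let $G(n,p)$ be the binomial random graph on $n$ vertices, in which each of the $\binom n2$ possible edges is present independently with probability $p$. The length of a path is its number of edges, and $\log$ is the natural logarithm. For every $\varepsilon>0$ there is a constant $d_0=d_0(\varepsilon)>0$ such that the following holds. Let $p=p(n)\in[0,1]$ be any function of $n$ such that $d=d(n)=np$ satisfies $d\ge d_0$ for all sufficiently large $n$ and $d=o(n)$ as $n\to\infty$. Then, with probability tending to $1$ as $n\to\infty$, $G(n,p)$ contains an induced path of length $\max\{0,\lceil(3/2-\varepsilon)\frac nd\log d\rceil\}$ (in particular, one of length at least $(3/2-\varepsilon)\frac nd\log d$). -/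

import Mathlib

open Filter Topology Asymptotics

/-- `G` contains an induced path of length `l`: an induced subgraph isomorphic to the path with
`l` edges, that is, with `l + 1` vertices. -/
def HasInducedPath {V : Type*} (G : SimpleGraph V) (l : ℕ) : Prop :=
  (SimpleGraph.pathGraph (l + 1)).IsIndContained G

/-- The probability that the binomial random graph on the vertex set `Fin n` with edge probability
`p` has the property `P`. -/
noncomputable def probGnp (n : ℕ) (p : unitInterval) (P : SimpleGraph (Fin n) → Prop) : ℝ :=
  (SimpleGraph.binomialRandom (Fin n) p).real {G | P G}

/-!
Write `l = log d`. Counting long induced paths directly fails for small average degree: the second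
moment of the number of induced linear forests on `N ≈ c (n / d) log d` vertices exceeds the square
of the mean by a factor of about `exp (N l / d)`, which is bounded only if `d` is at least about
`√n`. In this dense case (`one_le_probGnp_mul_of_dense`) the second moment method gives the path at
once. In the sparse case the path is assembled from many shorter ones.

*Second moment.* `N` disjoint blocks of `B` vertices are fixed, and the maps counted use each block
exactly once (`blockMap`). For two such maps the overlap pattern records which vertex of one is
which vertex of the other. A pattern with `s` common vertices occurs for a proportion of at most
`(e / (N B)) ^ s` of the maps, and the common edges contribute a factor `p⁻¹` each, so that the sum
over all patterns is a product of transition weights, estimated by the row sums of a transfer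
matrix (`sum_prod_cons_le`). The factor `(1 - p)⁻¹ ^ (s.choose 2)` of the common non-edges is not
a product over positions, but it is at most a sum of two geometric terms
(`inv_one_sub_pow_choose_le`). This gives `one_le_bprob_exists_spans_mul`.

*Concentration.* The sets of pairs whose later block is a given one are independent, and changing
one of them destroys at most one component of a forest with one vertex in each block. By the
concentration inequality for the Hamming distance (`bprob_mul_bprob_le`), a forest with `m₀`
components of `L` vertices, found with probability at least `exp (-N l / d)` up to a factor
`d ^ O(ε)` in the exponent, can be replaced by one with `(1 - O(ε)) m₀` components found with high
probability, as soon as `(ε m₀)² / N = ε² N / L²` exceeds this exponent. Hence `L` may be almost as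
large as `d ^ (1/2)` (`bprob_no_pathForest_le`).

*Linking.* At least a quarter of the vertices lie outside all blocks. Such a vertex links two paths
of the forest if its only neighbours in the forest are one near the end of the first path and one near the
start of the second one. Between two sets containing a constant proportion of the paths there are
about `n (1 - p) ^ N ≈ n / d ^ c` such vertices, up to constants and powers of `log d`, and almost
all of them have no neighbour among the other linking vertices. If this number exceeds the number
`N / L` of paths, that is, if `L > d ^ (c - 1)`, then with high probability every two such sets are
linked (`bprob_bad_linkers_le`). A depth first search in the digraph of links then finds a directed
path through almost all components (`exists_chain_of_arcs`), and the corresponding concatenation is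
an induced path (`exists_isIndPath_of_isPathForest`). The conditions `d ^ (c - 1) < L < d ^ (1/2)`
are compatible exactly for `c < 3/2`.
-/


/-! ### Random subsets of a finite set -/

/-- The expectation of `f S`, where `S` is a random subset of the finite set `E` that contains
each element independently with probability `p`. -/
noncomputable def bexp {α : Type*} [DecidableEq α] (p : ℝ) (E : Finset α) (f : Finset α → ℝ) : ℝ :=
  ∑ S ∈ E.powerset, p ^ S.card * (1 - p) ^ (E \ S).card * f S

open Classical in
/-- The probability that a random subset of `E`, containing each element independently with
probability `p`, has the property `A`. -/
noncomputable def bprob {α : Type*} [DecidableEq α] (p : ℝ) (E : Finset α)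
    (A : Finset α → Prop) : ℝ :=
  bexp p E fun S => if A S then 1 else 0

section RandomSubset

variable {α : Type*} [DecidableEq α] {p : ℝ}

lemma bexp_congr {E : Finset α} {f g : Finset α → ℝ} (h : ∀ S ⊆ E, f S = g S) :
    bexp p E f = bexp p E g :=
  Finset.sum_congr rfl fun S hS => by rw [h S (Finset.mem_powerset.1 hS)]

lemma bexp_mono (hp0 : 0 ≤ p) (hp1 : p ≤ 1) {E : Finset α} {f g : Finset α → ℝ}
    (h : ∀ S ⊆ E, f S ≤ g S) : bexp p E f ≤ bexp p E g :=
  Finset.sum_le_sum fun S hS => mul_le_mul_of_nonneg_left (h S (Finset.mem_powerset.1 hS))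
    (mul_nonneg (pow_nonneg hp0 _) (pow_nonneg (by linarith) _))

lemma bexp_nonneg (hp0 : 0 ≤ p) (hp1 : p ≤ 1) {E : Finset α} {f : Finset α → ℝ}
    (h : ∀ S ⊆ E, 0 ≤ f S) : 0 ≤ bexp p E f :=
  Finset.sum_nonneg fun S hS => mul_nonneg
    (mul_nonneg (pow_nonneg hp0 _) (pow_nonneg (by linarith) _)) (h S (Finset.mem_powerset.1 hS))

lemma bexp_add (E : Finset α) (f g : Finset α → ℝ) :
    bexp p E (fun S => f S + g S) = bexp p E f + bexp p E g := by
  simp only [bexp, mul_add, Finset.sum_add_distrib]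

lemma bexp_const_mul (E : Finset α) (c : ℝ) (f : Finset α → ℝ) :
    bexp p E (fun S => c * f S) = c * bexp p E f := by
  simp only [bexp, Finset.mul_sum]
  exact Finset.sum_congr rfl fun S _ => by ring

lemma bexp_mul_const (E : Finset α) (c : ℝ) (f : Finset α → ℝ) :
    bexp p E (fun S => f S * c) = bexp p E f * c := by
  simp only [bexp, Finset.sum_mul]
  exact Finset.sum_congr rfl fun S _ => by ring

lemma bexp_sum {β : Type*} (E : Finset α) (T : Finset β) (f : β → Finset α → ℝ) :
    bexp p E (fun S => ∑ b ∈ T, f b S) = ∑ b ∈ T, bexp p E (f b) := by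
  simp only [bexp, Finset.mul_sum]
  rw [Finset.sum_comm]

/-- Expectation of a product with one factor for each element of `E`. -/
lemma bexp_prod (E : Finset α) (f h : α → ℝ) :
    bexp p E (fun S => (∏ e ∈ S, f e) * ∏ e ∈ E \ S, h e) =
      ∏ e ∈ E, (p * f e + (1 - p) * h e) := by
  rw [Finset.prod_add, bexp]
  refine Finset.sum_congr rfl fun S _ => ?_
  rw [Finset.prod_mul_distrib, Finset.prod_mul_distrib, Finset.prod_const, Finset.prod_const]
  ring

lemma bexp_one (E : Finset α) : bexp p E (fun _ => 1) = 1 := by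
  have := bexp_prod (p := p) E (fun _ => 1) (fun _ => 1)
  simpa using this

lemma bexp_const (E : Finset α) (c : ℝ) : bexp p E (fun _ => c) = c := by
  have := bexp_mul_const (p := p) E c (fun _ => 1)
  simpa [bexp_one] using this

lemma bexp_insert {a : α} {E : Finset α} (ha : a ∉ E) (f : Finset α → ℝ) :
    bexp p (insert a E) f = (1 - p) * bexp p E f + p * bexp p E fun S => f (insert a S) := by
  rw [bexp, Finset.sum_powerset_insert ha, bexp, bexp, Finset.mul_sum, Finset.mul_sum]
  congr 1
  · refine Finset.sum_congr rfl fun S hS => ?_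
    have haS : a ∉ S := fun h => ha (Finset.mem_powerset.1 hS h)
    rw [Finset.insert_sdiff_of_notMem _ haS, Finset.card_insert_of_notMem (by simp [ha])]
    ring
  · refine Finset.sum_congr rfl fun S hS => ?_
    have haS : a ∉ S := fun h => ha (Finset.mem_powerset.1 hS h)
    rw [Finset.card_insert_of_notMem haS, Finset.insert_sdiff_insert,
      Finset.sdiff_insert_of_notMem ha]
    ring

/-- Random subsets of disjoint sets are independent (Fubini's theorem). -/
lemma bexp_union {E F : Finset α} (hEF : Disjoint E F) (f : Finset α → ℝ) :
    bexp p (E ∪ F) f = bexp p E fun S => bexp p F fun T => f (S ∪ T) := by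
  induction E using Finset.induction_on generalizing f with
  | empty => simp [bexp]
  | insert a E ha ih =>
    rw [Finset.disjoint_insert_left] at hEF
    rw [Finset.insert_union, bexp_insert (by simp [ha, hEF.1]), bexp_insert ha, ih hEF.2, ih hEF.2]
    simp [Finset.insert_union]

/-- A product of functions of disjoint blocks has the product of the expectations as its
expectation. -/
lemma bexp_biUnion_prod {ι : Type*} [DecidableEq ι] (I : Finset ι) (E : ι → Finset α)
    (hE : (I : Set ι).PairwiseDisjoint E) (g : ι → Finset α → ℝ) :
    bexp p (I.biUnion E) (fun S => ∏ i ∈ I, g i (S ∩ E i)) = ∏ i ∈ I, bexp p (E i) (g i) := by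
  induction I using Finset.induction_on with
  | empty => simp [bexp]
  | insert a I ha ih =>
    have hI : (I : Set ι).PairwiseDisjoint E := hE.subset (by simp)
    have hdis : ∀ i ∈ I, Disjoint (E a) (E i) := fun i hi =>
      hE (by simp) (by simp [hi]) (fun h => ha (h ▸ hi))
    have hd : Disjoint (E a) (I.biUnion E) := by
      rw [Finset.disjoint_biUnion_right]; exact hdis
    rw [Finset.biUnion_insert, bexp_union hd, Finset.prod_insert ha, ← ih hI, ← bexp_mul_const]
    refine bexp_congr fun S hS => ?_
    rw [← bexp_const_mul]
    refine bexp_congr fun T hT => ?_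
    rw [Finset.prod_insert ha]
    have h1 : (S ∪ T) ∩ E a = S := by
      rw [Finset.union_inter_distrib_right, Finset.inter_eq_left.2 hS,
        Finset.disjoint_iff_inter_eq_empty.1 (Disjoint.mono_left hT hd.symm), Finset.union_empty]
    rw [h1]
    congr 1
    refine Finset.prod_congr rfl fun i hi => ?_
    rw [Finset.union_inter_distrib_right,
      Finset.disjoint_iff_inter_eq_empty.1 (Disjoint.mono_left hS (hdis i hi)),
      Finset.empty_union]

lemma bprob_congr {E : Finset α} {A B : Finset α → Prop} (h : ∀ S ⊆ E, (A S ↔ B S)) :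
    bprob p E A = bprob p E B :=
  bexp_congr fun S hS => by by_cases hA : A S <;> simp [hA, ← h S hS]

lemma bprob_mono (hp0 : 0 ≤ p) (hp1 : p ≤ 1) {E : Finset α} {A B : Finset α → Prop}
    (h : ∀ S ⊆ E, A S → B S) : bprob p E A ≤ bprob p E B := by
  refine bexp_mono hp0 hp1 fun S hS => ?_
  have := h S hS
  by_cases hA : A S <;> by_cases hB : B S <;> simp_all

lemma bprob_nonneg (hp0 : 0 ≤ p) (hp1 : p ≤ 1) (E : Finset α) (A : Finset α → Prop) :
    0 ≤ bprob p E A :=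
  bexp_nonneg hp0 hp1 fun S _ => by split_ifs <;> norm_num

lemma bprob_le_one (hp0 : 0 ≤ p) (hp1 : p ≤ 1) (E : Finset α) (A : Finset α → Prop) :
    bprob p E A ≤ 1 := by
  rw [← bexp_one (p := p) E]
  exact bexp_mono hp0 hp1 fun S _ => by split_ifs <;> norm_num

lemma bprob_not (E : Finset α) (A : Finset α → Prop) :
    bprob p E (fun S => ¬ A S) = 1 - bprob p E A := by
  have h : bprob p E A + bprob p E (fun S => ¬ A S) = 1 := by
    rw [bprob, bprob, ← bexp_add]
    refine Eq.trans (bexp_congr fun S _ => ?_) (bexp_one (p := p) E)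
    by_cases h : A S <;> simp [h]
  linarith

lemma bprob_or_le (hp0 : 0 ≤ p) (hp1 : p ≤ 1) (E : Finset α) (A B : Finset α → Prop) :
    bprob p E (fun S => A S ∨ B S) ≤ bprob p E A + bprob p E B := by
  rw [bprob, bprob, bprob, ← bexp_add]
  refine bexp_mono hp0 hp1 fun S _ => ?_
  by_cases hA : A S <;> by_cases hB : B S <;> simp [hA, hB]

lemma bprob_exists_le {β : Type*} (hp0 : 0 ≤ p) (hp1 : p ≤ 1) (E : Finset α) (T : Finset β)
    (A : β → Finset α → Prop) :
    bprob p E (fun S => ∃ b ∈ T, A b S) ≤ ∑ b ∈ T, bprob p E (A b) := by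
  classical
  simp only [bprob]
  rw [← bexp_sum]
  refine bexp_mono hp0 hp1 fun S _ => ?_
  have hnn : ∀ b ∈ T, (0 : ℝ) ≤ if A b S then 1 else 0 := fun b _ => by split_ifs <;> norm_num
  split_ifs with h
  · obtain ⟨b, hb, hA⟩ := h
    refine le_trans ?_ (Finset.single_le_sum hnn hb)
    simp [hA]
  · exact Finset.sum_nonneg hnn

/-- The probability that a pairwise incompatible family of events occurs is the sum of the
probabilities. -/
lemma sum_bprob_le {β : Type*} (hp0 : 0 ≤ p) (hp1 : p ≤ 1) (E : Finset α) (T : Finset β)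
    (A : β → Finset α → Prop) (hA : ∀ S, ∀ b ∈ T, ∀ c ∈ T, A b S → A c S → b = c) :
    ∑ b ∈ T, bprob p E (A b) ≤ bprob p E (fun S => ∃ b ∈ T, A b S) := by
  classical
  simp only [bprob]
  rw [← bexp_sum]
  refine bexp_mono hp0 hp1 fun S _ => ?_
  split_ifs with h
  · obtain ⟨b, hb, hbS⟩ := h
    rw [Finset.sum_eq_single b]
    · simp [hbS]
    · intro c hc hcb
      rw [if_neg fun h => hcb (hA S c hc b hb h hbS)]
    · exact fun h => absurd hb h
  · push Not at h
    rw [Finset.sum_eq_zero fun b hb => if_neg (h b hb)]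

/-- Markov's inequality. -/
lemma bprob_le_bexp (hp0 : 0 ≤ p) (hp1 : p ≤ 1) (E : Finset α) (A : Finset α → Prop)
    (f : Finset α → ℝ) (hf : ∀ S ⊆ E, 0 ≤ f S) (hA : ∀ S ⊆ E, A S → 1 ≤ f S) :
    bprob p E A ≤ bexp p E f := by
  refine bexp_mono hp0 hp1 fun S hS => ?_
  split_ifs with h
  · exact hA S hS h
  · exact hf S hS

/-- Probability of a cylinder: the elements of `P` are present and those of `A` are absent. -/
lemma bprob_cylinder {E P A : Finset α} (hP : P ⊆ E) (hA : A ⊆ E) (hPA : Disjoint P A) :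
    bprob p E (fun S => P ⊆ S ∧ Disjoint A S) = p ^ P.card * (1 - p) ^ A.card := by
  classical
  have key := bexp_prod (p := p) E (fun e => if e ∈ A then 0 else 1)
    (fun e => if e ∈ P then 0 else 1)
  have h1 : bprob p E (fun S => P ⊆ S ∧ Disjoint A S) =
      bexp p E (fun S => (∏ e ∈ S, (if e ∈ A then (0 : ℝ) else 1)) *
        ∏ e ∈ E \ S, if e ∈ P then (0 : ℝ) else 1) := by
    refine bexp_congr fun S hS => ?_
    have hd : Disjoint A S ↔ ∀ e ∈ S, e ∉ A := by
      rw [disjoint_comm, Finset.disjoint_left]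
    split_ifs with h
    · obtain ⟨h1, h2⟩ := h
      rw [Finset.prod_eq_one, Finset.prod_eq_one]
      · norm_num
      · intro e he
        rw [if_neg fun hP => (Finset.mem_sdiff.1 he).2 (h1 hP)]
      · intro e he
        rw [if_neg (hd.1 h2 e he)]
    · symm
      by_cases h2 : Disjoint A S
      · have h3 : ¬ P ⊆ S := fun h3 => h ⟨h3, h2⟩
        obtain ⟨e, he, heS⟩ := Finset.not_subset.1 h3
        rw [Finset.prod_eq_zero (i := e) (s := E \ S)]
        · simp
        · simp [hP he, heS]
        · simp [he]
      · rw [hd] at h2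
        push Not at h2
        obtain ⟨e, he, heA⟩ := h2
        rw [Finset.prod_eq_zero (i := e) (s := S) he (by simp [heA])]
        simp
  rw [h1, key]
  have h2 : ∀ e ∈ E, (p * (if e ∈ A then (0 : ℝ) else 1) + (1 - p) * (if e ∈ P then 0 else 1)) =
      (if e ∈ P then p else 1) * (if e ∈ A then 1 - p else 1) := by
    intro e _
    by_cases heA : e ∈ A
    · have : e ∉ P := fun h => Finset.disjoint_left.1 hPA h heA
      simp [heA, this]
    · by_cases heP : e ∈ P <;> simp [heA, heP]
  rw [Finset.prod_congr rfl h2, Finset.prod_mul_distrib, Finset.prod_ite, Finset.prod_ite]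
  simp [Finset.filter_mem_eq_inter, Finset.inter_eq_right.2 hP, Finset.inter_eq_right.2 hA]

/-- The second moment method (Cauchy-Schwarz inequality). -/
lemma sq_bexp_le (hp0 : 0 ≤ p) (hp1 : p ≤ 1) (E : Finset α) (X : Finset α → ℝ) :
    bexp p E X ^ 2 ≤ bprob p E (fun S => X S ≠ 0) * bexp p E fun S => X S ^ 2 := by
  classical
  have hw : ∀ S, 0 ≤ p ^ S.card * (1 - p) ^ (E \ S).card := fun S =>
    mul_nonneg (pow_nonneg hp0 _) (pow_nonneg (by linarith) _)
  have key := Finset.sum_mul_sq_le_sq_mul_sq E.powerset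
    (fun S => √(p ^ S.card * (1 - p) ^ (E \ S).card) * if X S ≠ 0 then 1 else 0)
    (fun S => √(p ^ S.card * (1 - p) ^ (E \ S).card) * X S)
  have e1 : bexp p E X = ∑ S ∈ E.powerset,
      (√(p ^ S.card * (1 - p) ^ (E \ S).card) * if X S ≠ 0 then 1 else 0) *
      (√(p ^ S.card * (1 - p) ^ (E \ S).card) * X S) := by
    refine Finset.sum_congr rfl fun S _ => ?_
    have := Real.mul_self_sqrt (hw S)
    split_ifs with h
    · nth_rewrite 1 [← this]; ring
    · simp only [ne_eq, not_not] at h; simp [h]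
  rw [e1]
  refine key.trans (le_of_eq ?_)
  congr 1
  · refine Finset.sum_congr rfl fun S _ => ?_
    rw [mul_pow, Real.sq_sqrt (hw S)]
    by_cases h : X S = 0 <;> simp [h]
  · refine Finset.sum_congr rfl fun S _ => ?_
    rw [mul_pow, Real.sq_sqrt (hw S)]

/-- Conditioning on the part of the random subset in `E`. -/
lemma bprob_union_ge (hp0 : 0 ≤ p) (hp1 : p ≤ 1) {E F : Finset α} (hEF : Disjoint E F)
    (A B : Finset α → Prop) {c : ℝ}
    (h : ∀ S ⊆ E, A S → c ≤ bprob p F fun T => B (S ∪ T)) :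
    bprob p E A * c ≤ bprob p (E ∪ F) B := by
  classical
  rw [bprob, bprob, bexp_union hEF, ← bexp_mul_const]
  refine bexp_mono hp0 hp1 fun S hS => ?_
  split_ifs with hA
  · rw [one_mul]; exact h S hS hA
  · rw [zero_mul]; exact bprob_nonneg hp0 hp1 _ _

end RandomSubset

/-! ### The binomial random graph as a random set of pairs -/

/-- The set of potential edges on the vertex set `V`. -/
def pairSet (V : Type*) [Fintype V] [DecidableEq V] : Finset (Sym2 V) :=
  Finset.univ.filter fun e => ¬ e.IsDiag

lemma probGnp_eq_bprob (n : ℕ) (p : unitInterval) (P : SimpleGraph (Fin n) → Prop) :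
    probGnp n p P =
      bprob (p : ℝ) (pairSet (Fin n)) fun S => P (SimpleGraph.fromEdgeSet (S : Set _)) := by
  classical
  have hcoe : ((pairSet (Fin n) : Finset (Sym2 (Fin n))) : Set (Sym2 (Fin n))) =
      Sym2.diagSetᶜ := by
    ext e; simp [pairSet]
  have hset : {S | S ∈ SimpleGraph.edgeSet '' {G : SimpleGraph (Fin n) | P G} ∧
      S ⊆ Sym2.diagSetᶜ} =
      ((((pairSet (Fin n)).powerset.filter fun S : Finset (Sym2 (Fin n)) =>
        P (SimpleGraph.fromEdgeSet (S : Set (Sym2 (Fin n))))).image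
        (fun S : Finset (Sym2 (Fin n)) => (S : Set (Sym2 (Fin n)))) :
          Finset (Set (Sym2 (Fin n)))) : Set (Set (Sym2 (Fin n)))) := by
    ext S
    simp only [Finset.coe_image, Set.mem_image, Finset.mem_coe, Finset.mem_filter,
      Finset.mem_powerset]
    constructor
    · rintro ⟨⟨G, hG, rfl⟩, h2⟩
      refine ⟨(Set.toFinite G.edgeSet).toFinset, ⟨?_, ?_⟩, by simp⟩
      · rw [← Finset.coe_subset, hcoe]; simp
      · simpa using hG
    · rintro ⟨T, ⟨h1, h2⟩, rfl⟩
      rw [← Finset.coe_subset, hcoe] at h1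
      refine ⟨⟨_, h2, ?_⟩, h1⟩
      rw [SimpleGraph.edgeSet_fromEdgeSet, sdiff_eq_left, ← Set.subset_compl_iff_disjoint_right]
      exact h1
  rw [probGnp, MeasureTheory.measureReal_def, SimpleGraph.binomialRandom_apply',
    ProbabilityTheory.setBernoulli_apply_eq_apply_subsets, ← MeasureTheory.measureReal_def, hset,
    ← MeasureTheory.sum_measureReal_singleton, Finset.sum_image (by simp), Finset.sum_filter,
    bprob, bexp]
  refine Finset.sum_congr rfl fun S hS => ?_
  have hS' : (S : Set (Sym2 (Fin n))) ⊆ Sym2.diagSetᶜ := by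
    rw [← hcoe]; exact_mod_cast Finset.mem_powerset.1 hS
  split_ifs
  · rw [ProbabilityTheory.setBernoulli_real_singleton p hS' (Set.toFinite _), ← hcoe,
      ← Finset.coe_sdiff, Set.ncard_coe_finset, Set.ncard_coe_finset, mul_one]
  · simp

/-! ### Concentration of measure in the Hamming distance -/

section Hamming

variable {α ι : Type*} [DecidableEq α] [DecidableEq ι] {p : ℝ}

/-- The exponential inequality behind Talagrand's concentration inequality for the Hamming distance
on a product space. The factors of the product are the random subsets of the blocks `E i`, and `D`
is any lower bound for the Hamming distance to the event `A`. The proof is by induction on the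
number of blocks: once the subset `x` of a block is fixed, the distance to `A` is at most the
distance to the section of `A` at `x`, and at most one more than the distance to the most likely
section. -/
lemma bprob_mul_bexp_exp_le (hp0 : 0 ≤ p) (hp1 : p ≤ 1) (t : ℝ)
    (I : Finset ι) (E : ι → Finset α) (hE : (I : Set ι).PairwiseDisjoint E)
    (A : Finset α → Prop) (D : Finset α → ℝ)
    (hD : ∀ S ⊆ I.biUnion E, ∀ S' ⊆ I.biUnion E, A S' →
      D S ≤ (I.filter fun i => S ∩ E i ≠ S' ∩ E i).card) (ht : 0 ≤ t) :
    bprob p (I.biUnion E) A * bexp p (I.biUnion E) (fun S => Real.exp (t * D S)) ≤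
      Real.exp (t ^ 2 / 4) ^ I.card := by
  classical
  induction I using Finset.induction_on generalizing A D with
  | empty =>
    by_cases hA : A ∅
    · have := hD ∅ (by simp) ∅ (by simp) hA
      simp only [Finset.filter_empty, Finset.card_empty, Nat.cast_zero] at this
      have h2 : Real.exp (t * D ∅) ≤ 1 := by
        rw [Real.exp_le_one_iff]; exact mul_nonpos_of_nonneg_of_nonpos ht this
      simpa [bprob, bexp, hA] using h2
    · simp [bprob, bexp, hA]
  | insert a I ha ih =>
    have hI : (I : Set ι).PairwiseDisjoint E := hE.subset (by simp)
    have hdis : ∀ i ∈ I, Disjoint (E a) (E i) := fun i hi =>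
      hE (by simp) (by simp [hi]) (fun h => ha (h ▸ hi))
    have hd : Disjoint (E a) (I.biUnion E) := by
      rw [Finset.disjoint_biUnion_right]; exact hdis
    set U := I.biUnion E with hU
    set K := Real.exp (t ^ 2 / 4) ^ I.card with hK
    have hK0 : 0 < K := by positivity
    set v : Finset α → ℝ := fun x => bprob p U fun y => A (x ∪ y) with hv
    set g : Finset α → ℝ := fun x => bexp p U fun y => Real.exp (t * D (x ∪ y)) with hg
    have hPA : bprob p (E a ∪ U) A = bexp p (E a) v := by rw [bprob, bexp_union hd]; rfl
    have hPg : bexp p (E a ∪ U) (fun S => Real.exp (t * D S)) = bexp p (E a) g := by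
      rw [bexp_union hd]
    rw [Finset.biUnion_insert, hPA, hPg, Finset.card_insert_of_notMem ha, pow_succ, ← hK]
    have hv0 : ∀ x, 0 ≤ v x := fun x => bprob_nonneg hp0 hp1 _ _
    have hg0 : ∀ x, 0 ≤ g x := fun x => bexp_nonneg hp0 hp1 fun _ _ => (Real.exp_pos _).le
    have ecard : ∀ x ⊆ E a, ∀ x' ⊆ E a, ∀ y ⊆ U, ∀ y' ⊆ U,
        (((insert a I).filter fun i => (x ∪ y) ∩ E i ≠ (x' ∪ y') ∩ E i).card : ℝ) =
          (if x = x' then 0 else 1) + ((I.filter fun i => y ∩ E i ≠ y' ∩ E i).card : ℝ) := by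
      intro x hx x' hx' y hy y' hy'
      have e1 : ∀ x ⊆ E a, ∀ y ⊆ U, (x ∪ y) ∩ E a = x := fun x hx y hy => by
        rw [Finset.union_inter_distrib_right, Finset.inter_eq_left.2 hx,
          Finset.disjoint_iff_inter_eq_empty.1 (Disjoint.mono_left hy hd.symm), Finset.union_empty]
      have e2 : ∀ x ⊆ E a, ∀ y, ∀ i ∈ I, (x ∪ y) ∩ E i = y ∩ E i := fun x hx y i hi => by
        rw [Finset.union_inter_distrib_right,
          Finset.disjoint_iff_inter_eq_empty.1 (Disjoint.mono_left hx (hdis i hi)),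
          Finset.empty_union]
      have e3 : (I.filter fun i => (x ∪ y) ∩ E i ≠ (x' ∪ y') ∩ E i) =
          I.filter fun i => y ∩ E i ≠ y' ∩ E i :=
        Finset.filter_congr fun i hi => by rw [e2 x hx y i hi, e2 x' hx' y' i hi]
      rw [Finset.filter_insert, e1 x hx y hy, e1 x' hx' y' hy', e3]
      by_cases h : x = x'
      · simp [h]
      · rw [if_pos h, if_neg h, Finset.card_insert_of_notMem (by simp [ha])]
        push_cast; ring
    obtain ⟨x₀, hx₀, hmax⟩ := Finset.exists_max_image (E a).powerset v ⟨∅, by simp⟩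
    rw [Finset.mem_powerset] at hx₀
    set M := v x₀ with hM
    have hvM : ∀ x ⊆ E a, v x ≤ M := fun x hx => hmax x (Finset.mem_powerset.2 hx)
    have hsub : ∀ x ⊆ E a, ∀ y ⊆ U, x ∪ y ⊆ (insert a I).biUnion E := fun x hx y hy => by
      rw [Finset.biUnion_insert]; exact Finset.union_subset_union hx hy
    have hvg : ∀ x ⊆ E a, v x * g x ≤ K := fun x hx => by
      refine ih hI (fun y => A (x ∪ y)) (fun y => D (x ∪ y)) fun y hy y' hy' hA => ?_
      have := hD _ (hsub x hx y hy) _ (hsub x hx y' hy') hA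
      rwa [ecard x hx x hx y hy y' hy', if_pos rfl, zero_add] at this
    have hMg : ∀ x ⊆ E a, M * g x ≤ Real.exp t * K := fun x hx => by
      have := ih hI (fun y => A (x₀ ∪ y)) (fun y => D (x ∪ y) - 1) fun y hy y' hy' hA => by
        have := hD _ (hsub x hx y hy) _ (hsub x₀ hx₀ y' hy') hA
        rw [ecard x hx x₀ hx₀ y hy y' hy'] at this
        have h1 : (if x = x₀ then (0 : ℝ) else 1) ≤ 1 := by split_ifs <;> norm_num
        linarith
      have e : bexp p U (fun y => Real.exp (t * (D (x ∪ y) - 1))) = Real.exp (-t) * g x := by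
        rw [hg, ← bexp_const_mul]
        refine bexp_congr fun y _ => ?_
        rw [← Real.exp_add]; congr 1; ring
      rw [e] at this
      have h2 : M * g x = Real.exp t * (M * (Real.exp (-t) * g x)) := by
        have : Real.exp t * Real.exp (-t) = 1 := by rw [← Real.exp_add]; simp
        linear_combination (-(M * g x)) * this
      rw [h2]
      exact mul_le_mul_of_nonneg_left this (Real.exp_pos t).le
    -- pointwise linear bound for the conditional exponential moment
    have hlin : ∀ x ⊆ E a,
        M ^ 2 * g x ≤ K * (M * (1 + Real.exp t)) + (-(K * Real.exp t)) * v x := by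
      intro x hx
      have h1 := hvg x hx
      have h2 := mul_le_mul_of_nonneg_left (hMg x hx) (sub_nonneg.2 (hvM x hx))
      have h3 := mul_le_mul_of_nonneg_left h1 (hv0 x₀)
      nlinarith
    have hmean : M ^ 2 * bexp p (E a) g ≤
        K * (M * (1 + Real.exp t)) - K * Real.exp t * bexp p (E a) v := by
      have := bexp_mono (p := p) hp0 hp1 hlin
      rw [bexp_const_mul, bexp_add, bexp_const, bexp_const_mul] at this
      linarith
    have hV0 : 0 ≤ bexp p (E a) v := bexp_nonneg hp0 hp1 fun x _ => hv0 x
    rcases (hv0 x₀).eq_or_lt with hM0 | hMpos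
    · have : bexp p (E a) v = 0 := by
        rw [bexp_congr (g := fun _ => 0) (fun x hx => le_antisymm ((hvM x hx).trans hM0.symm.le)
          (hv0 x)), bexp_const]
      rw [this, zero_mul]; positivity
    · -- the bound is a quadratic polynomial in `V`, whose maximum gives `cosh (t / 2) ^ 2`
      set V := bexp p (E a) v
      set Γ := bexp p (E a) g
      have hcosh : (1 + Real.exp t) ^ 2 ≤ 4 * Real.exp t * Real.exp (t ^ 2 / 4) := by
        have h := Real.cosh_le_exp_half_sq (t / 2)
        have h0 : 0 ≤ Real.cosh (t / 2) := (Real.cosh_pos _).le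
        have h2 : Real.cosh (t / 2) ^ 2 ≤ Real.exp (t ^ 2 / 4) := by
          calc Real.cosh (t / 2) ^ 2 ≤ Real.exp ((t / 2) ^ 2 / 2) ^ 2 := by gcongr
            _ = Real.exp (t ^ 2 / 4) := by rw [← Real.exp_nat_mul]; congr 1; push_cast; ring
        have h3 : 1 + Real.exp t = 2 * Real.exp (t / 2) * Real.cosh (t / 2) := by
          rw [Real.cosh_eq]
          have e1 : Real.exp t = Real.exp (t / 2) * Real.exp (t / 2) := by
            rw [← Real.exp_add]; congr 1; ring
          have e2 : Real.exp (t / 2) * Real.exp (-(t / 2)) = 1 := by rw [← Real.exp_add]; simp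
          rw [e1]; linear_combination -e2
        have h4 : Real.exp t = Real.exp (t / 2) ^ 2 := by
          rw [← Real.exp_nat_mul]; congr 1; push_cast; ring
        calc (1 + Real.exp t) ^ 2 = 4 * Real.exp (t / 2) ^ 2 * Real.cosh (t / 2) ^ 2 := by
              rw [h3]; ring
          _ ≤ 4 * Real.exp (t / 2) ^ 2 * Real.exp (t ^ 2 / 4) := by gcongr
          _ = _ := by rw [← h4]
      have h1 : M ^ 2 * (V * Γ) ≤ V * (K * (M * (1 + Real.exp t)) - K * Real.exp t * V) := by
        have := mul_le_mul_of_nonneg_left hmean hV0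
        linarith
      have h2 : V * (M * (1 + Real.exp t) - Real.exp t * V) * (4 * Real.exp t) ≤
          M ^ 2 * (1 + Real.exp t) ^ 2 := by
        nlinarith [sq_nonneg (M * (1 + Real.exp t) - 2 * Real.exp t * V)]
      have h3 : V * (M * (1 + Real.exp t) - Real.exp t * V) ≤ M ^ 2 * Real.exp (t ^ 2 / 4) := by
        have h4 := mul_le_mul_of_nonneg_left hcosh (sq_nonneg M)
        have h5 : V * (M * (1 + Real.exp t) - Real.exp t * V) * (4 * Real.exp t) ≤
          M ^ 2 * Real.exp (t ^ 2 / 4) * (4 * Real.exp t) := by linarith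
        exact le_of_mul_le_mul_right h5 (by positivity)
      have h6 : M ^ 2 * (V * Γ) ≤ M ^ 2 * (K * Real.exp (t ^ 2 / 4)) := by
        have := mul_le_mul_of_nonneg_left h3 hK0.le
        nlinarith
      exact le_of_mul_le_mul_left h6 (by positivity)

/-- Two events at Hamming distance at least `s` cannot both be likely. -/
lemma bprob_mul_bprob_le (hp0 : 0 ≤ p) (hp1 : p ≤ 1)
    (I : Finset ι) (E : ι → Finset α) (hE : (I : Set ι).PairwiseDisjoint E)
    (A B : Finset α → Prop) (s : ℝ) (hs : 0 ≤ s) (hI : 0 < I.card)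
    (hAB : ∀ S ⊆ I.biUnion E, ∀ S' ⊆ I.biUnion E, B S → A S' →
      s ≤ (I.filter fun i => S ∩ E i ≠ S' ∩ E i).card) :
    bprob p (I.biUnion E) A * bprob p (I.biUnion E) B ≤ Real.exp (-(s ^ 2 / I.card)) := by
  classical
  have hN : (0 : ℝ) < I.card := by exact_mod_cast hI
  -- this value minimizes `I.card * t ^ 2 / 4 - t * s`
  set t := 2 * s / I.card with ht
  have key := bprob_mul_bexp_exp_le hp0 hp1 t I E hE A (fun S => if B S then s else 0)
    (fun S hS S' hS' hA => by
      split_ifs with hB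
      · exact hAB S hS S' hS' hB hA
      · positivity) (by positivity)
  have h1 : Real.exp (t * s) * bprob p (I.biUnion E) B ≤
      bexp p (I.biUnion E) (fun S => Real.exp (t * if B S then s else 0)) := by
    rw [bprob, ← bexp_const_mul]
    refine bexp_mono hp0 hp1 fun S _ => ?_
    split_ifs <;> simp
  have h2 := (mul_le_mul_of_nonneg_left h1 (bprob_nonneg hp0 hp1 (I.biUnion E) A)).trans key
  rw [← Real.exp_nat_mul] at h2
  have h3 : Real.exp (I.card * (t ^ 2 / 4)) = Real.exp (t * s) * Real.exp (-(s ^ 2 / I.card)) := by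
    rw [← Real.exp_add]; congr 1; rw [ht]; field_simp; ring
  rw [h3] at h2
  refine le_of_mul_le_mul_left (a := Real.exp (t * s)) ?_ (Real.exp_pos _)
  linarith

end Hamming

/-! ### The second moment of the number of induced linear forests -/

/-- The graph on `Fin N` in which `i` is joined to `i + 1` whenever `lk (i + 1)` holds: a linear
forest whose components are intervals. -/
def linForest (lk : ℕ → Prop) (N : ℕ) : SimpleGraph (Fin N) where
  Adj i j := ((j : ℕ) = i + 1 ∧ lk j) ∨ ((i : ℕ) = j + 1 ∧ lk i)
  symm := ⟨fun _ _ h => h.symm⟩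
  loopless := ⟨fun i h => by rcases h with h | h <;> omega⟩

/-- The map `φ` is an embedding of `H` into the graph with edge set `S` as an induced subgraph,
provided that `φ` is injective. -/
def Spans {V W : Type*} (H : SimpleGraph W) (S : Finset (Sym2 V)) (φ : W → V) : Prop :=
  ∀ i j, i ≠ j → (s(φ i, φ j) ∈ S ↔ H.Adj i j)

section Joint

variable {V W : Type*} [DecidableEq V] [Finite W] {p : ℝ}

/-- The images under `φ` of the edges of `H`. -/
noncomputable def edgeImage (H : SimpleGraph W) (φ : W → V) : Finset (Sym2 V) :=
  (Set.toFinite H.edgeSet).toFinset.image (Sym2.map φ)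

lemma mem_edgeImage {H : SimpleGraph W} {φ : W → V} {e : Sym2 V} :
    e ∈ edgeImage H φ ↔ ∃ i j, H.Adj i j ∧ e = s(φ i, φ j) := by
  simp only [edgeImage, Finset.mem_image, Set.Finite.mem_toFinset]
  constructor
  · rintro ⟨e, he, rfl⟩
    induction e using Sym2.ind with
    | _ i j => exact ⟨i, j, he, by simp⟩
  · rintro ⟨i, j, h, rfl⟩
    exact ⟨s(i, j), h, by simp⟩

lemma card_edgeImage (H : SimpleGraph W) {φ : W → V} (hφ : Function.Injective φ) :
    (edgeImage H φ).card = H.edgeSet.ncard := by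
  rw [edgeImage, Finset.card_image_of_injective _ (Sym2.map.injective hφ),
    Set.ncard_eq_toFinset_card _ (Set.toFinite _)]

lemma spans_iff {H : SimpleGraph W} {S : Finset (Sym2 V)} {φ : W → V} :
    Spans H S φ ↔ edgeImage H φ ⊆ S ∧ Disjoint (edgeImage Hᶜ φ) S := by
  constructor
  · intro h
    refine ⟨fun e he => ?_, Finset.disjoint_left.2 fun e he heS => ?_⟩
    · obtain ⟨i, j, hij, rfl⟩ := mem_edgeImage.1 he
      exact (h i j hij.ne).2 hij
    · obtain ⟨i, j, hij, rfl⟩ := mem_edgeImage.1 he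
      rw [SimpleGraph.compl_adj] at hij
      exact hij.2 ((h i j hij.1).1 heS)
  · rintro ⟨h1, h2⟩ i j hij
    refine ⟨fun h => ?_, fun h => h1 (mem_edgeImage.2 ⟨i, j, h, rfl⟩)⟩
    by_contra hn
    exact Finset.disjoint_left.1 h2
      (mem_edgeImage.2 ⟨i, j, by rw [SimpleGraph.compl_adj]; exact ⟨hij, hn⟩, rfl⟩) h

lemma disjoint_edgeImage_compl (H : SimpleGraph W) {φ : W → V} (hφ : Function.Injective φ) :
    Disjoint (edgeImage H φ) (edgeImage Hᶜ φ) := by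
  rw [Finset.disjoint_left]
  intro e h1 h2
  obtain ⟨i, j, hij, rfl⟩ := mem_edgeImage.1 h1
  obtain ⟨k, l, hkl, h⟩ := mem_edgeImage.1 h2
  rw [SimpleGraph.compl_adj] at hkl
  rw [Sym2.eq_iff] at h
  rcases h with ⟨h1, h2⟩ | ⟨h1, h2⟩
  · rw [hφ h1, hφ h2] at hij; exact hkl.2 hij
  · rw [hφ h1, hφ h2] at hij; exact hkl.2 hij.symm

lemma edgeImage_subset {H : SimpleGraph W} {φ : W → V} {E : Finset (Sym2 V)}
    (hE : ∀ i j, i ≠ j → s(φ i, φ j) ∈ E) : edgeImage H φ ⊆ E := fun e he => by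
  obtain ⟨i, j, hij, rfl⟩ := mem_edgeImage.1 he
  exact hE i j hij.ne

lemma bprob_spans {H : SimpleGraph W} {φ : W → V} (hφ : Function.Injective φ)
    {E : Finset (Sym2 V)} (hE : ∀ i j, i ≠ j → s(φ i, φ j) ∈ E) :
    bprob p E (fun S => Spans H S φ) =
      p ^ H.edgeSet.ncard * (1 - p) ^ Hᶜ.edgeSet.ncard := by
  simp only [spans_iff]
  rw [bprob_cylinder (edgeImage_subset hE) (edgeImage_subset hE)
    (disjoint_edgeImage_compl H hφ), card_edgeImage _ hφ, card_edgeImage _ hφ]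

/-- The probability that two maps both span `H`, in terms of the overlap of their images: `x` and
`y` bound the number of common edges and of common non-edges. -/
lemma bprob_spans_and_le (hp0 : 0 < p) (hp1 : p < 1) {H : SimpleGraph W} {φ ψ : W → V}
    (hφ : Function.Injective φ) (hψ : Function.Injective ψ)
    {E : Finset (Sym2 V)} (hE : ∀ i j, i ≠ j → s(φ i, φ j) ∈ E)
    (hE' : ∀ i j, i ≠ j → s(ψ i, ψ j) ∈ E) {x y : ℕ}
    (hx : (edgeImage H φ ∩ edgeImage H ψ).card ≤ x)
    (hy : (edgeImage Hᶜ φ ∩ edgeImage Hᶜ ψ).card ≤ y) :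
    bprob p E (fun S => Spans H S φ ∧ Spans H S ψ) ≤
      (p ^ H.edgeSet.ncard * (1 - p) ^ Hᶜ.edgeSet.ncard) ^ 2 *
        (p⁻¹ ^ x * (1 - p)⁻¹ ^ y) := by
  have hq : 0 < 1 - p := by linarith
  by_cases hd : Disjoint (edgeImage H φ ∪ edgeImage H ψ) (edgeImage Hᶜ φ ∪ edgeImage Hᶜ ψ)
  · have h1 : bprob p E (fun S => Spans H S φ ∧ Spans H S ψ) =
        bprob p E (fun S => edgeImage H φ ∪ edgeImage H ψ ⊆ S ∧
          Disjoint (edgeImage Hᶜ φ ∪ edgeImage Hᶜ ψ) S) := by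
      refine bprob_congr fun S _ => ?_
      rw [spans_iff, spans_iff, Finset.union_subset_iff, Finset.disjoint_union_left]
      tauto
    rw [h1, bprob_cylinder (Finset.union_subset (edgeImage_subset hE) (edgeImage_subset hE'))
      (Finset.union_subset (edgeImage_subset hE) (edgeImage_subset hE')) hd]
    have key : ∀ (r : ℝ), 0 < r → r ≤ 1 → ∀ (A B : Finset (Sym2 V)) (z c : ℕ), A.card = c →
        B.card = c → (A ∩ B).card ≤ z → r ^ (A ∪ B).card ≤ (r ^ c) ^ 2 * r⁻¹ ^ z := by
      intro r hr0 hr1 A B z c hA hB hz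
      have h2 := Finset.card_union_add_card_inter A B
      have h3 : r ^ (A ∪ B).card * r ^ (A ∩ B).card = (r ^ c) ^ 2 := by
        rw [← pow_add, h2, hA, hB]; ring
      have h4 : r ^ (A ∪ B).card = (r ^ c) ^ 2 * r⁻¹ ^ (A ∩ B).card := by
        rw [← h3, mul_assoc, ← mul_pow, mul_inv_cancel₀ hr0.ne', one_pow, mul_one]
      rw [h4]
      gcongr
      exact (one_le_inv₀ hr0).2 hr1
    have k1 := key p hp0 hp1.le _ _ x _ (card_edgeImage H hφ) (card_edgeImage H hψ) hx
    have k2 := key (1 - p) hq (by linarith) _ _ y _ (card_edgeImage Hᶜ hφ)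
      (card_edgeImage Hᶜ hψ) hy
    calc _ ≤ ((p ^ H.edgeSet.ncard) ^ 2 * p⁻¹ ^ x) *
          (((1 - p) ^ Hᶜ.edgeSet.ncard) ^ 2 * (1 - p)⁻¹ ^ y) :=
          mul_le_mul k1 k2 (by positivity) (by positivity)
      _ = _ := by ring
  · have h1 : bprob p E (fun S => Spans H S φ ∧ Spans H S ψ) = bprob p E (fun _ => False) := by
      refine bprob_congr fun S _ => ?_
      rw [spans_iff, spans_iff, iff_false]
      rintro ⟨⟨a, b⟩, c, d⟩
      refine hd (Disjoint.mono_left (Finset.union_subset a c) ?_)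
      rw [disjoint_comm, Finset.disjoint_union_left]
      exact ⟨b, d⟩
    rw [h1]
    simp only [bprob, if_false, bexp_const]
    positivity

end Joint

/-! ### Weights of overlap patterns -/

section Pattern

/-- Transfer matrix bound: a sum over sequences of products of transition weights. -/
lemma sum_prod_cons_le {X : Type*} [Fintype X] (C : ℝ) (hC : 0 ≤ C) (n : ℕ)
    (g : ℕ → X → X → ℝ) (hg0 : ∀ i x y, 0 ≤ g i x y) (hg : ∀ i x, ∑ y, g i x y ≤ C) (x : X) :
    ∑ τ : Fin n → X, ∏ i : Fin n, g i ((Fin.cons x τ : Fin (n + 1) → X) i.castSucc) (τ i) ≤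
      C ^ n := by
  induction n generalizing g x with
  | zero => simp
  | succ n ih =>
    rw [← (Fin.consEquiv fun _ : Fin (n + 1) => X).sum_comp, Fintype.sum_prod_type]
    have h : ∀ y, ∀ τ : Fin n → X, (∏ i : Fin (n + 1),
        g i ((Fin.cons x ((Fin.consEquiv fun _ : Fin (n + 1) => X) (y, τ)) :
          Fin (n + 2) → X) i.castSucc) (((Fin.consEquiv fun _ : Fin (n + 1) => X) (y, τ)) i)) =
        g 0 x y * ∏ i : Fin n, g (i + 1) ((Fin.cons y τ : Fin (n + 1) → X) i.castSucc) (τ i) := by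
      intro y τ
      rw [Fin.prod_univ_succ]
      simp [Fin.consEquiv]
    simp only [h, ← Finset.mul_sum]
    calc ∑ y, g 0 x y * ∑ τ : Fin n → X, ∏ i : Fin n,
          g (i + 1) ((Fin.cons y τ : Fin (n + 1) → X) i.castSucc) (τ i)
        ≤ ∑ y, g 0 x y * C ^ n := Finset.sum_le_sum fun y _ => mul_le_mul_of_nonneg_left
          (ih (fun i => g (i + 1)) (fun i => hg0 (i + 1)) (fun i => hg (i + 1)) y) (hg0 _ _ _)
      _ ≤ C * C ^ n := by
          rw [← Finset.sum_mul]; exact mul_le_mul_of_nonneg_right (hg 0 x) (by positivity)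
      _ = C ^ (n + 1) := by ring

open Classical in
/-- The weight of the position `i` in an overlap pattern, where `x` and `y` are the images of
`i - 1` and of `i`, if they are in the overlap. A position in the overlap gets the weight `z`,
with an additional factor `p⁻¹` if the edge to its predecessor is in the overlap as well; in this
case the images have to be consecutive. -/
noncomputable def patWeight {N : ℕ} (lk : ℕ → Prop) (p z : ℝ) (i : ℕ) :
    Option (Fin N) → Option (Fin N) → ℝ
  | _, none => 1
  | none, some _ => z
  | some k, some j =>
    if lk i then (if (j : ℕ) = k + 1 ∨ (k : ℕ) = j + 1 then z * p⁻¹ else 0) else z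

variable {N : ℕ} {lk : ℕ → Prop} {p z : ℝ}

lemma patWeight_nonneg (hp : 0 < p) (hz : 0 ≤ z) (i : ℕ) (x y : Option (Fin N)) :
    0 ≤ patWeight lk p z i x y := by
  rcases x with _ | k <;> rcases y with _ | j <;> simp only [patWeight] <;> (try split_ifs) <;>
    positivity

lemma patWeight_eq (i : ℕ) (x y : Option (Fin N)) :
    patWeight lk p z i x y = (if y = none then 1 else z) * patWeight lk p 1 i x y := by
  rcases x with _ | k <;> rcases y with _ | j <;> simp [patWeight]

/-- The row sums of the transfer matrix. The image of a position is arbitrary in general, but one of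
at most two vertices if the edge to the predecessor is in the overlap. -/
lemma sum_patWeight_le (hp : 0 < p) (hz : 0 ≤ z) (i : ℕ) (x : Option (Fin N)) :
    ∑ y, patWeight lk p z i x y ≤ 1 + (N + 2 * p⁻¹) * z := by
  classical
  have hp' : 0 ≤ p⁻¹ := by positivity
  rw [Fintype.sum_option]
  have h0 : patWeight lk p z i x none = 1 := by rcases x <;> simp [patWeight]
  rw [h0]
  rcases x with _ | k
  · simp only [patWeight, Finset.sum_const, Finset.card_univ, Fintype.card_fin, nsmul_eq_mul]
    nlinarith [mul_nonneg hp' hz]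
  · by_cases hl : lk i
    · simp only [patWeight, hl, if_true]
      rw [← Finset.sum_filter, Finset.sum_const, nsmul_eq_mul]
      have hcard : (Finset.univ.filter fun j : Fin N => (j : ℕ) = k + 1 ∨ (k : ℕ) = j + 1).card
          ≤ 2 := by
        have hsub : ((Finset.univ.filter fun j : Fin N =>
            (j : ℕ) = k + 1 ∨ (k : ℕ) = j + 1).image fun j : Fin N => (j : ℕ)) ⊆
            {(k : ℕ) + 1, (k : ℕ) - 1} := by
          intro m hm
          simp only [Finset.mem_image, Finset.mem_filter, Finset.mem_univ, true_and] at hm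
          obtain ⟨j, hj, rfl⟩ := hm
          simp only [Finset.mem_insert, Finset.mem_singleton]
          omega
        calc _ = _ := (Finset.card_image_of_injective _ Fin.val_injective).symm
          _ ≤ _ := Finset.card_le_card hsub
          _ ≤ 2 := Finset.card_le_two
      have : (((Finset.univ.filter fun j : Fin N =>
          (j : ℕ) = k + 1 ∨ (k : ℕ) = j + 1).card : ℕ) : ℝ) ≤ 2 := by exact_mod_cast hcard
      have hN : (0 : ℝ) ≤ N * z := by positivity
      nlinarith [mul_le_mul_of_nonneg_right this (mul_nonneg hz hp')]
    · simp only [patWeight, hl, if_false, Finset.sum_const, Finset.card_univ, Fintype.card_fin,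
        nsmul_eq_mul]
      nlinarith [mul_nonneg hp' hz]

/-- The weight of an overlap pattern `τ`. -/
noncomputable def patProd (lk : ℕ → Prop) (p z : ℝ) (τ : Fin N → Option (Fin N)) : ℝ :=
  ∏ i : Fin N, patWeight lk p z i ((Fin.cons none τ : Fin (N + 1) → Option (Fin N)) i.castSucc)
    (τ i)

/-- The positions in the overlap. -/
def patDom (τ : Fin N → Option (Fin N)) : Finset (Fin N) := Finset.univ.filter fun i => τ i ≠ none

lemma patProd_eq (τ : Fin N → Option (Fin N)) :
    patProd lk p z τ = z ^ (patDom τ).card * patProd lk p 1 τ := by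
  classical
  have h : ∀ i ∈ (Finset.univ : Finset (Fin N)), patWeight lk p z i
      ((Fin.cons none τ : Fin (N + 1) → Option (Fin N)) i.castSucc) (τ i) =
      (if τ i = none then 1 else z) * patWeight lk p 1 i
        ((Fin.cons none τ : Fin (N + 1) → Option (Fin N)) i.castSucc) (τ i) :=
    fun i _ => patWeight_eq _ _ _
  rw [patProd, Finset.prod_congr rfl h, Finset.prod_mul_distrib, patProd, Finset.prod_ite, patDom]
  simp

lemma patProd_nonneg (hp : 0 < p) (hz : 0 ≤ z) (τ : Fin N → Option (Fin N)) :
    0 ≤ patProd lk p z τ := Finset.prod_nonneg fun _ _ => patWeight_nonneg hp hz _ _ _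

lemma sum_patProd_le (hp : 0 < p) (hz : 0 ≤ z) :
    ∑ τ : Fin N → Option (Fin N), patProd lk p z τ ≤ (1 + (N + 2 * p⁻¹) * z) ^ N :=
  sum_prod_cons_le _ (by positivity) N (fun i => patWeight lk p z i)
    (fun i => patWeight_nonneg hp hz i) (fun i => sum_patWeight_le hp hz i) none

open Classical in
/-- The positions whose edge to the predecessor lies in the overlap. -/
noncomputable def patEdges (lk : ℕ → Prop) (τ : Fin N → Option (Fin N)) : Finset (Fin N) :=
  Finset.univ.filter fun i => lk i ∧ τ i ≠ none ∧ ∃ k : Fin N, (i : ℕ) = k + 1 ∧ τ k ≠ none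

/-- A pattern that preserves adjacency has the weight determined by its number of edges. -/
lemma inv_pow_patEdges_le (τ : Fin N → Option (Fin N))
    (h : ∀ i k j l : Fin N, (i : ℕ) = k + 1 → lk i → τ i = some j → τ k = some l →
      (j : ℕ) = l + 1 ∨ (l : ℕ) = j + 1) :
    p⁻¹ ^ (patEdges lk τ).card ≤ patProd lk p 1 τ := by
  classical
  rw [← Finset.prod_const, patEdges, Finset.prod_filter, patProd]
  refine le_of_eq (Finset.prod_congr rfl fun i _ => ?_)
  rcases hi : τ i with _ | j
  · simp [patWeight]
  · obtain ⟨i, hi'⟩ := i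
    cases i with
    | zero => simp [patWeight]
    | succ k =>
      have hk : k < N := by omega
      have hcons : (Fin.cons none τ : Fin (N + 1) → Option (Fin N))
          (Fin.castSucc ⟨k + 1, hi'⟩) = τ ⟨k, hk⟩ := by
        have : Fin.castSucc (⟨k + 1, hi'⟩ : Fin N) = Fin.succ ⟨k, hk⟩ := rfl
        rw [this, Fin.cons_succ]
      rw [hcons]
      have hex : (∃ k' : Fin N, ((⟨k + 1, hi'⟩ : Fin N) : ℕ) = k' + 1 ∧ τ k' ≠ none) ↔
          τ ⟨k, hk⟩ ≠ none := by
        constructor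
        · rintro ⟨k', h1, h2⟩
          have : k' = ⟨k, hk⟩ := Fin.ext (by simpa using h1.symm)
          rwa [← this]
        · exact fun h => ⟨⟨k, hk⟩, rfl, h⟩
      simp only [hex]
      rcases hl : τ ⟨k, hk⟩ with _ | l
      · simp [patWeight]
      · by_cases hlk : lk (k + 1)
        · have := h ⟨k + 1, hi'⟩ ⟨k, hk⟩ j l rfl hlk hi hl
          simp [patWeight, hlk, this]
        · simp [patWeight, hlk]

end Pattern

/-! ### The second moment bound -/

section SecondMoment

/-- The estimate `(N - s)! / N! ≤ (e / N) ^ s`, without division. -/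
lemma factorial_mul_pow_le (N s : ℕ) (hs : s ≤ N) :
    ((N - s).factorial : ℝ) * (N : ℝ) ^ s ≤ N.factorial * Real.exp 1 ^ s := by
  induction N generalizing s with
  | zero => simp [Nat.le_zero.1 hs]
  | succ n ih =>
    cases s with
    | zero => simp
    | succ s =>
      have hsn : s ≤ n := by omega
      have h1 := ih s hsn
      have h2 : ((n : ℝ) + 1) ^ s ≤ Real.exp 1 * (n : ℝ) ^ s := by
        rcases Nat.eq_zero_or_pos n with rfl | hn
        · have : s = 0 := by omega
          subst this
          simp only [pow_zero, mul_one]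
          exact Real.one_le_exp (by norm_num)
        · have hn' : (0 : ℝ) < n := by exact_mod_cast hn
          have h3 : (n : ℝ) + 1 ≤ Real.exp (1 / n) * n := by
            have := Real.add_one_le_exp (1 / (n : ℝ))
            calc (n : ℝ) + 1 = (1 / n + 1) * n := by field_simp; ring
              _ ≤ _ := by gcongr
          calc ((n : ℝ) + 1) ^ s ≤ (Real.exp (1 / n) * n) ^ s := by gcongr
            _ = Real.exp (s * (1 / n)) * (n : ℝ) ^ s := by rw [mul_pow, ← Real.exp_nat_mul]
            _ ≤ Real.exp 1 * (n : ℝ) ^ s := by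
              gcongr
              rw [mul_one_div, div_le_one hn']
              exact_mod_cast hsn
      have e : n + 1 - (s + 1) = n - s := by omega
      rw [e, Nat.factorial_succ, pow_succ (Real.exp 1), pow_succ]
      push_cast
      have h4 : ((n - s).factorial : ℝ) * ((n : ℝ) + 1) ^ s ≤
          n.factorial * Real.exp 1 ^ s * Real.exp 1 := by
        calc _ ≤ ((n - s).factorial : ℝ) * (Real.exp 1 * (n : ℝ) ^ s) := by gcongr
          _ = Real.exp 1 * (((n - s).factorial : ℝ) * (n : ℝ) ^ s) := by ring
          _ ≤ Real.exp 1 * (n.factorial * Real.exp 1 ^ s) := by gcongr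
          _ = _ := by ring
      nlinarith [mul_le_mul_of_nonneg_left h4 (by positivity : (0 : ℝ) ≤ n + 1)]

/-- The permutations that agree with a given one on a set `T`. -/
lemma card_perm_agree_le {W : Type*} [Fintype W] [DecidableEq W] (T : Finset W)
    (π₀ : Equiv.Perm W) :
    (Finset.univ.filter fun π : Equiv.Perm W => ∀ j ∈ T, π j = π₀ j).card ≤
      (Fintype.card W - T.card).factorial := by
  classical
  have h1 : Fintype.card {f : Equiv.Perm W // ∀ a, ¬ (a ∉ T) → f a = a} =
      (Fintype.card W - T.card).factorial := by
    rw [← Fintype.card_congr (Equiv.Perm.subtypeEquivSubtypePerm fun a => a ∉ T),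
      Fintype.card_perm]
    congr 1
    rw [Fintype.card_subtype_compl, Fintype.card_coe]
  rw [← h1, ← Fintype.card_subtype]
  refine Fintype.card_le_of_injective (fun π => ⟨π₀⁻¹ * π.1, fun a ha => ?_⟩) ?_
  · rw [Equiv.Perm.mul_apply, π.2 a (not_not.1 ha)]; simp
  · intro π π' h
    simp only [Subtype.mk.injEq, mul_right_inj] at h
    exact Subtype.ext h

lemma card_fun_agree_le {N B : ℕ} (T : Finset (Fin N)) (β₀ : Fin N → Fin B) :
    (Finset.univ.filter fun β : Fin N → Fin B => ∀ j ∈ T, β j = β₀ j).card ≤ B ^ (N - T.card) := by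
  classical
  have h : (Finset.univ.filter fun β : Fin N → Fin B => ∀ j ∈ T, β j = β₀ j) ⊆
      Fintype.piFinset fun j => if j ∈ T then {β₀ j} else Finset.univ := by
    intro β hβ
    simp only [Finset.mem_filter, Finset.mem_univ, true_and] at hβ
    rw [Fintype.mem_piFinset]
    intro j
    by_cases hj : j ∈ T <;> simp [hj, hβ j]
  refine (Finset.card_le_card h).trans (le_of_eq ?_)
  rw [Fintype.card_piFinset]
  have : ∀ j ∈ (Finset.univ : Finset (Fin N)),
      (if j ∈ T then {β₀ j} else (Finset.univ : Finset (Fin B))).card =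
      if j ∈ T then 1 else B := by
    intro j _; split_ifs <;> simp
  rw [Finset.prod_congr rfl this, Finset.prod_ite]
  simp only [Finset.prod_const_one, one_mul, Finset.prod_const]
  congr 1
  have : (Finset.univ.filter fun j : Fin N => j ∉ T) = Tᶜ := by ext; simp
  rw [this, Finset.card_compl, Fintype.card_fin]

variable {V : Type*} {N B : ℕ}

/-- The maps from `Fin N` into a vertex set split into `N` blocks of size `B` that use each block
exactly once: the vertex `j` is mapped into the block `x.1 j`. -/
def blockMap (ι : Fin N × Fin B → V) (x : Equiv.Perm (Fin N) × (Fin N → Fin B)) (j : Fin N) : V :=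
  ι (x.1 j, x.2 j)

lemma blockMap_injective {ι : Fin N × Fin B → V} (hι : Function.Injective ι)
    (x : Equiv.Perm (Fin N) × (Fin N → Fin B)) : Function.Injective (blockMap ι x) := by
  intro j j' h
  have := congrArg Prod.fst (hι h)
  exact x.1.injective this

open Classical in
/-- The overlap pattern of two maps: `i` is sent to the `j` with `ψ j = φ i`, if there is one. -/
noncomputable def overlap (φ ψ : Fin N → V) (i : Fin N) : Option (Fin N) :=
  if h : ∃ j, ψ j = φ i then some h.choose else none

lemma overlap_eq_some {φ ψ : Fin N → V} {i j : Fin N} (h : overlap φ ψ i = some j) :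
    ψ j = φ i := by
  unfold overlap at h
  split_ifs at h with h'
  rw [← Option.some.inj h]
  exact h'.choose_spec

lemma overlap_ne_none {φ ψ : Fin N → V} {i j : Fin N} (h : ψ j = φ i) : overlap φ ψ i ≠ none := by
  unfold overlap
  rw [dif_pos ⟨j, h⟩]
  simp

/-- A given overlap pattern is rare among the maps using each block once. -/
lemma card_overlap_le (hN : 0 < N) (hB : 0 < B) {ι : Fin N × Fin B → V}
    (hι : Function.Injective ι) {φ : Fin N → V} (hφ : Function.Injective φ)
    (τ : Fin N → Option (Fin N)) :
    ((Finset.univ.filter fun x => overlap φ (blockMap ι x) = τ).card : ℝ) ≤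
      N.factorial * (B : ℝ) ^ N * (Real.exp 1 / (N * B)) ^ (patDom τ).card := by
  have hN' : (0 : ℝ) < N := by exact_mod_cast hN
  have hB' : (0 : ℝ) < B := by exact_mod_cast hB
  rcases (Finset.univ.filter fun x => overlap φ (blockMap ι x) = τ).eq_empty_or_nonempty with h | h
  · rw [h]; simp only [Finset.card_empty, Nat.cast_zero]; positivity
  obtain ⟨x₀, hx₀⟩ := h
  simp only [Finset.mem_filter, Finset.mem_univ, true_and] at hx₀
  set T : Finset (Fin N) := Finset.univ.filter fun j => ∃ i, τ i = some j with hT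
  have hcard : T.card = (patDom τ).card := by
    symm
    refine Finset.card_bij (fun i hi => (τ i).get (Option.isSome_iff_ne_none.2
      (Finset.mem_filter.1 hi).2)) ?_ ?_ ?_
    · intro i hi
      simp only [hT, Finset.mem_filter, Finset.mem_univ, true_and]
      exact ⟨i, by simp⟩
    · intro i hi i' hi' h
      have hs : τ i = τ i' := Option.get_inj.1 h
      obtain ⟨j, hj⟩ := Option.ne_none_iff_exists'.1 (Finset.mem_filter.1 hi).2
      rw [← hx₀] at hs hj
      have h1 := overlap_eq_some hj
      have h2 := overlap_eq_some (hs ▸ hj)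
      exact hφ (h1.symm.trans h2)
    · intro j hj
      simp only [hT, Finset.mem_filter, Finset.mem_univ, true_and] at hj
      obtain ⟨i, hi⟩ := hj
      exact ⟨i, by simp [patDom, hi], by simp [hi]⟩
  have hsub : (Finset.univ.filter fun x => overlap φ (blockMap ι x) = τ) ⊆
      (Finset.univ.filter fun π : Equiv.Perm (Fin N) => ∀ j ∈ T, π j = x₀.1 j) ×ˢ
        (Finset.univ.filter fun β : Fin N → Fin B => ∀ j ∈ T, β j = x₀.2 j) := by
    intro x hx
    simp only [Finset.mem_filter, Finset.mem_univ, true_and] at hx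
    have key : ∀ j ∈ T, (x.1 j, x.2 j) = (x₀.1 j, x₀.2 j) := by
      intro j hj
      simp only [hT, Finset.mem_filter, Finset.mem_univ, true_and] at hj
      obtain ⟨i, hi⟩ := hj
      have h1 := overlap_eq_some ((congrFun hx i).trans hi)
      have h2 := overlap_eq_some ((congrFun hx₀ i).trans hi)
      exact hι (h1.trans h2.symm)
    simp only [Finset.mem_product, Finset.mem_filter, Finset.mem_univ, true_and]
    exact ⟨fun j hj => congrArg Prod.fst (key j hj), fun j hj => congrArg Prod.snd (key j hj)⟩
  have h1 := Finset.card_le_card hsub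
  rw [Finset.card_product] at h1
  have hperm : (Finset.univ.filter fun π : Equiv.Perm (Fin N) => ∀ j ∈ T, π j = x₀.1 j).card ≤
      (N - T.card).factorial := by
    have := card_perm_agree_le T x₀.1
    rw [Fintype.card_fin] at this
    convert this
  have h2 := h1.trans (Nat.mul_le_mul hperm (card_fun_agree_le T x₀.2))
  rw [hcard] at h2
  have hsN : (patDom τ).card ≤ N := by simpa using Finset.card_le_univ (patDom τ)
  set s := (patDom τ).card
  have h3 := factorial_mul_pow_le N s hsN
  calc ((Finset.univ.filter fun x => overlap φ (blockMap ι x) = τ).card : ℝ)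
      ≤ ((N - s).factorial : ℝ) * (B : ℝ) ^ (N - s) := by exact_mod_cast h2
    _ = ((N - s).factorial * (N : ℝ) ^ s) * (B : ℝ) ^ (N - s) * B ^ s / ((N : ℝ) * B) ^ s := by
        rw [mul_pow]; field_simp
    _ ≤ (N.factorial * Real.exp 1 ^ s) * (B : ℝ) ^ (N - s) * B ^ s / ((N : ℝ) * B) ^ s := by
        gcongr
    _ = N.factorial * (B : ℝ) ^ N * (Real.exp 1 / (N * B)) ^ s := by
        have : (B : ℝ) ^ N = B ^ (N - s) * B ^ s := by rw [← pow_add, Nat.sub_add_cancel hsN]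
        rw [this, div_pow]; ring

/-- The probability that two maps span a linear forest, in terms of their overlap pattern. -/
lemma bprob_spans_and_le_patProd [DecidableEq V] {p : ℝ} (hp0 : 0 < p) (hp1 : p < 1)
    (lk : ℕ → Prop) {φ ψ : Fin N → V} (hφ : Function.Injective φ) (hψ : Function.Injective ψ)
    {E : Finset (Sym2 V)} (hE : ∀ i j, i ≠ j → s(φ i, φ j) ∈ E)
    (hE' : ∀ i j, i ≠ j → s(ψ i, ψ j) ∈ E) :
    bprob p E (fun S => Spans (linForest lk N) S φ ∧ Spans (linForest lk N) S ψ) ≤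
      (p ^ (linForest lk N).edgeSet.ncard * (1 - p) ^ (linForest lk N)ᶜ.edgeSet.ncard) ^ 2 *
        (patProd lk p 1 (overlap φ ψ) *
          (1 - p)⁻¹ ^ ((patDom (overlap φ ψ)).card.choose 2)) := by
  classical
  have hq : 0 < 1 - p := by linarith
  set τ := overlap φ ψ with hτ
  by_cases hval : ∀ i k j l : Fin N, (i : ℕ) = k + 1 → lk i → τ i = some j → τ k = some l →
      (j : ℕ) = l + 1 ∨ (l : ℕ) = j + 1
  · have hx : (edgeImage (linForest lk N) φ ∩ edgeImage (linForest lk N) ψ).card ≤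
        (patEdges lk τ).card := by
      have hsub : edgeImage (linForest lk N) φ ∩ edgeImage (linForest lk N) ψ ⊆
          (patEdges lk τ).image fun i : Fin N => s(φ ⟨(i : ℕ) - 1, by omega⟩, φ i) := by
        intro e he
        rw [Finset.mem_inter] at he
        obtain ⟨k, i, hki, rfl⟩ := mem_edgeImage.1 he.1
        obtain ⟨l, j, hlj, h⟩ := mem_edgeImage.1 he.2
        have hne : τ k ≠ none ∧ τ i ≠ none := by
          rw [Sym2.eq_iff] at h
          rcases h with ⟨h1, h2⟩ | ⟨h1, h2⟩ <;>
            exact ⟨overlap_ne_none h1.symm, overlap_ne_none h2.symm⟩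
        rw [Finset.mem_image]
        rcases hki with ⟨h1, h2⟩ | ⟨h1, h2⟩
        · refine ⟨i, ?_, ?_⟩
          · simp only [patEdges, Finset.mem_filter, Finset.mem_univ, true_and]
            exact ⟨h2, hne.2, k, h1, hne.1⟩
          · have : (⟨(i : ℕ) - 1, by omega⟩ : Fin N) = k := Fin.ext (by simp; omega)
            rw [this]
        · refine ⟨k, ?_, ?_⟩
          · simp only [patEdges, Finset.mem_filter, Finset.mem_univ, true_and]
            exact ⟨h2, hne.1, i, h1, hne.2⟩
          · have : (⟨(k : ℕ) - 1, by omega⟩ : Fin N) = i := Fin.ext (by simp; omega)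
            rw [this, Sym2.eq_swap]
      exact (Finset.card_le_card hsub).trans Finset.card_image_le
    have hy : (edgeImage (linForest lk N)ᶜ φ ∩ edgeImage (linForest lk N)ᶜ ψ).card ≤
        (patDom τ).card.choose 2 := by
      have hsub : edgeImage (linForest lk N)ᶜ φ ∩ edgeImage (linForest lk N)ᶜ ψ ⊆
          (((patDom τ).image φ).offDiag.image Sym2.mk.uncurry) := by
        intro e he
        rw [Finset.mem_inter] at he
        obtain ⟨k, i, hki, rfl⟩ := mem_edgeImage.1 he.1
        obtain ⟨l, j, hlj, h⟩ := mem_edgeImage.1 he.2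
        have hne : τ k ≠ none ∧ τ i ≠ none := by
          rw [Sym2.eq_iff] at h
          rcases h with ⟨h1, h2⟩ | ⟨h1, h2⟩ <;>
            exact ⟨overlap_ne_none h1.symm, overlap_ne_none h2.symm⟩
        rw [Finset.mem_image]
        refine ⟨(φ k, φ i), ?_, rfl⟩
        rw [Finset.mem_offDiag]
        exact ⟨Finset.mem_image_of_mem _ (by simp [patDom, hne.1]),
          Finset.mem_image_of_mem _ (by simp [patDom, hne.2]), fun h => hki.ne (hφ h)⟩
      refine (Finset.card_le_card hsub).trans (le_of_eq ?_)
      rw [Sym2.card_image_offDiag, Finset.card_image_of_injective _ hφ]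
    refine (bprob_spans_and_le hp0 hp1 hφ hψ hE hE' hx hy).trans ?_
    gcongr
    exact inv_pow_patEdges_le τ hval
  · push Not at hval
    obtain ⟨i, k, j, l, hik, hlk, hi, hk, hne⟩ := hval
    have h1 : bprob p E (fun S => Spans (linForest lk N) S φ ∧ Spans (linForest lk N) S ψ) =
        bprob p E (fun _ => False) := by
      refine bprob_congr fun S _ => ?_
      rw [iff_false]
      rintro ⟨h1, h2⟩
      have hki : k ≠ i := fun h => by rw [h] at hik; omega
      have hmem := (h1 k i hki).2 (Or.inl ⟨hik, hlk⟩)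
      rw [← overlap_eq_some hi, ← overlap_eq_some hk] at hmem
      have hlj : l ≠ j := by
        rintro rfl
        exact hki (hφ ((overlap_eq_some hk).symm.trans (overlap_eq_some hi)))
      rcases (h2 l j hlj).1 hmem with h | h
      · exact hne.1 h.1
      · exact hne.2 h.1
    rw [h1]
    simp only [bprob, if_false, bexp_const]
    have := patProd_nonneg (lk := lk) hp0 zero_le_one τ
    positivity

/-- The second moment bound: a lower bound for the probability that an induced linear forest with
one vertex in each block exists. The hypothesis `hab` bounds the contribution of the common
non-edges by geometric terms, for which the sum over the overlap patterns factorizes. -/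
theorem one_le_bprob_exists_spans_mul [DecidableEq V] {p : ℝ} (hp0 : 0 < p) (hp1 : p < 1)
    (hN : 0 < N) (hB : 0 < B) (lk : ℕ → Prop) {ι : Fin N × Fin B → V}
    (hι : Function.Injective ι) {E : Finset (Sym2 V)} (hE : ∀ x y, x ≠ y → s(ι x, ι y) ∈ E)
    {a b γ : ℝ} (ha : 0 ≤ a) (hb : 0 ≤ b) (hγ : 0 ≤ γ)
    (hab : ∀ s ≤ N, (1 - p)⁻¹ ^ (s.choose 2) ≤ a ^ s + γ * b ^ s) :
    1 ≤ bprob p E (fun S => ∃ x, Spans (linForest lk N) S (blockMap ι x)) *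
      ((1 + (N + 2 * p⁻¹) * (Real.exp 1 / (N * B) * a)) ^ N +
        γ * (1 + (N + 2 * p⁻¹) * (Real.exp 1 / (N * B) * b)) ^ N) := by
  classical
  have hN' : (0 : ℝ) < N := by exact_mod_cast hN
  have hB' : (0 : ℝ) < B := by exact_mod_cast hB
  have hq : 0 < 1 - p := by linarith
  set w : ℝ := Real.exp 1 / (N * B) with hw
  have hw0 : 0 ≤ w := by positivity
  set H := linForest lk N with hH
  set μ : ℝ := p ^ H.edgeSet.ncard * (1 - p) ^ Hᶜ.edgeSet.ncard with hμ
  have hμ0 : 0 < μ := by positivity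
  set M : ℝ := (1 + (N + 2 * p⁻¹) * (w * a)) ^ N + γ * (1 + (N + 2 * p⁻¹) * (w * b)) ^ N with hM
  set Φ : ℝ := N.factorial * (B : ℝ) ^ N with hΦ
  have hΦ0 : 0 < Φ := by positivity
  have hcardΦ : ((Finset.univ : Finset (Equiv.Perm (Fin N) × (Fin N → Fin B))).card : ℝ) = Φ := by
    rw [Finset.card_univ, Fintype.card_prod, Fintype.card_perm, Fintype.card_fun]
    simp [hΦ]
  have hinj := blockMap_injective hι
  have hEx : ∀ x, ∀ i j, i ≠ j → s(blockMap ι x i, blockMap ι x j) ∈ E := fun x i j hij =>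
    hE _ _ fun h => hij (x.1.injective (congrArg Prod.fst h))
  set X : Finset (Sym2 V) → ℝ := fun S =>
    ∑ x : Equiv.Perm (Fin N) × (Fin N → Fin B), if Spans H S (blockMap ι x) then 1 else 0 with hX
  have hEX : bexp p E X = Φ * μ := by
    rw [hX, bexp_sum]
    have : ∀ x ∈ (Finset.univ : Finset (Equiv.Perm (Fin N) × (Fin N → Fin B))),
        bexp p E (fun S => if Spans H S (blockMap ι x) then 1 else 0) = μ := by
      intro x _
      have := bprob_spans (p := p) (H := H) (hinj x) (hEx x)
      rw [hμ, ← this, bprob]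
    rw [Finset.sum_congr rfl this, Finset.sum_const, nsmul_eq_mul, hcardΦ]
  have hfix : ∀ x, ∑ y, bprob p E (fun S => Spans H S (blockMap ι x) ∧ Spans H S (blockMap ι y)) ≤
      Φ * μ ^ 2 * M := by
    intro x
    set F : (Fin N → Option (Fin N)) → ℝ := fun τ =>
      patProd lk p 1 τ * (1 - p)⁻¹ ^ ((patDom τ).card.choose 2) with hF
    have hP0 : ∀ τ : Fin N → Option (Fin N), 0 ≤ patProd lk p 1 τ := fun τ =>
      patProd_nonneg hp0 zero_le_one τ
    calc ∑ y, bprob p E (fun S => Spans H S (blockMap ι x) ∧ Spans H S (blockMap ι y))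
        ≤ ∑ y, μ ^ 2 * F (overlap (blockMap ι x) (blockMap ι y)) :=
          Finset.sum_le_sum fun y _ =>
            bprob_spans_and_le_patProd hp0 hp1 lk (hinj x) (hinj y) (hEx x) (hEx y)
      _ = μ ^ 2 * ∑ τ, ((Finset.univ.filter fun y =>
            overlap (blockMap ι x) (blockMap ι y) = τ).card : ℝ) * F τ := by
          rw [← Finset.mul_sum]
          congr 1
          rw [← Finset.sum_fiberwise Finset.univ fun y => overlap (blockMap ι x) (blockMap ι y)]
          refine Finset.sum_congr rfl fun τ _ => ?_
          rw [Finset.sum_congr rfl fun y hy => by rw [(Finset.mem_filter.1 hy).2],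
            Finset.sum_const, nsmul_eq_mul]
      _ ≤ μ ^ 2 * ∑ τ, Φ * (patProd lk p (w * a) τ + γ * patProd lk p (w * b) τ) := by
          refine mul_le_mul_of_nonneg_left (Finset.sum_le_sum fun τ _ => ?_) (by positivity)
          have h1 := card_overlap_le hN hB hι (hinj x) τ
          have hs : (patDom τ).card ≤ N := by simpa using Finset.card_le_univ (patDom τ)
          have h2 := hab _ hs
          have h3 : 0 ≤ F τ := mul_nonneg (hP0 τ) (by positivity)
          calc _ ≤ (Φ * w ^ (patDom τ).card) * F τ := mul_le_mul_of_nonneg_right h1 h3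
            _ ≤ (Φ * w ^ (patDom τ).card) * (patProd lk p 1 τ *
                (a ^ (patDom τ).card + γ * b ^ (patDom τ).card)) := by
              gcongr
              exact mul_le_mul_of_nonneg_left h2 (hP0 τ)
            _ = _ := by
              rw [patProd_eq (z := w * a), patProd_eq (z := w * b), mul_pow, mul_pow]; ring
      _ = Φ * μ ^ 2 * (∑ τ : Fin N → Option (Fin N), patProd lk p (w * a) τ +
            γ * ∑ τ : Fin N → Option (Fin N), patProd lk p (w * b) τ) := by
          rw [← Finset.mul_sum, Finset.sum_add_distrib, ← Finset.mul_sum]; ring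
      _ ≤ Φ * μ ^ 2 * M := by
          have h1 := sum_patProd_le (N := N) (lk := lk) hp0 (mul_nonneg hw0 ha)
          have h2 := sum_patProd_le (N := N) (lk := lk) hp0 (mul_nonneg hw0 hb)
          rw [hM]
          gcongr
  have hEX2 : bexp p E (fun S => X S ^ 2) ≤ (Φ * μ) ^ 2 * M := by
    have e1 : bexp p E (fun S => X S ^ 2) = ∑ x, ∑ y,
        bprob p E (fun S => Spans H S (blockMap ι x) ∧ Spans H S (blockMap ι y)) := by
      simp only [bprob, ← bexp_sum]
      refine bexp_congr fun S _ => ?_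
      rw [hX, sq, Finset.sum_mul_sum]
      refine Finset.sum_congr rfl fun x _ => Finset.sum_congr rfl fun y _ => ?_
      by_cases h1 : Spans H S (blockMap ι x) <;> by_cases h2 : Spans H S (blockMap ι y) <;>
        simp [h1, h2]
    rw [e1]
    calc _ ≤ ∑ x : Equiv.Perm (Fin N) × (Fin N → Fin B), Φ * μ ^ 2 * M :=
          Finset.sum_le_sum fun x _ => hfix x
      _ = (Φ * μ) ^ 2 * M := by
          rw [Finset.sum_const, nsmul_eq_mul, hcardΦ]; ring
  have hCS := sq_bexp_le hp0.le hp1.le E X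
  have hP : bprob p E (fun S => X S ≠ 0) ≤
      bprob p E (fun S => ∃ x, Spans H S (blockMap ι x)) := by
    refine bprob_mono hp0.le hp1.le fun S _ h => ?_
    by_contra hn
    push Not at hn
    exact h (Finset.sum_eq_zero fun x _ => if_neg (hn x))
  rw [hEX] at hCS
  have hM0 : 0 ≤ M := by positivity
  have h5 : (Φ * μ) ^ 2 * 1 ≤ (Φ * μ) ^ 2 *
      (bprob p E (fun S => ∃ x, Spans H S (blockMap ι x)) * M) := by
    calc (Φ * μ) ^ 2 * 1 ≤ bprob p E (fun S => X S ≠ 0) * bexp p E fun S => X S ^ 2 := by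
          rw [mul_one]; exact hCS
      _ ≤ bprob p E (fun S => ∃ x, Spans H S (blockMap ι x)) * ((Φ * μ) ^ 2 * M) :=
          mul_le_mul hP hEX2 (bexp_nonneg hp0.le hp1.le fun _ _ => sq_nonneg _)
            (bprob_nonneg hp0.le hp1.le _ _)
      _ = _ := by ring
  exact le_of_mul_le_mul_left h5 (by positivity)

end SecondMoment

/-! ### Induced linear forests with many long components -/

/-- The maps `f (i, ·)` trace `m` pairwise disjoint paths with `L` vertices each, and the graph with
edge set `S` induces exactly these paths on the set of their vertices. -/
def IsPathForest {V : Type*} {m L : ℕ} (S : Finset (Sym2 V)) (f : Fin m × Fin L → V) : Prop :=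
  Function.Injective f ∧ ∀ x y, x ≠ y → (s(f x, f y) ∈ S ↔
    x.1 = y.1 ∧ ((y.2 : ℕ) = x.2 + 1 ∨ (x.2 : ℕ) = y.2 + 1))

section Forest

variable {V : Type*} [DecidableEq V]

/-- The pairs of vertices of `ι` whose later block is the block `k`. -/
def blockPairs {N B : ℕ} (ι : Fin N × Fin B → V) (k : Fin N) : Finset (Sym2 V) :=
  (Finset.univ.filter fun z : (Fin N × Fin B) × (Fin N × Fin B) =>
    z.1 ≠ z.2 ∧ max z.1.1 z.2.1 = k).image fun z => s(ι z.1, ι z.2)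

lemma mem_blockPairs {N B : ℕ} {ι : Fin N × Fin B → V} (hι : Function.Injective ι)
    {k : Fin N} {x y : Fin N × Fin B} :
    s(ι x, ι y) ∈ blockPairs ι k ↔ x ≠ y ∧ max x.1 y.1 = k := by
  simp only [blockPairs, Finset.mem_image, Finset.mem_filter, Finset.mem_univ, true_and]
  constructor
  · rintro ⟨z, ⟨h1, h2⟩, h⟩
    rw [Sym2.eq_iff] at h
    rcases h with ⟨h3, h4⟩ | ⟨h3, h4⟩
    · rw [hι h3, hι h4] at h1 h2; exact ⟨h1, h2⟩
    · rw [hι h3, hι h4] at h1 h2; exact ⟨h1.symm, by rw [max_comm]; exact h2⟩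
  · exact fun h => ⟨(x, y), h, rfl⟩

lemma pairwiseDisjoint_blockPairs {N B : ℕ} {ι : Fin N × Fin B → V} (hι : Function.Injective ι) :
    ((Finset.univ : Finset (Fin N)) : Set (Fin N)).PairwiseDisjoint (blockPairs ι) := by
  intro k _ l _ hkl
  rw [Function.onFun, Finset.disjoint_left]
  intro e he he'
  have : ∃ x y, e = s(ι x, ι y) := by
    simp only [blockPairs, Finset.mem_image] at he
    obtain ⟨z, _, h⟩ := he
    exact ⟨z.1, z.2, h.symm⟩
  obtain ⟨x, y, rfl⟩ := this
  exact hkl (((mem_blockPairs hι).1 he).2.symm.trans ((mem_blockPairs hι).1 he').2)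

/-- Without the links at the multiples of `L`, the components are `m` paths with `L` vertices. -/
lemma linForest_adj_iff {m L : ℕ} (x y : Fin m × Fin L) :
    (linForest (fun j => ¬ L ∣ j) (m * L)).Adj (finProdFinEquiv x) (finProdFinEquiv y) ↔
      x.1 = y.1 ∧ ((y.2 : ℕ) = x.2 + 1 ∨ (x.2 : ℕ) = y.2 + 1) := by
  have key : ∀ x y : Fin m × Fin L,
      ((y.2 + L * y.1 : ℕ) = (x.2 + L * x.1) + 1 ∧ ¬ L ∣ y.2 + L * y.1) ↔
        x.1 = y.1 ∧ (y.2 : ℕ) = x.2 + 1 := by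
    rintro ⟨c, l⟩ ⟨c', l'⟩
    have hl := l.isLt
    have hl' := l'.isLt
    have hL : 0 < L := by omega
    simp only [(Nat.dvd_mul_right L (c' : ℕ)), Nat.dvd_add_left]
    constructor
    · rintro ⟨h1, h2⟩
      have hl0 : (l' : ℕ) ≠ 0 := fun h => h2 (by simp [h])
      have h3 : ((l' : ℕ) - 1) + L * c' = l + L * c := by omega
      have h4 := congrArg (· / L) h3
      simp only [Nat.add_mul_div_left _ _ hL, Nat.div_eq_of_lt hl,
        Nat.div_eq_of_lt (by omega : (l' : ℕ) - 1 < L)] at h4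
      have h5 : c' = c := Fin.ext (by omega)
      subst h5
      exact ⟨rfl, by omega⟩
    · rintro ⟨h1, h2⟩
      subst h1
      refine ⟨by omega, fun h => ?_⟩
      have := Nat.le_of_dvd (by omega) h
      omega
  have h1 := key x y
  have h2 := key y x
  simp only [linForest, finProdFinEquiv_apply_val]
  rw [h1, h2]
  constructor
  · rintro (⟨h, h'⟩ | ⟨h, h'⟩)
    · exact ⟨h, Or.inl h'⟩
    · exact ⟨h.symm, Or.inr h'⟩
  · rintro ⟨h, h' | h'⟩
    · exact Or.inl ⟨h, h'⟩
    · exact Or.inr ⟨h.symm, h'⟩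

/-- Changing the pairs of few blocks destroys few components of the forest. -/
lemma exists_isPathForest_of_close {m₀ m L B : ℕ} {ι : Fin (m₀ * L) × Fin B → V}
    (hι : Function.Injective ι) {S S' : Finset (Sym2 V)}
    (x : Equiv.Perm (Fin (m₀ * L)) × (Fin (m₀ * L) → Fin B))
    (hx : Spans (linForest (fun j => ¬ L ∣ j) (m₀ * L)) S (blockMap ι x))
    (hm : m + (Finset.univ.filter fun k =>
      S ∩ blockPairs ι k ≠ S' ∩ blockPairs ι k).card ≤ m₀) :
    ∃ f : Fin m × Fin L → V, IsPathForest S' f ∧ ∀ z, f z ∈ Set.range ι := by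
  set D := Finset.univ.filter fun k => S ∩ blockPairs ι k ≠ S' ∩ blockPairs ι k with hD
  set bad : Finset (Fin m₀) := D.image fun k => (finProdFinEquiv.symm (x.1.symm k)).1 with hbad
  have hcard : m ≤ (badᶜ).card := by
    have : bad.card ≤ D.card := Finset.card_image_le
    rw [Finset.card_compl, Fintype.card_fin]
    omega
  have hemb : Nonempty (Fin m ↪ (badᶜ : Finset (Fin m₀))) := by
    rw [Function.Embedding.nonempty_iff_card_le]
    rwa [Fintype.card_fin, Fintype.card_coe]
  obtain ⟨g⟩ := hemb
  set P : Fin m × Fin L → Fin (m₀ * L) := fun z => finProdFinEquiv ((g z.1).1, z.2) with hP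
  have hPinj : Function.Injective P := by
    rintro ⟨i, a⟩ ⟨j, b⟩ h
    have := finProdFinEquiv.injective h
    simp only [Prod.mk.injEq] at this
    rw [Prod.mk.injEq]
    exact ⟨g.injective (Subtype.ext this.1), this.2⟩
  have hPD : ∀ z, x.1 (P z) ∉ D := by
    intro z hz
    have h1 : (g z.1).1 ∈ bad := by
      exact Finset.mem_image.2 ⟨_, hz, by simp [hP]⟩
    exact (Finset.mem_compl.1 (g z.1).2) h1
  refine ⟨fun z => blockMap ι x (P z), ⟨(blockMap_injective hι x).comp hPinj, ?_⟩,
    fun z => ⟨_, rfl⟩⟩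
  intro y z hyz
  have hne : P y ≠ P z := fun h => hyz (hPinj h)
  have hmem : s(blockMap ι x (P y), blockMap ι x (P z)) ∈
      blockPairs ι (max (x.1 (P y)) (x.1 (P z))) := by
    unfold blockMap
    rw [mem_blockPairs hι]
    exact ⟨fun h => hne (x.1.injective (congrArg Prod.fst h)), rfl⟩
  have hmax : max (x.1 (P y)) (x.1 (P z)) ∉ D := by
    rcases max_choice (x.1 (P y)) (x.1 (P z)) with h | h <;> rw [h]
    · exact hPD y
    · exact hPD z
  simp only [hD, Finset.mem_filter, Finset.mem_univ, true_and, not_not] at hmax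
  have h1 : s(blockMap ι x (P y), blockMap ι x (P z)) ∈ S' ↔
      s(blockMap ι x (P y), blockMap ι x (P z)) ∈ S := by
    have := Finset.ext_iff.1 hmax s(blockMap ι x (P y), blockMap ι x (P z))
    simp only [Finset.mem_inter, hmem, and_true] at this
    exact this.symm
  rw [h1, hx _ _ hne, hP]
  have := linForest_adj_iff ((g y.1).1, y.2) ((g z.1).1, z.2)
  rw [this]
  simp only [Subtype.val_inj, EmbeddingLike.apply_eq_iff_eq]

/-- If an induced forest with `m₀` components exists with probability at least `1 / M`, then one
with slightly fewer components exists with high probability. -/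
theorem bprob_no_pathForest_le {p : ℝ} (hp0 : 0 ≤ p) (hp1 : p ≤ 1) {m₀ m L B : ℕ} (hm : m ≤ m₀)
    (hN : 0 < m₀ * L) {ι : Fin (m₀ * L) × Fin B → V} (hι : Function.Injective ι) {M : ℝ}
    (hM0 : 0 ≤ M)
    (hM : 1 ≤ bprob p (Finset.univ.biUnion (blockPairs ι))
      (fun S => ∃ x, Spans (linForest (fun j => ¬ L ∣ j) (m₀ * L)) S (blockMap ι x)) * M) :
    bprob p (Finset.univ.biUnion (blockPairs ι)) (fun S =>
      ¬ ∃ f : Fin m × Fin L → V, IsPathForest S f ∧ ∀ z, f z ∈ Set.range ι) ≤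
      Real.exp (-(((m₀ : ℝ) - m) ^ 2 / (m₀ * L : ℕ))) * M := by
  have hmR : (m : ℝ) ≤ m₀ := by exact_mod_cast hm
  have key := bprob_mul_bprob_le hp0 hp1 Finset.univ (blockPairs ι)
    (pairwiseDisjoint_blockPairs hι)
    (fun S => ¬ ∃ f : Fin m × Fin L → V, IsPathForest S f ∧ ∀ z, f z ∈ Set.range ι)
    (fun S => ∃ x, Spans (linForest (fun j => ¬ L ∣ j) (m₀ * L)) S (blockMap ι x))
    ((m₀ : ℝ) - m) (by linarith) (by simpa using hN) (by
      rintro S - S' - ⟨x, hx⟩ hS'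
      by_contra hlt
      push Not at hlt
      refine hS' (exists_isPathForest_of_close hι x hx ?_)
      have : (m : ℝ) + (Finset.univ.filter fun k =>
        S ∩ blockPairs ι k ≠ S' ∩ blockPairs ι k).card ≤ m₀ := by linarith
      exact_mod_cast this)
  rw [Finset.card_univ, Fintype.card_fin] at key
  set A := bprob p (Finset.univ.biUnion (blockPairs ι)) (fun S =>
      ¬ ∃ f : Fin m × Fin L → V, IsPathForest S f ∧ ∀ z, f z ∈ Set.range ι)
  have hA : 0 ≤ A := bprob_nonneg hp0 hp1 _ _
  calc A = A * 1 := (mul_one A).symm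
    _ ≤ A * (_ * M) := mul_le_mul_of_nonneg_left hM hA
    _ = (A * _) * M := (mul_assoc _ _ _).symm
    _ ≤ _ := mul_le_mul_of_nonneg_right key hM0

end Forest

/-! ### Depth first search -/

/-- A relation in which any two disjoint `t`-sets are connected by an arc has a directed path
missing fewer than `2 * t` elements. The proof runs a depth first search: `U` consists of the
unvisited elements, `D` of the finished ones and `l` is the stack, with the top first. -/
lemma exists_chain_of_arcs {α : Type*} [Fintype α] [DecidableEq α] (R : α → α → Prop) (t : ℕ)
    (ht : ∀ S T : Finset α, S.card = t → T.card = t → Disjoint S T → ∃ a ∈ S, ∃ b ∈ T, R a b) :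
    ∃ l : List α, l.Nodup ∧ l.IsChain R ∧ Fintype.card α ≤ l.length + 2 * t := by
  have step : ∀ k : ℕ, ∀ (U D : Finset α) (l : List α), l.Nodup → l.IsChain (fun a b => R b a) →
      Disjoint U D → (∀ a, a ∈ l ↔ a ∉ U ∪ D) → (∀ a ∈ D, ∀ b ∈ U, ¬ R a b) →
      U.card = D.card + k →
      ∃ (U D : Finset α) (l : List α), l.Nodup ∧ l.IsChain (fun a b => R b a) ∧
        Disjoint U D ∧ (∀ a, a ∈ l ↔ a ∉ U ∪ D) ∧ (∀ a ∈ D, ∀ b ∈ U, ¬ R a b) ∧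
        U.card = D.card := by
    intro k
    induction k with
    | zero => exact fun U D l h1 h2 h3 h4 h5 h6 => ⟨U, D, l, h1, h2, h3, h4, h5, h6⟩
    | succ k ih =>
      intro U D l h1 h2 h3 h4 h5 h6
      have push : ∀ u ∈ U, (u :: l).IsChain (fun a b => R b a) →
          ∃ (U D : Finset α) (l : List α), l.Nodup ∧ l.IsChain (fun a b => R b a) ∧
          Disjoint U D ∧ (∀ a, a ∈ l ↔ a ∉ U ∪ D) ∧ (∀ a ∈ D, ∀ b ∈ U, ¬ R a b) ∧
          U.card = D.card := by
        intro u hu hc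
        have huD : u ∉ D := Finset.disjoint_left.1 h3 hu
        refine ih (U.erase u) D (u :: l) ?_ hc (h3.mono_left (Finset.erase_subset _ _)) ?_
          (fun a ha b hb => h5 a ha b (Finset.mem_of_mem_erase hb)) ?_
        · rw [List.nodup_cons]
          exact ⟨fun h => (h4 u).1 h (Finset.mem_union_left _ hu), h1⟩
        · intro a
          have := h4 a
          simp only [List.mem_cons, Finset.mem_union, Finset.mem_erase] at this ⊢
          by_cases hau : a = u
          · subst hau; simp [huD]
          · simp [hau, this]
        · rw [Finset.card_erase_of_mem hu]; omega
      have hUne : U.Nonempty := Finset.card_pos.1 (by omega)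
      cases l with
      | nil =>
        obtain ⟨u, hu⟩ := hUne
        exact push u hu (List.isChain_singleton _)
      | cons x l =>
        by_cases hx : ∃ u ∈ U, R x u
        · obtain ⟨u, hu, hxu⟩ := hx
          exact push u hu (List.isChain_cons_cons.2 ⟨hxu, h2⟩)
        · push Not at hx
          have hxUD := (h4 x).1 (by simp)
          rw [Finset.mem_union, not_or] at hxUD
          refine ih U (insert x D) l (List.nodup_cons.1 h1).2 h2.tail ?_ ?_ ?_ ?_
          · rw [Finset.disjoint_insert_right]; exact ⟨hxUD.1, h3⟩
          · intro a
            have := h4 a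
            simp only [List.mem_cons, Finset.mem_union, Finset.mem_insert] at this ⊢
            by_cases hax : a = x
            · subst hax
              simp [(List.nodup_cons.1 h1).1]
            · simp only [hax, false_or] at this ⊢; exact this
          · intro a ha b hb
            rcases Finset.mem_insert.1 ha with rfl | ha
            · exact hx b hb
            · exact h5 a ha b hb
          · rw [Finset.card_insert_of_notMem hxUD.2]; omega
  obtain ⟨U, D, l, h1, h2, h3, h4, h5, h6⟩ := step (Fintype.card α) Finset.univ ∅ [] (by simp)
    (by simp) (by simp) (by simp) (by simp) (by simp)
  refine ⟨l.reverse, by simpa using h1, by simpa [List.isChain_reverse] using h2, ?_⟩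
  have hD : D.card ≤ t := by
    by_contra hlt
    push Not at hlt
    obtain ⟨T, hT, hTc⟩ := Finset.exists_subset_card_eq (s := U) (n := t) (by omega)
    obtain ⟨S, hS, hSc⟩ := Finset.exists_subset_card_eq (s := D) (n := t) (by omega)
    obtain ⟨a, ha, b, hb, hab⟩ := ht S T hSc hTc ((h3.mono hT hS).symm)
    exact h5 a (hS ha) b (hT hb) hab
  have hl : l.toFinset = (U ∪ D)ᶜ := by ext a; simp only [List.mem_toFinset, Finset.mem_compl, h4]
  have := congrArg Finset.card hl
  rw [List.toFinset_card_of_nodup h1, Finset.card_compl, Finset.card_union_of_disjoint h3] at this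
  rw [List.length_reverse]
  omega

/-! ### Concatenating induced paths -/

section Paths

variable {V : Type*}

/-- The list is the vertex sequence of an induced path in the graph with edge set `S`. -/
def IsIndPath (S : Finset (Sym2 V)) : List V → Prop
  | [] => True
  | v :: l => v ∉ l ∧ (∀ u ∈ l, s(v, u) ∈ S ↔ l.head? = some u) ∧ IsIndPath S l

lemma IsIndPath.append {S : Finset (Sym2 V)} {l₁ l₂ : List V} (h₁ : IsIndPath S l₁)
    (h₂ : IsIndPath S l₂) (hd : ∀ u ∈ l₁, u ∉ l₂)
    (h : ∀ u ∈ l₁, ∀ v ∈ l₂, (s(u, v) ∈ S ↔ l₁.getLast? = some u ∧ l₂.head? = some v)) :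
    IsIndPath S (l₁ ++ l₂) := by
  induction l₁ with
  | nil => exact h₂
  | cons v l ih =>
    obtain ⟨h1, h2, h3⟩ := h₁
    refine ⟨?_, ?_, ?_⟩
    · simp only [List.append_eq, List.mem_append, not_or]
      exact ⟨h1, hd v (by simp)⟩
    · intro u hu
      simp only [List.append_eq, List.mem_append] at hu
      rcases hu with hu | hu
      · rw [h2 u hu]
        cases l with
        | nil => simp at hu
        | cons w l => simp
      · rw [h v (by simp) u hu]
        cases l with
        | nil => simp
        | cons w l =>
          have hne : (v :: w :: l).getLast? ≠ some v := by
            rw [List.getLast?_cons_cons]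
            exact fun h => h1 (List.mem_of_getLast? h)
          have hne' : w ≠ u := by
            rintro rfl
            exact hd w (by simp) hu
          rw [List.getLast?_cons_cons] at hne ⊢
          simp [hne, hne']
    · refine ih h3 (fun u hu => hd u (by simp [hu])) fun u hu w hw => ?_
      rw [h u (by simp [hu]) w hw]
      cases l with
      | nil => simp at hu
      | cons x l => rw [List.getLast?_cons_cons]

lemma IsIndPath.nodup {S : Finset (Sym2 V)} {l : List V} (h : IsIndPath S l) : l.Nodup := by
  induction l with
  | nil => simp
  | cons v l ih => exact List.nodup_cons.2 ⟨h.1, ih h.2.2⟩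

lemma IsIndPath.mem_iff {S : Finset (Sym2 V)} {l : List V} (h : IsIndPath S l) (i j : ℕ)
    (hij : i < j) (hj : j < l.length) : s(l[i], l[j]) ∈ S ↔ j = i + 1 := by
  induction l generalizing i j with
  | nil => simp at hj
  | cons v l ih =>
    obtain ⟨j, rfl⟩ : ∃ k, j = k + 1 := ⟨j - 1, by omega⟩
    cases i with
    | zero =>
      simp only [List.getElem_cons_zero, List.getElem_cons_succ]
      have hjl : j < l.length := by simpa using hj
      rw [h.2.1 _ (List.getElem_mem hjl), List.head?_eq_getElem?,
        List.getElem?_eq_getElem (by omega : 0 < l.length), Option.some_inj,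
        h.2.2.nodup.getElem_inj_iff]
      omega
    | succ i =>
      simp only [List.getElem_cons_succ]
      rw [ih h.2.2 i j (by omega) (by simpa using hj)]
      omega

/-- The graph with edge set `S` has an induced path of each length smaller than the number of
vertices of a given induced path. -/
lemma IsIndPath.hasInducedPath {S : Finset (Sym2 V)} {l : List V} (h : IsIndPath S l) {k : ℕ}
    (hk : k < l.length) : HasInducedPath (SimpleGraph.fromEdgeSet (S : Set (Sym2 V))) k := by
  have hlt : ∀ i : Fin (k + 1), (i : ℕ) < l.length := fun i => by omega
  let g : Fin (k + 1) → V := fun i => l[(i : ℕ)]'(hlt i)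
  have hg : Function.Injective g := fun i j hij => Fin.ext ((h.nodup.getElem_inj_iff).1 hij)
  have hadj : ∀ i j : Fin (k + 1), i < j → (s(g i, g j) ∈ S ↔ (j : ℕ) = i + 1) :=
    fun i j hij => h.mem_iff i j hij (hlt j)
  refine ⟨⟨⟨g, hg⟩, ?_⟩⟩
  intro i j
  change (SimpleGraph.fromEdgeSet (S : Set (Sym2 V))).Adj (g i) (g j) ↔ _
  rw [SimpleGraph.fromEdgeSet_adj, Finset.mem_coe, SimpleGraph.pathGraph_adj, hg.ne_iff, ne_eq,
    Fin.ext_iff]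
  rcases lt_trichotomy i j with hij | rfl | hij
  · rw [hadj i j hij]; omega
  · omega
  · rw [Sym2.eq_swap, hadj j i hij]; omega

/-- The vertex `v` links the path `i` of the forest `f` to the path `j`: its only neighbours in
the forest are one of the last `h` vertices of the path `i` and one of the first `h` vertices of
the path `j`. -/
def Links {m L : ℕ} (S : Finset (Sym2 V)) (f : Fin m × Fin L → V) (h : ℕ) (v : V)
    (i j : Fin m) : Prop :=
  ∃ a b : Fin L, L ≤ a + h ∧ (b : ℕ) < h ∧ ∀ x, s(v, f x) ∈ S ↔ x = (i, a) ∨ x = (j, b)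

/-- The segment of the path `i` of a path forest from position `b` to position `a`. -/
lemma exists_segment {m L : ℕ} {S : Finset (Sym2 V)} {f : Fin m × Fin L → V}
    (hf : IsPathForest S f) (i : Fin m) (k : ℕ) (a b : Fin L) (hab : (a : ℕ) = b + k) :
    ∃ l : List V, IsIndPath S l ∧ l.head? = some (f (i, b)) ∧ l.getLast? = some (f (i, a)) ∧
      l.length = k + 1 ∧ ∀ u ∈ l, ∃ c : Fin L, b ≤ c ∧ u = f (i, c) := by
  induction k generalizing b with
  | zero =>
    have : a = b := Fin.ext (by omega)
    subst this
    exact ⟨[f (i, a)], by simp [IsIndPath], by simp, by simp, by simp, by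
      simpa using ⟨a, le_rfl, rfl⟩⟩
  | succ k ih =>
    obtain ⟨l, h1, h2, h3, h4, h5⟩ := ih ⟨b + 1, by omega⟩ (by simp; omega)
    refine ⟨f (i, b) :: l, ⟨?_, ?_, h1⟩, by simp, ?_, by simp [h4], ?_⟩
    · intro hmem
      obtain ⟨c, hc, he⟩ := h5 _ hmem
      have := hf.1 he
      simp only [Prod.mk.injEq, true_and] at this
      rw [← this, Fin.le_def] at hc
      simp at hc
    · intro u hu
      obtain ⟨c, hc, rfl⟩ := h5 u hu
      rw [Fin.le_def] at hc
      simp only at hc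
      rw [hf.2 _ _ (by simp only [ne_eq, Prod.mk.injEq, true_and]; rintro rfl; omega), h2,
        Option.some_inj, hf.1.eq_iff]
      simp only [true_and, Prod.mk.injEq, Fin.ext_iff]
      omega
    · cases l with
      | nil => simp at h4
      | cons w l => rw [List.getLast?_cons_cons]; exact h3
    · intro u hu
      rcases List.mem_cons.1 hu with rfl | hu
      · exact ⟨b, le_rfl, rfl⟩
      · obtain ⟨c, hc, rfl⟩ := h5 u hu
        refine ⟨c, ?_, rfl⟩
        rw [Fin.le_def] at hc ⊢
        simp only at hc
        omega

/-- A chain of linked paths of a path forest can be concatenated to a long induced path, if the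
links are pairwise non-adjacent. -/
lemma exists_isIndPath_of_links {m L : ℕ} {S : Finset (Sym2 V)} {f : Fin m × Fin L → V}
    (hf : IsPathForest S f) (h : ℕ) (Z : Set V) (hZf : ∀ v ∈ Z, ∀ x, v ≠ f x)
    (hZ : ∀ u ∈ Z, ∀ v ∈ Z, s(u, v) ∉ S) (hL : 2 * h ≤ L) (is : List (Fin m)) (hnd : is.Nodup)
    (hc : is.IsChain fun i j => ∃ v ∈ Z, Links S f h v i j) (i : Fin m) (hi : is.head? = some i)
    (b : Fin L) (hb : (b : ℕ) < h) :
    ∃ l : List V, IsIndPath S l ∧ l.head? = some (f (i, b)) ∧ is.length * (L - 2 * h) ≤ l.length ∧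
      ∀ u ∈ l, (∃ j ∈ is, ∃ c, u = f (j, c)) ∨
        (u ∈ Z ∧ ∀ x, s(u, f x) ∈ S → x.1 ∈ is) := by
  induction is generalizing i b with
  | nil => simp at hi
  | cons i' is ih =>
    obtain rfl : i' = i := by simpa using hi
    cases is with
    | nil =>
      obtain ⟨l, h1, h2, h3, h4, h5⟩ := exists_segment hf i' (L - 1 - b) ⟨L - 1, by omega⟩ b
        (by simp; omega)
      refine ⟨l, h1, h2, by rw [h4, List.length_singleton, one_mul]; omega, fun u hu => ?_⟩
      obtain ⟨c, _, rfl⟩ := h5 u hu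
      exact Or.inl ⟨i', by simp, c, rfl⟩
    | cons j is =>
      rw [List.isChain_cons_cons] at hc
      obtain ⟨⟨v, hvZ, a, b', ha, hb', hv⟩, hc⟩ := hc
      obtain ⟨hi'nd, hnd⟩ := List.nodup_cons.1 hnd
      obtain ⟨l, g1, g2, g3, g4⟩ := ih hnd hc j (by simp) b' hb'
      obtain ⟨l', k1, k2, k3, k4, k5⟩ := exists_segment hf i' (a - b) a b (by omega)
      have hij : i' ≠ j := fun h => hi'nd (by simp [h])
      have hvl : IsIndPath S (v :: l) := by
        refine ⟨fun hmem => ?_, fun u hu => ?_, g1⟩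
        · rcases g4 v hmem with ⟨j', _, c, hvc⟩ | ⟨_, h2⟩
          · exact hZf v hvZ _ hvc
          · exact hi'nd (h2 (i', a) ((hv _).2 (Or.inl rfl)))
        · rw [g2, Option.some_inj]
          rcases g4 u hu with ⟨j', hj', c, rfl⟩ | ⟨huZ, h2⟩
          · rw [hv, hf.1.eq_iff]
            constructor
            · rintro (h | h)
              · simp only [Prod.mk.injEq] at h
                exact absurd (h.1 ▸ hj') hi'nd
              · exact h.symm
            · exact fun h => Or.inr h.symm
          · exact iff_of_false (hZ v hvZ u huZ) fun h => hZf u huZ _ h.symm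
      refine ⟨l' ++ v :: l, k1.append hvl ?_ ?_, ?_, ?_, ?_⟩
      · intro u hu hmem
        obtain ⟨c, _, rfl⟩ := k5 u hu
        rcases List.mem_cons.1 hmem with h | h
        · exact hZf v hvZ _ h.symm
        · rcases g4 _ h with ⟨j', hj', c', hc'⟩ | ⟨huZ, _⟩
          · have := hf.1 hc'
            simp only [Prod.mk.injEq] at this
            exact hi'nd (this.1 ▸ hj')
          · exact hZf _ huZ _ rfl
      · intro u hu w hw
        obtain ⟨c, _, rfl⟩ := k5 u hu
        rw [k3, List.head?_cons, Option.some_inj, Option.some_inj]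
        rcases List.mem_cons.1 hw with rfl | hw
        · rw [Sym2.eq_swap, hv, hf.1.eq_iff]
          simp [hij, eq_comm]
        · have hwv : v ≠ w := fun h => hvl.1 (h ▸ hw)
          refine iff_of_false (fun hmem => ?_) fun h => hwv h.2
          rcases g4 w hw with ⟨j', hj', c', rfl⟩ | ⟨_, h2⟩
          · have hne : i' ≠ j' := fun h => hi'nd (h ▸ hj')
            rw [hf.2 _ _ (by simp [hne])] at hmem
            exact hne hmem.1
          · rw [Sym2.eq_swap] at hmem
            exact hi'nd (h2 _ hmem)
      · cases l' with
        | nil => simp at k4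
        | cons w l' => simpa using k2
      · rw [List.length_cons] at g3
        rw [List.length_append, k4, List.length_cons, List.length_cons, Nat.succ_mul,
          List.length_cons]
        omega
      · intro u hu
        rcases List.mem_append.1 hu with hu | hu
        · obtain ⟨c, _, rfl⟩ := k5 u hu
          exact Or.inl ⟨i', by simp, c, rfl⟩
        · rcases List.mem_cons.1 hu with rfl | hu
          · refine Or.inr ⟨hvZ, fun x hx => ?_⟩
            rcases (hv x).1 hx with rfl | rfl <;> simp
          · rcases g4 u hu with ⟨j', hj', c, rfl⟩ | ⟨huZ, h2⟩
            · exact Or.inl ⟨j', by simp [List.mem_cons.1 hj'], c, rfl⟩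
            · exact Or.inr ⟨huZ, fun x hx => by simp [List.mem_cons.1 (h2 x hx)]⟩

/-- If all pairs of large sets of paths of a path forest are linked by pairwise non-adjacent
vertices, there is an induced path through almost the whole forest. -/
theorem exists_isIndPath_of_isPathForest {m L : ℕ} {S : Finset (Sym2 V)} {f : Fin m × Fin L → V}
    (hf : IsPathForest S f) (h t : ℕ) (Z : Set V) (hZf : ∀ v ∈ Z, ∀ x, v ≠ f x)
    (hZ : ∀ u ∈ Z, ∀ v ∈ Z, s(u, v) ∉ S) (hL : 2 * h ≤ L) (h0 : 0 < h) (hm : 2 * t < m)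
    (hlink : ∀ A B : Finset (Fin m), A.card = t → B.card = t → Disjoint A B →
      ∃ i ∈ A, ∃ j ∈ B, ∃ v ∈ Z, Links S f h v i j) :
    ∃ l : List V, IsIndPath S l ∧ (m - 2 * t) * (L - 2 * h) ≤ l.length := by
  obtain ⟨is, hnd, hc, hlen⟩ := exists_chain_of_arcs
    (fun i j => ∃ v ∈ Z, Links S f h v i j) t hlink
  rw [Fintype.card_fin] at hlen
  obtain ⟨i, hi⟩ : ∃ i, is.head? = some i := by
    cases is with
    | nil => simp at hlen; omega
    | cons i is => exact ⟨i, rfl⟩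
  obtain ⟨l, h1, _, h2, _⟩ := exists_isIndPath_of_links hf h Z hZf hZ hL is hnd hc i hi
    ⟨0, by omega⟩ h0
  exact ⟨l, h1, (Nat.mul_le_mul_right _ (by omega)).trans h2⟩

end Paths

/-! ### Chernoff bounds -/

section Chernoff

variable {α ι : Type*} [DecidableEq α] [DecidableEq ι] {p : ℝ}

open Classical in
/-- The exponential moments of the number of events that occur, for independent events. -/
lemma bexp_exp_card_le (hp0 : 0 ≤ p) (hp1 : p ≤ 1) (I : Finset ι) (E : ι → Finset α)
    (hE : (I : Set ι).PairwiseDisjoint E) (C : ι → Finset α → Prop) (c : ℝ) (κ : ι → ℝ)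
    (hκ : ∀ i ∈ I, (Real.exp c - 1) * bprob p (E i) (C i) ≤ κ i) :
    bexp p (I.biUnion E) (fun S =>
      Real.exp (c * (I.filter fun i => C i (S ∩ E i)).card)) ≤ Real.exp (∑ i ∈ I, κ i) := by
  have h1 : ∀ S : Finset α, Real.exp (c * (I.filter fun i => C i (S ∩ E i)).card) =
      ∏ i ∈ I, (fun T => if C i T then Real.exp c else 1) (S ∩ E i) := by
    intro S
    simp only
    rw [Finset.prod_ite, Finset.prod_const, Finset.prod_const_one, mul_one, ← Real.exp_nat_mul,
      mul_comm]
  simp only [h1]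
  rw [bexp_biUnion_prod I E hE fun i T => if C i T then Real.exp c else 1, Real.exp_sum]
  refine Finset.prod_le_prod (fun i _ => bexp_nonneg hp0 hp1 fun S _ => ?_) fun i hi => ?_
  · split_ifs <;> positivity
  · have h2 : bexp p (E i) (fun T => if C i T then Real.exp c else 1) =
        1 + (Real.exp c - 1) * bprob p (E i) (C i) := by
      rw [bprob, ← bexp_const_mul]
      nth_rewrite 2 [← bexp_const (p := p) (E i) 1]
      rw [← bexp_add]
      refine bexp_congr fun S _ => ?_
      split_ifs <;> ring
    rw [h2]
    have := Real.add_one_le_exp (κ i)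
    linarith [hκ i hi]

open Classical in
/-- Upper tail of the number of events that occur, for independent events. -/
lemma bprob_card_ge_le (hp0 : 0 ≤ p) (hp1 : p ≤ 1) (I : Finset ι) (E : ι → Finset α)
    (hE : (I : Set ι).PairwiseDisjoint E) (C : ι → Finset α → Prop) (κ : ι → ℝ)
    (hκ : ∀ i ∈ I, bprob p (E i) (C i) ≤ κ i) (T : ℝ) :
    bprob p (I.biUnion E) (fun S => T ≤ (I.filter fun i => C i (S ∩ E i)).card) ≤
      Real.exp (2 * ∑ i ∈ I, κ i - T) := by
  have key := bexp_exp_card_le hp0 hp1 I E hE C 1 (fun i => 2 * κ i) fun i hi => by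
    have h1 := hκ i hi
    have h2 := bprob_nonneg hp0 hp1 (E i) (C i)
    have h3 : Real.exp 1 - 1 ≤ 2 := by linarith [Real.exp_one_lt_d9]
    nlinarith
  rw [← Finset.mul_sum] at key
  refine (bprob_le_bexp hp0 hp1 _ _ (fun S => Real.exp (-T) *
    Real.exp (1 * (I.filter fun i => C i (S ∩ E i)).card)) (fun S _ => by positivity) ?_).trans ?_
  · intro S _ hS
    rw [← Real.exp_add]
    exact Real.one_le_exp (by linarith)
  · rw [bexp_const_mul, sub_eq_neg_add, Real.exp_add]
    exact mul_le_mul_of_nonneg_left key (Real.exp_pos _).le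

open Classical in
/-- Lower tail of the number of events that occur, for independent events of probability at least
`x`. -/
lemma bprob_card_le_le (hp0 : 0 ≤ p) (hp1 : p ≤ 1) (I : Finset ι) (E : ι → Finset α)
    (hE : (I : Set ι).PairwiseDisjoint E) (C : ι → Finset α → Prop) (x : ℝ)
    (hx : ∀ i ∈ I, x ≤ bprob p (E i) (C i)) (hx0 : 0 ≤ x) :
    bprob p (I.biUnion E) (fun S =>
      ((I.filter fun i => C i (S ∩ E i)).card : ℝ) ≤ x * I.card / 2) ≤
      Real.exp (-(x * I.card / 10)) := by
  have key := bexp_exp_card_le hp0 hp1 I E hE C (-1) (fun i => -(3 / 5 * x)) fun i hi => by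
    have h1 := hx i hi
    have h3 : Real.exp (-1) ≤ 2 / 5 := by
      rw [Real.exp_neg, inv_le_comm₀ (Real.exp_pos _) (by norm_num)]
      linarith [Real.exp_one_gt_d9]
    nlinarith
  rw [Finset.sum_const, nsmul_eq_mul] at key
  refine (bprob_le_bexp hp0 hp1 _ _ (fun S => Real.exp (x * I.card / 2) *
    Real.exp (-1 * (I.filter fun i => C i (S ∩ E i)).card)) (fun S _ => by positivity) ?_).trans ?_
  · intro S _ hS
    rw [← Real.exp_add]
    exact Real.one_le_exp (by linarith)
  · rw [bexp_const_mul]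
    refine (mul_le_mul_of_nonneg_left key (Real.exp_pos _).le).trans (le_of_eq ?_)
    rw [← Real.exp_add]
    congr 1; ring

end Chernoff

/-! ### Linking the components of a forest -/

section Linking

variable {V : Type*} [DecidableEq V] {p : ℝ}

/-- The pairs consisting of `v` and a vertex of `V₁`. -/
def starPairs (V₁ : Finset V) (v : V) : Finset (Sym2 V) := V₁.image fun u => s(v, u)

/-- The pairs consisting of two distinct vertices of `V₂`. -/
def innerPairs (V₂ : Finset V) : Finset (Sym2 V) := V₂.offDiag.image Sym2.mk.uncurry

lemma mem_starPairs {V₁ : Finset V} {v u : V} : s(v, u) ∈ starPairs V₁ v ↔ u ∈ V₁ := by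
  simp only [starPairs, Finset.mem_image]
  constructor
  · rintro ⟨w, hw, h⟩
    rwa [Sym2.congr_right.1 h] at hw
  · exact fun h => ⟨u, h, rfl⟩

lemma mem_innerPairs {V₂ : Finset V} {u v : V} :
    s(u, v) ∈ innerPairs V₂ ↔ u ∈ V₂ ∧ v ∈ V₂ ∧ u ≠ v := by
  simp only [innerPairs, Finset.mem_image, Finset.mem_offDiag]
  constructor
  · rintro ⟨⟨a, b⟩, ⟨h1, h2, h3⟩, h⟩
    rcases Sym2.eq_iff.1 h with ⟨rfl, rfl⟩ | ⟨rfl, rfl⟩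
    · exact ⟨h1, h2, h3⟩
    · exact ⟨h2, h1, fun h => h3 h.symm⟩
  · exact fun h => ⟨(u, v), h, rfl⟩

lemma pairwiseDisjoint_starPairs {V₁ V₂ : Finset V} (hd : Disjoint V₁ V₂) :
    (V₂ : Set V).PairwiseDisjoint (starPairs V₁) := by
  intro u hu v hv huv
  rw [Function.onFun, Finset.disjoint_left]
  intro e he he'
  simp only [starPairs, Finset.mem_image] at he he'
  obtain ⟨a, ha, rfl⟩ := he
  obtain ⟨b, hb, h⟩ := he'
  rcases Sym2.eq_iff.1 h with ⟨h1, _⟩ | ⟨h1, _⟩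
  · exact huv h1.symm
  · exact Finset.disjoint_left.1 hd (h1 ▸ ha) hv

/-- The probability that `v` has exactly the neighbours `f x` and `f y` among the `f z`. -/
lemma bprob_nbrs_eq {W : Type*} [Fintype W] [DecidableEq W] {f : W → V}
    (hf : Function.Injective f) {V₁ : Finset V} (hfV : ∀ z, f z ∈ V₁) (v : V) {x y : W}
    (hxy : x ≠ y) :
    bprob p (starPairs V₁ v) (fun S => ∀ z, s(v, f z) ∈ S ↔ z = x ∨ z = y) =
      p ^ 2 * (1 - p) ^ (Fintype.card W - 2) := by
  have hinj : Function.Injective fun z => s(v, f z) := fun a b h => hf (Sym2.congr_right.1 h)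
  have h1 : bprob p (starPairs V₁ v) (fun S => ∀ z, s(v, f z) ∈ S ↔ z = x ∨ z = y) =
      bprob p (starPairs V₁ v) (fun S => ({x, y} : Finset W).image (fun z => s(v, f z)) ⊆ S ∧
        Disjoint (({x, y} : Finset W)ᶜ.image (fun z => s(v, f z))) S) := by
    refine bprob_congr fun S _ => ?_
    rw [Finset.image_subset_iff, Finset.disjoint_left]
    simp only [Finset.mem_image, Finset.mem_compl, Finset.mem_insert, Finset.mem_singleton,
      forall_exists_index, and_imp, forall_apply_eq_imp_iff₂]
    constructor
    · exact fun h => ⟨fun z hz => (h z).2 hz, fun z hz hS => hz ((h z).1 hS)⟩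
    · exact fun h z => ⟨fun hS => by_contra fun hz => h.2 z hz hS, h.1 z⟩
  have hsub : ∀ A : Finset W, A.image (fun z => s(v, f z)) ⊆ starPairs V₁ v := fun A e he => by
    obtain ⟨z, _, rfl⟩ := Finset.mem_image.1 he
    exact mem_starPairs.2 (hfV z)
  rw [h1, bprob_cylinder (hsub _) (hsub _)
    ((Finset.disjoint_image hinj).2 disjoint_compl_right),
    Finset.card_image_of_injective _ hinj, Finset.card_image_of_injective _ hinj,
    Finset.card_compl, Finset.card_pair hxy]

variable {m L : ℕ}

/-- The pairs of a position among the last `h` of a path in `A` and one among the first `h` of a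
path in `B`. -/
def linkPairs (L h : ℕ) (A B : Finset (Fin m)) : Finset ((Fin m × Fin L) × (Fin m × Fin L)) :=
  (A ×ˢ Finset.univ.filter fun a : Fin L => L ≤ a + h) ×ˢ
    (B ×ˢ Finset.univ.filter fun b : Fin L => (b : ℕ) < h)

lemma card_linkPairs {h : ℕ} (hh : h ≤ L) (A B : Finset (Fin m)) :
    (linkPairs L h A B).card = A.card * h * (B.card * h) := by
  have h2 : (Finset.univ.filter fun b : Fin L => (b : ℕ) < h).card = h := by
    rw [Fin.card_filter_val_lt, min_eq_right hh]
  have h1 : (Finset.univ.filter fun a : Fin L => L ≤ a + h).card = h := by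
    rw [← h2]
    refine Finset.card_bij' (fun a _ => Fin.rev a) (fun b _ => Fin.rev b) ?_ ?_ ?_ ?_
    · intro a ha
      simp only [Finset.mem_filter, Finset.mem_univ, true_and, Fin.val_rev] at ha ⊢
      omega
    · intro a ha
      simp only [Finset.mem_filter, Finset.mem_univ, true_and, Fin.val_rev] at ha ⊢
      omega
    · simp
    · simp
  rw [linkPairs, Finset.card_product, Finset.card_product, Finset.card_product, h1, h2]

lemma mem_linkPairs {h : ℕ} {A B : Finset (Fin m)} {z : (Fin m × Fin L) × (Fin m × Fin L)} :
    z ∈ linkPairs L h A B ↔ (z.1.1 ∈ A ∧ L ≤ z.1.2 + h) ∧ (z.2.1 ∈ B ∧ (z.2.2 : ℕ) < h) := by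
  simp [linkPairs]

lemma exists_links_iff {V : Type*} {S : Finset (Sym2 V)} {f : Fin m × Fin L → V} {h : ℕ} {v : V}
    {A B : Finset (Fin m)} :
    (∃ i ∈ A, ∃ j ∈ B, Links S f h v i j) ↔
      ∃ z ∈ linkPairs L h A B, ∀ x, s(v, f x) ∈ S ↔ x = z.1 ∨ x = z.2 := by
  constructor
  · rintro ⟨i, hi, j, hj, a, b, ha, hb, hab⟩
    exact ⟨((i, a), (j, b)), mem_linkPairs.2 ⟨⟨hi, ha⟩, hj, hb⟩, hab⟩
  · rintro ⟨⟨⟨i, a⟩, ⟨j, b⟩⟩, hz, hab⟩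
    obtain ⟨⟨hi, ha⟩, hj, hb⟩ := mem_linkPairs.1 hz
    exact ⟨i, hi, j, hj, a, b, ha, hb, hab⟩

/-- The ways to link `A` to `B` exclude each other, since the two neighbours are determined. -/
lemma le_bprob_links (hp0 : 0 ≤ p) (hp1 : p ≤ 1) {f : Fin m × Fin L → V}
    (hf : Function.Injective f) {V₁ : Finset V} (hfV : ∀ z, f z ∈ V₁) (v : V) {h : ℕ}
    (hh : h ≤ L) {A B : Finset (Fin m)} (hAB : Disjoint A B) :
    (A.card * B.card * h ^ 2 : ℝ) * (p ^ 2 * (1 - p) ^ (m * L - 2)) ≤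
      bprob p (starPairs V₁ v) (fun S => ∃ i ∈ A, ∃ j ∈ B, Links S f h v i j) := by
  simp only [exists_links_iff]
  have hne : ∀ z ∈ linkPairs L h A B, z.1.1 ≠ z.2.1 := fun z hz he => by
    obtain ⟨⟨hi, _⟩, hj, _⟩ := mem_linkPairs.1 hz
    exact Finset.disjoint_left.1 hAB hi (he ▸ hj)
  refine le_trans (le_of_eq ?_) (sum_bprob_le hp0 hp1 _ _ _ ?_)
  · rw [Finset.sum_congr rfl fun z hz => bprob_nbrs_eq hf hfV v fun he =>
      hne z hz (congrArg Prod.fst he), Finset.sum_const, card_linkPairs hh, nsmul_eq_mul]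
    simp only [Fintype.card_prod, Fintype.card_fin]
    push_cast
    ring
  · intro S z hz w hw h1 h2
    have e1 : z.1 = w.1 ∨ z.1 = w.2 := (h2 _).1 ((h1 _).2 (Or.inl rfl))
    have e2 : z.2 = w.1 ∨ z.2 = w.2 := (h2 _).1 ((h1 _).2 (Or.inr rfl))
    obtain ⟨⟨hi, _⟩, hj, _⟩ := mem_linkPairs.1 hz
    obtain ⟨⟨hi', _⟩, hj', _⟩ := mem_linkPairs.1 hw
    have f1 : z.1 = w.1 := e1.resolve_right fun he =>
      Finset.disjoint_left.1 hAB hi (by rw [he]; exact hj')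
    have f2 : z.2 = w.2 := e2.resolve_left fun he =>
      Finset.disjoint_left.1 hAB hi' (by rw [← he]; exact hj)
    exact Prod.ext f1 f2

lemma bprob_links_le (hp0 : 0 ≤ p) (hp1 : p ≤ 1) {f : Fin m × Fin L → V}
    (hf : Function.Injective f) {V₁ : Finset V} (hfV : ∀ z, f z ∈ V₁) (v : V) {h : ℕ}
    (hh : h ≤ L) :
    bprob p (starPairs V₁ v) (fun S => ∃ i j, i ≠ j ∧ Links S f h v i j) ≤
      (m * m * h ^ 2 : ℝ) * (p ^ 2 * (1 - p) ^ (m * L - 2)) := by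
  have hq : 0 ≤ 1 - p := by linarith
  have h1 : bprob p (starPairs V₁ v) (fun S => ∃ i j, i ≠ j ∧ Links S f h v i j) ≤
      bprob p (starPairs V₁ v) (fun S =>
        ∃ z ∈ (linkPairs L h (Finset.univ : Finset (Fin m)) Finset.univ).filter
          (fun z => z.1 ≠ z.2), ∀ x, s(v, f x) ∈ S ↔ x = z.1 ∨ x = z.2) := by
    refine bprob_mono hp0 hp1 fun S _ => ?_
    rintro ⟨i, j, hij, a, b, ha, hb, hab⟩
    refine ⟨((i, a), (j, b)), Finset.mem_filter.2 ⟨mem_linkPairs.2 ⟨⟨by simp, ha⟩, by simp, hb⟩,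
      fun he => hij (congrArg Prod.fst he)⟩, hab⟩
  refine h1.trans ((bprob_exists_le hp0 hp1 _ _ _).trans ?_)
  rw [Finset.sum_congr rfl fun z hz => bprob_nbrs_eq hf hfV v (Finset.mem_filter.1 hz).2,
    Finset.sum_const, nsmul_eq_mul]
  simp only [Fintype.card_prod, Fintype.card_fin]
  refine mul_le_mul_of_nonneg_right ?_ (by positivity)
  have h2 := Finset.card_filter_le (linkPairs L h (Finset.univ : Finset (Fin m)) Finset.univ)
    (fun z => z.1 ≠ z.2)
  rw [card_linkPairs hh, Finset.card_univ, Fintype.card_fin] at h2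
  have h3 : (((linkPairs L h (Finset.univ : Finset (Fin m)) Finset.univ).filter
    (fun z => z.1 ≠ z.2)).card : ℝ) ≤ ((m * h * (m * h) : ℕ) : ℝ) := by exact_mod_cast h2
  refine h3.trans (le_of_eq ?_)
  push_cast
  ring

lemma links_inter_starPairs {S : Finset (Sym2 V)} {f : Fin m × Fin L → V} {V₁ : Finset V}
    (hfV : ∀ z, f z ∈ V₁) {h : ℕ} {v : V} {i j : Fin m} :
    Links (S ∩ starPairs V₁ v) f h v i j ↔ Links S f h v i j := by
  simp only [Links, Finset.mem_inter, mem_starPairs.2 (hfV _), and_true]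

open Classical in
/-- The vertices of `V₂` that link two distinct paths. -/
noncomputable def linkers (S : Finset (Sym2 V)) (f : Fin m × Fin L → V) (h : ℕ)
    (V₂ : Finset V) : Finset V :=
  V₂.filter fun v => ∃ i j, i ≠ j ∧ Links S f h v i j

open Classical in
/-- The vertices of `V₂` that link a path in `A` to a path in `B`. -/
noncomputable def linkersBetween (S : Finset (Sym2 V)) (f : Fin m × Fin L → V) (h : ℕ)
    (V₂ : Finset V) (A B : Finset (Fin m)) : Finset V :=
  V₂.filter fun v => ∃ i ∈ A, ∃ j ∈ B, Links S f h v i j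

/-- With high probability there are not too many linking vertices, but many of them between any two
large sets of paths. -/
lemma bprob_bad_linkers_le (hp0 : 0 ≤ p) (hp1 : p ≤ 1) {f : Fin m × Fin L → V}
    (hf : Function.Injective f) {V₁ V₂ : Finset V} (hfV : ∀ z, f z ∈ V₁) (hd : Disjoint V₁ V₂)
    {h t : ℕ} (hh : h ≤ L) (htm : t ≤ m) {r : ℝ}
    (hr : r = h ^ 2 * (p ^ 2 * (1 - p) ^ (m * L - 2))) :
    bprob p (V₂.biUnion (starPairs V₁)) (fun S =>
      4 * (m ^ 2 * r * V₂.card) ≤ (linkers S f h V₂).card ∨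
      ∃ AB ∈ (Finset.univ : Finset (Finset (Fin m) × Finset (Fin m))),
        (AB.1.card = t ∧ AB.2.card = t ∧ Disjoint AB.1 AB.2) ∧
        ((linkersBetween S f h V₂ AB.1 AB.2).card : ℝ) ≤ t ^ 2 * r * V₂.card / 2) ≤
      2 * 4 ^ m * Real.exp (-(t ^ 2 * r * V₂.card / 10)) := by
  classical
  have hq : 0 ≤ 1 - p := by linarith
  have hr0 : 0 ≤ r := by rw [hr]; positivity
  have hup := bprob_card_ge_le hp0 hp1 V₂ (starPairs V₁) (pairwiseDisjoint_starPairs hd)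
    (fun v S => ∃ i j, i ≠ j ∧ Links S f h v i j) (fun _ => m ^ 2 * r)
    (fun v _ => (bprob_links_le hp0 hp1 hf hfV v hh).trans (le_of_eq (by rw [hr]; ring)))
    (4 * (m ^ 2 * r * V₂.card))
  simp only [links_inter_starPairs hfV] at hup
  have hlow : ∀ AB : Finset (Fin m) × Finset (Fin m),
      bprob p (V₂.biUnion (starPairs V₁)) (fun S => (AB.1.card = t ∧ AB.2.card = t ∧
        Disjoint AB.1 AB.2) ∧
        ((linkersBetween S f h V₂ AB.1 AB.2).card : ℝ) ≤ t ^ 2 * r * V₂.card / 2) ≤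
      Real.exp (-(t ^ 2 * r * V₂.card / 10)) := by
    intro AB
    by_cases hAB : AB.1.card = t ∧ AB.2.card = t ∧ Disjoint AB.1 AB.2
    · have := bprob_card_le_le hp0 hp1 V₂ (starPairs V₁) (pairwiseDisjoint_starPairs hd)
        (fun v S => ∃ i ∈ AB.1, ∃ j ∈ AB.2, Links S f h v i j) (t ^ 2 * r)
        (fun v _ => le_trans (le_of_eq (by rw [hr, hAB.1, hAB.2.1]; ring))
          (le_bprob_links hp0 hp1 hf hfV v hh hAB.2.2)) (by positivity)
      simp only [links_inter_starPairs hfV] at this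
      refine le_trans (bprob_mono hp0 hp1 fun S _ hS => ?_) this
      exact hS.2
    · refine le_trans (le_of_eq ?_) (Real.exp_pos _).le
      have : bprob p (V₂.biUnion (starPairs V₁)) (fun S => (AB.1.card = t ∧ AB.2.card = t ∧
        Disjoint AB.1 AB.2) ∧
        ((linkersBetween S f h V₂ AB.1 AB.2).card : ℝ) ≤ t ^ 2 * r * V₂.card / 2) =
        bprob p (V₂.biUnion (starPairs V₁)) (fun _ => False) :=
        bprob_congr fun S _ => by simp [hAB]
      rw [this]
      simp only [bprob, if_false, bexp_const]
  refine (bprob_or_le hp0 hp1 _ _ _).trans ?_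
  have h2 := (bprob_exists_le hp0 hp1 (V₂.biUnion (starPairs V₁))
    (Finset.univ : Finset (Finset (Fin m) × Finset (Fin m))) _).trans
    (Finset.sum_le_sum fun AB _ => hlow AB)
  rw [Finset.sum_const, nsmul_eq_mul, Finset.card_univ] at h2
  simp only [Fintype.card_prod, Fintype.card_finset, Fintype.card_fin] at h2
  have h4 : (((2 ^ m * 2 ^ m : ℕ) : ℝ)) = 4 ^ m := by
    push_cast; rw [← mul_pow]; norm_num
  rw [h4] at h2
  have h5 : bprob p (V₂.biUnion (starPairs V₁)) (fun S =>
      4 * (m ^ 2 * r * V₂.card) ≤ (linkers S f h V₂).card) ≤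
      4 ^ m * Real.exp (-(t ^ 2 * r * V₂.card / 10)) := by
    have h6 : Real.exp (2 * ∑ v ∈ V₂, (m : ℝ) ^ 2 * r - 4 * (m ^ 2 * r * V₂.card)) ≤
        Real.exp (-(t ^ 2 * r * V₂.card / 10)) := by
      rw [Real.exp_le_exp, Finset.sum_const, nsmul_eq_mul]
      have h7 : (t : ℝ) ^ 2 * r * V₂.card ≤ m ^ 2 * r * V₂.card := by gcongr
      have h8 : 0 ≤ (t : ℝ) ^ 2 * r * V₂.card := by positivity
      linarith
    have h9 : (1 : ℝ) ≤ 4 ^ m := one_le_pow₀ (by norm_num)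
    refine (hup.trans h6).trans ?_
    exact le_mul_of_one_le_left (Real.exp_pos _).le h9
  refine (add_le_add h5 h2).trans (le_of_eq (by ring))

open Classical in
/-- An upper tail bound for the number of edges within a vertex set `W`. -/
lemma bprob_edges_ge_le (hp0 : 0 ≤ p) (hp1 : p ≤ 1) {V₂ W : Finset V} (hW : W ⊆ V₂) (T : ℝ) :
    bprob p (innerPairs V₂) (fun S => T ≤ ((innerPairs W).filter fun e => e ∈ S).card) ≤
      Real.exp (p * W.card ^ 2 - T) := by
  have hsub : innerPairs W ⊆ innerPairs V₂ :=
    Finset.image_subset_image (Finset.offDiag_mono hW)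
  have hbi : (innerPairs V₂).biUnion (fun e => ({e} : Finset (Sym2 V))) = innerPairs V₂ :=
    Finset.biUnion_singleton_eq_self
  have key := bprob_card_ge_le hp0 hp1 (innerPairs V₂) (fun e => ({e} : Finset (Sym2 V)))
    (fun a _ b _ hab => by simpa using hab) (fun e S => e ∈ innerPairs W ∧ e ∈ S)
    (fun e => if e ∈ innerPairs W then p else 0) (fun e _ => by
      by_cases he : e ∈ innerPairs W
      · have h1 := bprob_cylinder (p := p) (E := {e}) (P := {e}) (A := ∅) (by simp) (by simp)
          (by simp)
        simp only [Finset.singleton_subset_iff, Finset.disjoint_empty_left, and_true,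
          Finset.card_singleton, pow_one, Finset.card_empty, pow_zero, mul_one] at h1
        simp only [he, true_and, if_true]
        exact h1.le
      · simp only [he, false_and, if_false, bprob, bexp_const]
        exact le_rfl) T
  rw [hbi] at key
  refine le_trans (bprob_mono hp0 hp1 fun S _ hS => ?_) (key.trans ?_)
  · refine hS.trans ?_
    gcongr
    intro e he
    simp only [Finset.mem_filter, Finset.mem_inter, Finset.mem_singleton, and_true] at he ⊢
    exact ⟨hsub he.1, he⟩
  · rw [Real.exp_le_exp, ← Finset.sum_filter, Finset.sum_const, nsmul_eq_mul]
    have h1 : ((innerPairs V₂).filter fun e => e ∈ innerPairs W).card ≤ (innerPairs W).card :=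
      Finset.card_le_card fun e he => (Finset.mem_filter.1 he).2
    have h2 : (innerPairs W).card = W.card.choose 2 := Sym2.card_image_offDiag W
    have h3 : ((W.card.choose 2 : ℕ) : ℝ) ≤ (W.card : ℝ) ^ 2 / 2 := by
      have := Nat.choose_le_pow_div 2 W.card (α := ℝ)
      simpa using this
    have h4 : (((innerPairs V₂).filter fun e => e ∈ innerPairs W).card : ℝ) ≤ W.card ^ 2 / 2 := by
      refine le_trans ?_ h3
      rw [← h2]
      exact_mod_cast h1
    nlinarith

/-- The number of non-isolated vertices is at most twice the number of edges. -/
lemma card_nonisolated_le (S : Finset (Sym2 V)) (W : Finset V) :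
    (W.filter fun v => ∃ u ∈ W, u ≠ v ∧ s(u, v) ∈ S).card ≤
      2 * ((innerPairs W).filter fun e => e ∈ S).card := by
  classical
  have hsub : (W.filter fun v => ∃ u ∈ W, u ≠ v ∧ s(u, v) ∈ S) ⊆
      ((innerPairs W).filter fun e => e ∈ S).biUnion fun e => e.toFinset := by
    intro v hv
    obtain ⟨hvW, u, hu, huv, huS⟩ := Finset.mem_filter.1 hv
    rw [Finset.mem_biUnion]
    exact ⟨s(u, v), Finset.mem_filter.2 ⟨mem_innerPairs.2 ⟨hu, hvW, huv⟩, huS⟩, by simp⟩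
  refine (Finset.card_le_card hsub).trans ((Finset.card_biUnion_le_card_mul _ _ 2 ?_).trans
    (le_of_eq (mul_comm _ _)))
  intro e _
  rw [Sym2.card_toFinset]
  split_ifs <;> norm_num

end Linking

/-! ### A long induced path through the linked components -/

section LinkingPath

variable {V : Type*} [DecidableEq V] {p : ℝ} {m L : ℕ}

/-- Good linkers give a long induced path: the linkers that are not adjacent to other linkers
still join any two large sets of paths. -/
lemma exists_isIndPath_of_linkers {V₁ V₂ : Finset V} (hd : Disjoint V₁ V₂)
    {S₁ S₂ S₃ : Finset (Sym2 V)}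
    (h1 : ∀ u v, s(u, v) ∈ S₁ → u ∈ V₁ ∧ v ∈ V₁)
    (h2 : S₂ ⊆ V₂.biUnion (starPairs V₁)) (h3 : S₃ ⊆ innerPairs V₂)
    {f : Fin m × Fin L → V} (hf : IsPathForest S₁ f) (hfV : ∀ z, f z ∈ V₁) {h t : ℕ}
    (hL : 2 * h ≤ L) (h0 : 0 < h) (hm : 2 * t < m)
    (hAB : ∀ A B : Finset (Fin m), A.card = t → B.card = t → Disjoint A B →
      2 * ((innerPairs (linkers S₂ f h V₂)).filter fun e => e ∈ S₃).card <
        (linkersBetween S₂ f h V₂ A B).card) :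
    ∃ l : List V, IsIndPath (S₁ ∪ (S₂ ∪ S₃)) l ∧ (m - 2 * t) * (L - 2 * h) ≤ l.length := by
  classical
  set S := S₁ ∪ (S₂ ∪ S₃) with hS
  have hV₂ : ∀ u ∈ V₂, u ∉ V₁ := fun u hu hu' => Finset.disjoint_left.1 hd hu' hu
  have hmem2 : ∀ u v, s(u, v) ∈ S₂ → (u ∈ V₂ ∧ v ∈ V₁) ∨ (v ∈ V₂ ∧ u ∈ V₁) := by
    intro u v huv
    obtain ⟨w, hw, hwe⟩ := Finset.mem_biUnion.1 (h2 huv)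
    obtain ⟨x, hx, hxe⟩ := Finset.mem_image.1 hwe
    rcases Sym2.eq_iff.1 hxe with ⟨rfl, rfl⟩ | ⟨rfl, rfl⟩
    · exact Or.inl ⟨hw, hx⟩
    · exact Or.inr ⟨hw, hx⟩
  have hmem3 : ∀ u v, s(u, v) ∈ S₃ → u ∈ V₂ ∧ v ∈ V₂ ∧ u ≠ v := fun u v huv =>
    mem_innerPairs.1 (h3 huv)
  -- membership in `S` is decided by the position of the end vertices
  have hS11 : ∀ u ∈ V₁, ∀ v ∈ V₁, (s(u, v) ∈ S ↔ s(u, v) ∈ S₁) := by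
    intro u hu v hv
    simp only [hS, Finset.mem_union]
    constructor
    · rintro (h | h | h)
      · exact h
      · rcases hmem2 u v h with h | h
        · exact absurd hu (hV₂ u h.1)
        · exact absurd hv (hV₂ v h.1)
      · exact absurd hu (hV₂ u (hmem3 u v h).1)
    · exact fun h => Or.inl h
  have hS21 : ∀ u ∈ V₂, ∀ v ∈ V₁, (s(u, v) ∈ S ↔ s(u, v) ∈ S₂) := by
    intro u hu v hv
    simp only [hS, Finset.mem_union]
    constructor
    · rintro (h | h | h)
      · exact absurd (h1 u v h).1 (hV₂ u hu)
      · exact h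
      · exact absurd hv (hV₂ v (hmem3 u v h).2.1)
    · exact fun h => Or.inr (Or.inl h)
  have hS22 : ∀ u ∈ V₂, ∀ v ∈ V₂, (s(u, v) ∈ S ↔ s(u, v) ∈ S₃) := by
    intro u hu v hv
    simp only [hS, Finset.mem_union]
    constructor
    · rintro (h | h | h)
      · exact absurd (h1 u v h).1 (hV₂ u hu)
      · rcases hmem2 u v h with h | h
        · exact absurd h.2 (hV₂ v hv)
        · exact absurd h.2 (hV₂ u hu)
      · exact h
    · exact fun h => Or.inr (Or.inr h)
  have hfS : IsPathForest S f := ⟨hf.1, fun x y hxy => by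
    rw [hS11 _ (hfV x) _ (hfV y)]; exact hf.2 x y hxy⟩
  have hlinks : ∀ v ∈ V₂, ∀ i j, Links S₂ f h v i j → Links S f h v i j := by
    rintro v hv i j ⟨a, b, ha, hb, hab⟩
    exact ⟨a, b, ha, hb, fun x => by rw [hS21 v hv _ (hfV x)]; exact hab x⟩
  set W := linkers S₂ f h V₂ with hW
  have hWV : W ⊆ V₂ := Finset.filter_subset _ _
  set bad := W.filter fun v => ∃ u ∈ W, u ≠ v ∧ s(u, v) ∈ S₃ with hbad
  set Z : Set V := {v | v ∈ W ∧ v ∉ bad} with hZ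
  refine exists_isIndPath_of_isPathForest hfS h t Z ?_ ?_ hL h0 hm ?_
  · rintro v ⟨hv, _⟩ x rfl
    exact hV₂ _ (hWV hv) (hfV x)
  · rintro u ⟨hu, _⟩ v ⟨hv, hvb⟩ huv
    rw [hS22 u (hWV hu) v (hWV hv)] at huv
    exact hvb (Finset.mem_filter.2 ⟨hv, u, hu, (hmem3 u v huv).2.2, huv⟩)
  · intro A B hA hB hdAB
    have hcard := hAB A B hA hB hdAB
    have hsubW : linkersBetween S₂ f h V₂ A B ⊆ W := by
      intro v hv
      obtain ⟨hv2, i, hi, j, hj, hij⟩ := Finset.mem_filter.1 hv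
      exact Finset.mem_filter.2 ⟨hv2, i, j, fun he =>
        Finset.disjoint_left.1 hdAB hi (he ▸ hj), hij⟩
    have hlt : bad.card < (linkersBetween S₂ f h V₂ A B).card :=
      (card_nonisolated_le S₃ W).trans_lt hcard
    obtain ⟨v, hv, hvb⟩ := Finset.exists_mem_notMem_of_card_lt_card hlt
    obtain ⟨hv2, i, hi, j, hj, hij⟩ := Finset.mem_filter.1 hv
    exact ⟨i, hi, j, hj, v, ⟨hsubW hv, hvb⟩, hlinks v hv2 i j hij⟩

/-- With high probability the components of a given path forest can be linked to a long induced
path by vertices of a disjoint set `V₂`. -/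
theorem le_bprob_exists_isIndPath (hp0 : 0 ≤ p) (hp1 : p ≤ 1) {V₁ V₂ : Finset V}
    (hd : Disjoint V₁ V₂) {S₁ : Finset (Sym2 V)} (h1 : ∀ u v, s(u, v) ∈ S₁ → u ∈ V₁ ∧ v ∈ V₁)
    {f : Fin m × Fin L → V} (hf : IsPathForest S₁ f) (hfV : ∀ z, f z ∈ V₁) {h t : ℕ}
    (hL : 2 * h ≤ L) (h0 : 0 < h) (hm : 2 * t < m) {r : ℝ}
    (hr : r = h ^ 2 * (p ^ 2 * (1 - p) ^ (m * L - 2)))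
    (hsparse : 128 * (p * (m ^ 2 * r * V₂.card) ^ 2) ≤ t ^ 2 * r * V₂.card) :
    1 - 3 * 4 ^ m * Real.exp (-(t ^ 2 * r * V₂.card / 10)) ≤
      bprob p (V₂.biUnion (starPairs V₁) ∪ innerPairs V₂) (fun T =>
        ∃ l : List V, IsIndPath (S₁ ∪ T) l ∧ (m - 2 * t) * (L - 2 * h) ≤ l.length) := by
  classical
  set Λ : ℝ := t ^ 2 * r * V₂.card with hΛ
  have hq : 0 ≤ 1 - p := by linarith
  have hr0 : 0 ≤ r := by rw [hr]; positivity
  have hΛ0 : 0 ≤ Λ := by positivity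
  have hdis : Disjoint (V₂.biUnion (starPairs V₁)) (innerPairs V₂) := by
    rw [Finset.disjoint_left]
    intro e he he'
    obtain ⟨w, hw, hwe⟩ := Finset.mem_biUnion.1 he
    obtain ⟨x, hx, rfl⟩ := Finset.mem_image.1 hwe
    exact Finset.disjoint_left.1 hd hx (mem_innerPairs.1 he').2.1
  have hbad := bprob_bad_linkers_le hp0 hp1 hf.1 hfV hd (by omega : h ≤ L) (by omega : t ≤ m) hr
  set Bad : Finset (Sym2 V) → Prop := fun S =>
      4 * (m ^ 2 * r * V₂.card) ≤ (linkers S f h V₂).card ∨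
      ∃ AB ∈ (Finset.univ : Finset (Finset (Fin m) × Finset (Fin m))),
        (AB.1.card = t ∧ AB.2.card = t ∧ Disjoint AB.1 AB.2) ∧
        ((linkersBetween S f h V₂ AB.1 AB.2).card : ℝ) ≤ t ^ 2 * r * V₂.card / 2 with hBad
  have hgood : 1 - 2 * 4 ^ m * Real.exp (-(Λ / 10)) ≤
      bprob p (V₂.biUnion (starPairs V₁)) (fun S => ¬ Bad S) := by
    rw [bprob_not]; linarith
  have hcond : ∀ S ⊆ V₂.biUnion (starPairs V₁), ¬ Bad S →
      1 - Real.exp (-(Λ / 10)) ≤ bprob p (innerPairs V₂) (fun T =>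
        ∃ l : List V, IsIndPath (S₁ ∪ (S ∪ T)) l ∧ (m - 2 * t) * (L - 2 * h) ≤ l.length) := by
    intro S hSsub hSgood
    simp only [hBad, not_or, not_le, not_exists, not_and, Finset.mem_univ, true_implies] at hSgood
    obtain ⟨hg1, hg2⟩ := hSgood
    set W := linkers S f h V₂
    have hWV : W ⊆ V₂ := Finset.filter_subset _ _
    have hedges := bprob_edges_ge_le hp0 hp1 hWV (Λ / 4)
    have hexp : Real.exp (p * W.card ^ 2 - Λ / 4) ≤ Real.exp (-(Λ / 10)) := by
      rw [Real.exp_le_exp]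
      have : (W.card : ℝ) ^ 2 ≤ (4 * (m ^ 2 * r * V₂.card)) ^ 2 := by gcongr
      have h5 := mul_le_mul_of_nonneg_left this hp0
      nlinarith
    have h6 : 1 - Real.exp (-(Λ / 10)) ≤ bprob p (innerPairs V₂) (fun T =>
        ¬ (Λ / 4 ≤ ((innerPairs W).filter fun e => e ∈ T).card)) := by
      rw [bprob_not]
      have : bprob p (innerPairs V₂) (fun T =>
          Λ / 4 ≤ ((innerPairs W).filter fun e => e ∈ T).card) ≤ Real.exp (-(Λ / 10)) := by
        refine le_trans (le_of_eq (bprob_congr fun T _ => ?_)) (hedges.trans hexp)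
        exact Iff.rfl
      linarith
    refine h6.trans (bprob_mono hp0 hp1 fun T hT hTe => ?_)
    refine exists_isIndPath_of_linkers hd h1 hSsub hT hf hfV hL h0 hm fun A B hA hB hAB => ?_
    have h7 := hg2 (A, B) ⟨hA, hB, hAB⟩
    push Not at hTe
    have h8 : ((2 * ((innerPairs W).filter fun e => e ∈ T).card : ℕ) : ℝ) <
        (linkersBetween S f h V₂ A B).card := by
      push_cast
      simp only at h7
      linarith
    exact_mod_cast h8
  have key := bprob_union_ge hp0 hp1 hdis (fun S => ¬ Bad S) (fun T =>
    ∃ l : List V, IsIndPath (S₁ ∪ T) l ∧ (m - 2 * t) * (L - 2 * h) ≤ l.length) hcond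
  refine le_trans ?_ key
  set x := Real.exp (-(Λ / 10))
  have hx0 : 0 < x := Real.exp_pos _
  have hx1 : x ≤ 1 := by rw [Real.exp_le_one_iff]; linarith
  have h4 : (1 : ℝ) ≤ 4 ^ m := one_le_pow₀ (by norm_num)
  set P := bprob p (V₂.biUnion (starPairs V₁)) (fun S => ¬ Bad S)
  have hP1 : P ≤ 1 := bprob_le_one hp0 hp1 _ _
  nlinarith [mul_le_mul_of_nonneg_right h4 hx0.le, mul_le_mul_of_nonneg_right hP1 hx0.le]

end LinkingPath

/-! ### Lower bounds for the probability of a long induced path -/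

section Assembly

lemma mem_pairSet {V : Type*} [Fintype V] [DecidableEq V] {u v : V} :
    s(u, v) ∈ pairSet V ↔ u ≠ v := by
  simp [pairSet]

/-- The second moment bound for a single path with one vertex in each block. -/
theorem one_le_probGnp_mul {n k B : ℕ} {p : unitInterval} (hp0 : 0 < (p : ℝ)) (hp1 : (p : ℝ) < 1)
    (hB : 0 < B) (hn : (k + 1) * B ≤ n) {a b γ : ℝ} (ha : 0 ≤ a) (hb : 0 ≤ b) (hγ : 0 ≤ γ)
    (hab : ∀ s ≤ k + 1, (1 - (p : ℝ))⁻¹ ^ (s.choose 2) ≤ a ^ s + γ * b ^ s) :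
    1 ≤ probGnp n p (fun G => HasInducedPath G k) *
      ((1 + ((k + 1 : ℕ) + 2 * (p : ℝ)⁻¹) * (Real.exp 1 / ((k + 1 : ℕ) * B) * a)) ^ (k + 1) +
        γ * (1 + ((k + 1 : ℕ) + 2 * (p : ℝ)⁻¹) *
          (Real.exp 1 / ((k + 1 : ℕ) * B) * b)) ^ (k + 1)) := by
  set ι : Fin (k + 1) × Fin B → Fin n := fun x => Fin.castLE hn (finProdFinEquiv x) with hι
  have hinj : Function.Injective ι := (Fin.castLE_injective hn).comp finProdFinEquiv.injective
  have key := one_le_bprob_exists_spans_mul hp0 hp1 (Nat.succ_pos k) hB (fun _ => True) hinj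
    (E := pairSet (Fin n)) (fun x y hxy => mem_pairSet.2 fun h => hxy (hinj h)) ha hb hγ hab
  refine key.trans (mul_le_mul_of_nonneg_right ?_ (by positivity))
  rw [probGnp_eq_bprob]
  refine bprob_mono hp0.le hp1.le fun S _ => ?_
  rintro ⟨x, hx⟩
  have hφ := blockMap_injective hinj x
  refine ⟨⟨⟨blockMap ι x, hφ⟩, ?_⟩⟩
  intro i j
  change (SimpleGraph.fromEdgeSet (S : Set (Sym2 (Fin n)))).Adj (blockMap ι x i) (blockMap ι x j) ↔
    _
  rw [SimpleGraph.fromEdgeSet_adj, Finset.mem_coe, hφ.ne_iff, SimpleGraph.pathGraph_adj]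
  by_cases hij : i = j
  · subst hij; simp
  · rw [hx i j hij]
    simp only [linForest, and_true, ne_eq, hij, not_false_eq_true]
    omega

/-- The probability of a long induced path that arises from linking the components of a forest. -/
theorem mul_le_probGnp {n k m₀ m L B h t : ℕ} {p : unitInterval} (hp0 : 0 < (p : ℝ))
    (hp1 : (p : ℝ) < 1) (hB : 0 < B) (hn : m₀ * L * B ≤ n) (hmm : m ≤ m₀) (hL : 2 * h ≤ L)
    (h0 : 0 < h) (hm : 2 * t < m) (hk : k < (m - 2 * t) * (L - 2 * h))
    {a b γ : ℝ} (ha : 0 ≤ a) (hb : 0 ≤ b) (hγ : 0 ≤ γ)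
    (hab : ∀ s ≤ m₀ * L, (1 - (p : ℝ))⁻¹ ^ (s.choose 2) ≤ a ^ s + γ * b ^ s) {M r : ℝ}
    (hM : M = (1 + ((m₀ * L : ℕ) + 2 * (p : ℝ)⁻¹) *
      (Real.exp 1 / ((m₀ * L : ℕ) * B) * a)) ^ (m₀ * L) +
      γ * (1 + ((m₀ * L : ℕ) + 2 * (p : ℝ)⁻¹) *
        (Real.exp 1 / ((m₀ * L : ℕ) * B) * b)) ^ (m₀ * L))
    (hr : r = (h : ℝ) ^ 2 * ((p : ℝ) ^ 2 * (1 - (p : ℝ)) ^ (m * L - 2)))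
    (hsparse : 128 * ((p : ℝ) * ((m : ℝ) ^ 2 * r * (n - m₀ * L * B : ℕ)) ^ 2) ≤
      (t : ℝ) ^ 2 * r * (n - m₀ * L * B : ℕ)) :
    1 - Real.exp (-(((m₀ : ℝ) - m) ^ 2 / (m₀ * L : ℕ))) * M -
        3 * 4 ^ m * Real.exp (-((t : ℝ) ^ 2 * r * (n - m₀ * L * B : ℕ) / 10)) ≤
      probGnp n p (fun G => HasInducedPath G k) := by
  have hN : 0 < m₀ * L := Nat.mul_pos (by omega) (by omega)
  set ι : Fin (m₀ * L) × Fin B → Fin n := fun x => Fin.castLE hn (finProdFinEquiv x) with hι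
  have hinj : Function.Injective ι := (Fin.castLE_injective hn).comp finProdFinEquiv.injective
  set V₁ : Finset (Fin n) := Finset.univ.image ι with hV₁
  set V₂ : Finset (Fin n) := V₁ᶜ with hV₂
  have hd : Disjoint V₁ V₂ := disjoint_compl_right
  have hcard : V₂.card = n - m₀ * L * B := by
    rw [hV₂, Finset.card_compl, hV₁, Finset.card_image_of_injective _ hinj]
    simp
  set E₁ := Finset.univ.biUnion (blockPairs ι) with hE₁
  set E₂ := V₂.biUnion (starPairs V₁) ∪ innerPairs V₂ with hE₂
  have hmemE₁ : ∀ x y, s(ι x, ι y) ∈ E₁ ↔ x ≠ y := by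
    intro x y
    simp only [hE₁, Finset.mem_biUnion, Finset.mem_univ, true_and, mem_blockPairs hinj]
    constructor
    · rintro ⟨_, h, _⟩; exact h
    · exact fun h => ⟨_, h, rfl⟩
  have hE₁V : ∀ u v, s(u, v) ∈ E₁ → (u ∈ V₁ ∧ v ∈ V₁) ∧ u ≠ v := by
    intro u v huv
    simp only [hE₁, Finset.mem_biUnion, Finset.mem_univ, true_and] at huv
    obtain ⟨k, hk⟩ := huv
    obtain ⟨z, hz, he⟩ := Finset.mem_image.1 hk
    have hne : ι z.1 ≠ ι z.2 := fun h => (Finset.mem_filter.1 hz).2.1 (hinj h)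
    have hm1 : ∀ x, ι x ∈ V₁ := fun x => Finset.mem_image_of_mem _ (Finset.mem_univ _)
    rcases Sym2.eq_iff.1 he with ⟨rfl, rfl⟩ | ⟨rfl, rfl⟩
    · exact ⟨⟨hm1 _, hm1 _⟩, hne⟩
    · exact ⟨⟨hm1 _, hm1 _⟩, hne.symm⟩
  have hE₂V : ∀ u v, s(u, v) ∈ E₂ ↔
      (u ∈ V₂ ∧ v ∈ V₁) ∨ (v ∈ V₂ ∧ u ∈ V₁) ∨ (u ∈ V₂ ∧ v ∈ V₂ ∧ u ≠ v) := by
    intro u v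
    rw [hE₂, Finset.mem_union, mem_innerPairs, ← or_assoc]
    refine or_congr_left ?_
    rw [Finset.mem_biUnion]
    constructor
    · rintro ⟨w, hw, hwe⟩
      obtain ⟨x, hx, he⟩ := Finset.mem_image.1 hwe
      rcases Sym2.eq_iff.1 he with ⟨rfl, rfl⟩ | ⟨rfl, rfl⟩
      · exact Or.inl ⟨hw, hx⟩
      · exact Or.inr ⟨hw, hx⟩
    · rintro (⟨hu, hv⟩ | ⟨hv, hu⟩)
      · exact ⟨u, hu, mem_starPairs.2 hv⟩
      · exact ⟨v, hv, by rw [Sym2.eq_swap]; exact mem_starPairs.2 hu⟩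
  have hdis : Disjoint E₁ E₂ := by
    rw [Finset.disjoint_left]
    intro e he he'
    induction e using Sym2.ind with
    | _ u v =>
      obtain ⟨⟨hu, hv⟩, _⟩ := hE₁V u v he
      have hu' : u ∉ V₂ := Finset.disjoint_left.1 hd hu
      have hv' : v ∉ V₂ := Finset.disjoint_left.1 hd hv
      rcases (hE₂V u v).1 he' with h | h | h
      · exact hu' h.1
      · exact hv' h.1
      · exact hu' h.1
  have hunion : pairSet (Fin n) = E₁ ∪ E₂ := by
    ext e
    induction e using Sym2.ind with
    | _ u v =>
      rw [mem_pairSet, Finset.mem_union, hE₂V]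
      constructor
      · intro huv
        by_cases hu : u ∈ V₁ <;> by_cases hv : v ∈ V₁
        · left
          obtain ⟨x, _, rfl⟩ := Finset.mem_image.1 hu
          obtain ⟨y, _, rfl⟩ := Finset.mem_image.1 hv
          exact (hmemE₁ x y).2 fun h => huv (by rw [h])
        · right; right; left; exact ⟨Finset.mem_compl.2 hv, hu⟩
        · right; left; exact ⟨Finset.mem_compl.2 hu, hv⟩
        · right; right; right; exact ⟨Finset.mem_compl.2 hu, Finset.mem_compl.2 hv, huv⟩
      · rintro (h | h | h | h)
        · exact (hE₁V u v h).2
        · rintro rfl; exact Finset.disjoint_left.1 hd h.2 h.1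
        · rintro rfl; exact Finset.disjoint_left.1 hd h.2 h.1
        · exact h.2.2
  have hM0 : 0 ≤ M := by rw [hM]; positivity
  have hsecond := one_le_bprob_exists_spans_mul hp0 hp1 hN hB (fun j => ¬ L ∣ j) hinj
    (E := E₁) (fun x y hxy => (hmemE₁ x y).2 hxy) ha hb hγ hab
  rw [← hM] at hsecond
  have hforest := bprob_no_pathForest_le hp0.le hp1.le hmm hN hinj hM0 hsecond
  set A : Finset (Sym2 (Fin n)) → Prop := fun S =>
    ∃ f : Fin m × Fin L → Fin n, IsPathForest S f ∧ ∀ z, f z ∈ Set.range ι with hA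
  rw [bprob_not] at hforest
  set δ := Real.exp (-(((m₀ : ℝ) - m) ^ 2 / (m₀ * L : ℕ))) * M with hδ
  set η := 3 * 4 ^ m * Real.exp (-((t : ℝ) ^ 2 * r * (n - m₀ * L * B : ℕ) / 10)) with hη
  have hcond : ∀ S ⊆ E₁, A S → 1 - η ≤ bprob (p : ℝ) E₂ (fun T =>
      HasInducedPath (SimpleGraph.fromEdgeSet
        ((S ∪ T : Finset (Sym2 (Fin n))) : Set (Sym2 (Fin n)))) k) := by
    rintro S hS ⟨f, hf, hfι⟩
    have hfV : ∀ z, f z ∈ V₁ := fun z => by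
      obtain ⟨x, hx⟩ := hfι z
      rw [← hx]
      exact Finset.mem_image_of_mem _ (Finset.mem_univ _)
    have := le_bprob_exists_isIndPath hp0.le hp1.le hd (fun u v huv => (hE₁V u v (hS huv)).1)
      hf hfV hL h0 hm hr (by rw [hcard]; exact hsparse)
    rw [hcard] at this
    refine this.trans (bprob_mono hp0.le hp1.le fun T _ => ?_)
    rintro ⟨l, hl, hlen⟩
    exact hl.hasInducedPath (by omega)
  have key := bprob_union_ge hp0.le hp1.le hdis A (fun S =>
    HasInducedPath (SimpleGraph.fromEdgeSet (S : Set (Sym2 (Fin n)))) k) hcond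
  rw [probGnp_eq_bprob, hunion]
  refine le_trans ?_ key
  have hP1 : bprob (p : ℝ) E₁ A ≤ 1 := bprob_le_one hp0.le hp1.le _ _
  have hη0 : 0 ≤ η := by positivity
  nlinarith [mul_le_mul_of_nonneg_right hP1 hη0]

end Assembly

/-! ### Estimates for the second moment -/

section Estimates

lemma inv_one_sub_le_exp {p κ : ℝ} (hp : 0 ≤ p) (hpκ : p ≤ κ / 2) (hκ : κ ≤ 1) :
    (1 - p)⁻¹ ≤ Real.exp ((1 + κ) * p) := by
  have h1 : 0 < 1 - p := by linarith
  have h2 : (1 - p)⁻¹ ≤ 1 + (1 + κ) * p := by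
    rw [inv_le_iff_one_le_mul₀ h1]
    nlinarith [mul_nonneg hp (by linarith : 0 ≤ κ - 2 * p),
      mul_nonneg (mul_nonneg hp hp) (by linarith : 0 ≤ 1 - κ)]
  have := Real.add_one_le_exp ((1 + κ) * p)
  linarith

/-- Splitting the overlap sizes at `κ * N` gives geometric bounds for the contribution of the
common non-edges. -/
lemma inv_one_sub_pow_choose_le {p κ : ℝ} (hp : 0 ≤ p) (hpκ : p ≤ κ / 2) (hκ0 : 0 ≤ κ)
    (hκ : κ ≤ 1) (N s : ℕ) (hs : s ≤ N) :
    (1 - p)⁻¹ ^ (s.choose 2) ≤ Real.exp (κ * ((1 + κ) * p) * N / 2) ^ s +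
      Real.exp (-(κ * N)) * Real.exp (1 + (1 + κ) * p * N / 2) ^ s := by
  set ρ := (1 + κ) * p with hρ
  have hρ0 : 0 ≤ ρ := by positivity
  have hsN : (s : ℝ) ≤ N := by exact_mod_cast hs
  have h1 : 0 < 1 - p := by linarith
  have h2 : (1 - p)⁻¹ ^ (s.choose 2) ≤ Real.exp (ρ * s * s / 2) := by
    calc (1 - p)⁻¹ ^ (s.choose 2) ≤ Real.exp ρ ^ (s.choose 2) :=
          pow_le_pow_left₀ (by positivity) (inv_one_sub_le_exp hp hpκ hκ) _
      _ = Real.exp (s.choose 2 * ρ) := by rw [← Real.exp_nat_mul]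
      _ ≤ Real.exp (ρ * s * s / 2) := by
          rw [Real.exp_le_exp]
          have h3 : ((s.choose 2 : ℕ) : ℝ) ≤ (s : ℝ) ^ 2 / 2 := by
            simpa using Nat.choose_le_pow_div 2 s (α := ℝ)
          nlinarith
  refine h2.trans ?_
  rw [← Real.exp_nat_mul, ← Real.exp_nat_mul, ← Real.exp_add]
  have hs0 : (0 : ℝ) ≤ s := by positivity
  rcases le_total (s : ℝ) (κ * N) with h | h
  · refine le_add_of_le_of_nonneg ?_ (Real.exp_pos _).le
    rw [Real.exp_le_exp]
    nlinarith [mul_le_mul_of_nonneg_left h (mul_nonneg hρ0 hs0)]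
  · refine le_add_of_nonneg_of_le (Real.exp_pos _).le ?_
    rw [Real.exp_le_exp]
    nlinarith [mul_le_mul_of_nonneg_left hsN (mul_nonneg hρ0 hs0)]

/-- The second moment ratio of forests with `N` vertices, where `n` is the number of vertices, `l`
is the logarithm of the average degree and `B` is the block size. -/
lemma second_moment_ratio_le {p κ l : ℝ} {n N B : ℕ} (hp : 0 < p) (hκ0 : 0 < κ)
    (hκ : κ ≤ 1 / 8) (hl : 1 ≤ l) (hd : Real.exp l = p * n)
    (hl2 : 24 * Real.exp 1 * l * Real.exp (-(l / 10)) ≤ κ / 2) (hN : 0 < N)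
    (hNp : N * p ≤ 8 / 5 * l) (hNB : (n : ℝ) ≤ 2 * (N * B)) :
    (1 + (N + 2 * p⁻¹) * (Real.exp 1 / (N * B) *
        Real.exp (κ * ((1 + κ) * p) * N / 2))) ^ N +
      Real.exp (-(κ * N)) * (1 + (N + 2 * p⁻¹) * (Real.exp 1 / (N * B) *
        Real.exp (1 + (1 + κ) * p * N / 2))) ^ N ≤
    Real.exp (24 * N * l * Real.exp ((2 * κ - 1) * l)) + Real.exp (-(κ / 2 * N)) := by
  have hN' : (0 : ℝ) < N := by exact_mod_cast hN
  have hn : (0 : ℝ) < n := by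
    by_contra h
    have h1 := Real.exp_pos l
    rw [hd] at h1
    nlinarith
  have hNB0 : (0 : ℝ) < N * B := by linarith
  set u := (N + 2 * p⁻¹) * (Real.exp 1 / (N * B)) with hu
  have hu0 : 0 ≤ u := by positivity
  have hu1 : u ≤ 24 * l * Real.exp (-l) := by
    have he := Real.exp_one_lt_d9
    have h1 : u ≤ (N + 2 * p⁻¹) * (Real.exp 1 / (n / 2)) := by
      rw [hu]; gcongr; linarith
    have h2 : (N + 2 * p⁻¹) * (Real.exp 1 / (n / 2)) =
        2 * Real.exp 1 * (N * p + 2) * Real.exp (-l) := by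
      rw [Real.exp_neg, hd]; field_simp
    rw [h2] at h1
    refine h1.trans (mul_le_mul_of_nonneg_right ?_ (Real.exp_pos _).le)
    have h3 : N * p + 2 ≤ 18 / 5 * l := by linarith
    have h4 : 2 * Real.exp 1 * (N * p + 2) ≤ 2 * Real.exp 1 * (18 / 5 * l) := by gcongr
    nlinarith
  have hpow : ∀ y : ℝ, 0 ≤ y → (1 + u * y) ^ N ≤ Real.exp (N * (u * y)) := by
    intro y hy
    rw [Real.exp_nat_mul]
    refine pow_le_pow_left₀ (by positivity) ?_ _
    linarith [Real.add_one_le_exp (u * y)]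
  have hassoc : ∀ y : ℝ, (N + 2 * p⁻¹) * (Real.exp 1 / (N * B) * y) = u * y := fun y => by
    rw [hu, mul_assoc]
  rw [hassoc, hassoc]
  refine add_le_add ((hpow _ (Real.exp_pos _).le).trans ?_) ?_
  · rw [Real.exp_le_exp]
    have h1 : Real.exp (κ * ((1 + κ) * p) * N / 2) ≤ Real.exp (2 * κ * l) := by
      rw [Real.exp_le_exp]
      have : (1 + κ) * (N * p) ≤ 9 / 8 * (8 / 5 * l) := by gcongr; linarith
      nlinarith
    calc N * (u * Real.exp (κ * ((1 + κ) * p) * N / 2))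
        ≤ N * (24 * l * Real.exp (-l) * Real.exp (2 * κ * l)) := by gcongr
      _ = 24 * N * l * (Real.exp (-l) * Real.exp (2 * κ * l)) := by ring
      _ = 24 * N * l * Real.exp ((2 * κ - 1) * l) := by
          rw [← Real.exp_add]; congr 2; ring
  · refine (mul_le_mul_of_nonneg_left (hpow _ (Real.exp_pos _).le) (Real.exp_pos _).le).trans ?_
    rw [← Real.exp_add, Real.exp_le_exp]
    have h1 : Real.exp (1 + (1 + κ) * p * N / 2) ≤ Real.exp (1 + 9 / 10 * l) := by
      rw [Real.exp_le_exp]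
      have : (1 + κ) * (N * p) ≤ 9 / 8 * (8 / 5 * l) := by gcongr; linarith
      nlinarith
    have h2 : u * Real.exp (1 + (1 + κ) * p * N / 2) ≤ κ / 2 := by
      calc u * Real.exp (1 + (1 + κ) * p * N / 2)
          ≤ 24 * l * Real.exp (-l) * Real.exp (1 + 9 / 10 * l) := by gcongr
        _ = 24 * l * (Real.exp (-l) * Real.exp (1 + 9 / 10 * l)) := by ring
        _ = 24 * l * (Real.exp 1 * Real.exp (-(l / 10))) := by
            rw [← Real.exp_add, ← Real.exp_add]; congr 2; ring
        _ ≤ _ := by linarith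
    nlinarith

/-- The block size `3 * n / (4 * N)` leaves at least a quarter of the vertices unused, but uses at
least half of them. -/
lemma block_size {n N : ℕ} (hN : 0 < N) (hn : 4 * N ≤ n) :
    0 < 3 * n / (4 * N) ∧ 4 * (N * (3 * n / (4 * N))) ≤ 3 * n ∧
      n ≤ 2 * (N * (3 * n / (4 * N))) := by
  have h1 := Nat.div_add_mod (3 * n) (4 * N)
  have h2 := Nat.mod_lt (3 * n) (by omega : 0 < 4 * N)
  have e : 4 * N * (3 * n / (4 * N)) = 4 * (N * (3 * n / (4 * N))) := by ring
  rw [e] at h1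
  exact ⟨Nat.div_pos (by omega) (by omega), by omega, by omega⟩

/-- The dense case, with average degree at least about the square root of `n`: here the second
moment method yields an induced path directly. -/
theorem one_le_probGnp_mul_of_dense {n k : ℕ} {p : unitInterval} {κ l : ℝ} (hn : 0 < n)
    (hκ0 : 0 < κ) (hκ : κ ≤ 1 / 8) (hd : Real.exp l = p * n) (hpκ : (p : ℝ) ≤ κ / 2) (hl : 1 ≤ l)
    (hl1 : l ^ 2 ≤ Real.exp (κ * l))
    (hl2 : 24 * Real.exp 1 * l * Real.exp (-(l / 10)) ≤ κ / 2) (hl3 : 7 * l ≤ Real.exp l)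
    (hk1 : n / Real.exp l ≤ k + 1) (hk2 : (k : ℝ) + 1 ≤ 8 / 5 * (n / Real.exp l * l))
    (hdense : Real.log n ≤ (2 - 4 * κ) * l) :
    1 ≤ probGnp n p (fun G => HasInducedPath G k) *
      (Real.exp (40 * Real.exp (-(κ * l))) + Real.exp (-(κ / 2 * (n / Real.exp l)))) := by
  have hn' : (0 : ℝ) < n := by exact_mod_cast hn
  have hp0 : 0 < (p : ℝ) := by
    have := Real.exp_pos l
    rw [hd] at this
    exact pos_of_mul_pos_left this hn'.le
  have hx : n / Real.exp l = (p : ℝ)⁻¹ := by rw [hd]; field_simp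
  have hNp : ((k + 1 : ℕ) : ℝ) * p ≤ 8 / 5 * l := by
    rw [hx] at hk2
    push_cast
    calc ((k : ℝ) + 1) * p ≤ 8 / 5 * ((p : ℝ)⁻¹ * l) * p := by gcongr
      _ = 8 / 5 * l := by field_simp
  have h4N : 4 * (k + 1) ≤ n := by
    have h1 : (k : ℝ) + 1 ≤ n / 4 := by
      have h2 : l / Real.exp l ≤ 1 / 7 := by
        rw [div_le_iff₀ (Real.exp_pos _)]; linarith
      have h3 : n / Real.exp l * l = n * (l / Real.exp l) := by ring
      rw [h3] at hk2
      nlinarith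
    have h2 : ((4 * (k + 1) : ℕ) : ℝ) ≤ n := by push_cast; linarith
    exact_mod_cast h2
  obtain ⟨hB, hB1, hB2⟩ := block_size (by omega : 0 < k + 1) h4N
  set B := 3 * n / (4 * (k + 1)) with hBdef
  have key := one_le_probGnp_mul (n := n) hp0 (by linarith) hB (by omega) (Real.exp_pos _).le
    (Real.exp_pos _).le (Real.exp_pos _).le
    (inv_one_sub_pow_choose_le hp0.le hpκ hκ0.le (by linarith) (k + 1))
  refine key.trans (mul_le_mul_of_nonneg_left ?_ MeasureTheory.measureReal_nonneg)
  refine (second_moment_ratio_le hp0 hκ0 hκ hl hd hl2 (Nat.succ_pos k) hNp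
    (by exact_mod_cast hB2)).trans ?_
  refine add_le_add ?_ ?_
  · rw [Real.exp_le_exp]
    push_cast
    calc 24 * ((k : ℝ) + 1) * l * Real.exp ((2 * κ - 1) * l)
        ≤ 24 * (8 / 5 * (n / Real.exp l * l)) * l * Real.exp ((2 * κ - 1) * l) := by gcongr
      _ = 24 * 8 / 5 * l ^ 2 * (n * Real.exp (-l) * Real.exp ((2 * κ - 1) * l)) := by
          rw [Real.exp_neg]; field_simp
      _ = 24 * 8 / 5 * l ^ 2 * Real.exp (Real.log n - l + (2 * κ - 1) * l) := by
          rw [Real.exp_add, Real.exp_sub, Real.exp_log hn', Real.exp_neg]; rfl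
      _ ≤ 40 * Real.exp (κ * l) * Real.exp (-(2 * κ * l)) := by
          gcongr
          · linarith
          · linarith
      _ = 40 * Real.exp (-(κ * l)) := by
          rw [mul_assoc, ← Real.exp_add]; congr 2; ring
  · rw [Real.exp_le_exp]
    push_cast
    nlinarith

end Estimates

/-! ### Parameters and error terms in the sparse case -/

section Sparse

/-- The choice of the number `m₀` and the size `L` of the components of the forest, and of the
margins `t` and `h`, where `l` and `ν` are the logarithms of the average degree and of the number of
vertices. -/
lemma exists_forest_parameters {ε l ν : ℝ} (hε : 0 < ε) (hε4 : ε ≤ 1 / 4) (hl : 1 ≤ l)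
    (hl1 : l ^ 2 ≤ Real.exp (ε / 40 * l)) (hl5 : 2 ≤ ε / 60 * Real.exp ((1 / 2 - ε / 10) * l))
    (hsp : (2 - ε / 10) * l < ν) (hν : 10 ≤ ε / 60 * Real.exp (ν / 5)) :
    ∃ m₀ L t h : ℕ, Real.exp (ν / 5) ≤ m₀ ∧
      (3 / 2 - ε / 2) * (Real.exp (ν - l) * l) ≤ m₀ * L ∧
      m₀ * L ≤ (3 / 2 - 3 * ε / 8) * (Real.exp (ν - l) * l) ∧
      (m₀ : ℝ) ≤ 6 * Real.exp (ν - (3 / 2 - ε / 8) * l) ∧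
      0 < L ∧ (L : ℝ) ≤ Real.exp ((1 / 2 - ε / 10) * l) ∧
      ε / 60 * m₀ ≤ t ∧ (t : ℝ) ≤ ε / 30 * m₀ ∧ 0 < h ∧ ε / 60 * L ≤ h ∧ (h : ℝ) ≤ ε / 30 * L := by
  set y := Real.exp ((1 / 2 - ε / 10) * l) with hy
  set G := Real.exp (ν / 5) with hG
  set x := Real.exp (ν - l) with hx
  have hx0 : 0 < x := Real.exp_pos _
  have hy0 : 0 < y := Real.exp_pos _
  have hG0 : 0 < G := Real.exp_pos _
  have hy480 : 480 ≤ y := by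
    have := mul_le_mul_of_nonneg_right hε4 hy0.le
    linarith only [this, hl5]
  have hG2400 : 2400 ≤ G := by
    have := mul_le_mul_of_nonneg_right hε4 hG0.le
    linarith only [this, hν]
  set L := ⌊y⌋₊ with hL
  have hLy : (L : ℝ) ≤ y := Nat.floor_le hy0.le
  have hyL : y < L + 1 := Nat.lt_floor_add_one y
  have hL0 : (0 : ℝ) < L := by linarith
  have hLn : 0 < L := by exact_mod_cast hL0
  -- there are at least `G` components
  have hxy : G * y ≤ x := by
    rw [hG, hy, hx, ← Real.exp_add, Real.exp_le_exp]
    have := mul_nonneg hε.le (by linarith only [hl] : 0 ≤ l)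
    linarith only [this, hsp, hl]
  have hxl : x ≤ x * l := le_mul_of_one_le_right hx0.le hl
  have hGL : G * L ≤ x * l :=
    (mul_le_mul_of_nonneg_left hLy hG0.le).trans (hxy.trans hxl)
  set c := 3 / 2 - ε / 2 with hc
  have hc1 : 1 ≤ c := by rw [hc]; linarith
  set q := c * (x * l) / L with hq
  have hq0 : 0 ≤ q := by positivity
  have hqL : q * L = c * (x * l) := by rw [hq]; field_simp
  have hGq : G ≤ q := by
    rw [hq, le_div_iff₀ hL0]
    exact hGL.trans (le_mul_of_one_le_left (by positivity) hc1)
  set m₀ := ⌈q⌉₊ with hm₀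
  have hm1 : q ≤ m₀ := Nat.le_ceil q
  have hm2 : (m₀ : ℝ) < q + 1 := Nat.ceil_lt_add_one hq0
  have hεm : 10 ≤ ε / 60 * m₀ :=
    hν.trans (mul_le_mul_of_nonneg_left (hGq.trans hm1) (by positivity))
  have hyL2 : y ≤ 2 * L := by linarith only [hyL, hy480]
  have hεL : 1 ≤ ε / 60 * L := by
    have := mul_le_mul_of_nonneg_left hyL2 (by positivity : 0 ≤ ε / 60)
    linarith only [this, hl5]
  refine ⟨m₀, L, ⌈ε / 60 * m₀⌉₊, ⌈ε / 60 * L⌉₊, hGq.trans hm1, ?_, ?_, ?_, hLn, hLy,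
    Nat.le_ceil _, ?_, Nat.ceil_pos.2 (by linarith), Nat.le_ceil _, ?_⟩
  · rw [← hqL]; gcongr
  · have h1 : (m₀ : ℝ) * L ≤ c * (x * l) + L := by
      rw [← hqL]
      linarith only [mul_le_mul_of_nonneg_right hm2.le hL0.le]
    have h2 : (L : ℝ) ≤ ε / 8 * (x * l) := by
      have h3 : 600 * (L : ℝ) ≤ ε * G * L :=
        mul_le_mul_of_nonneg_right (by linarith only [hν]) hL0.le
      have h4 := mul_le_mul_of_nonneg_left hGL hε.le
      linarith only [h3, h4, hL0]
    rw [hc] at h1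
    linarith only [h1, h2]
  · have h1 : q ≤ 3 * (x * l) / y := by
      rw [le_div_iff₀ hy0]
      have h3 : q * y ≤ q * (2 * L) := mul_le_mul_of_nonneg_left hyL2 hq0
      have h4 : c * (x * l) ≤ 3 / 2 * (x * l) := by
        refine mul_le_mul_of_nonneg_right ?_ (by positivity)
        rw [hc]; linarith only [hε]
      linarith only [h3, h4, hqL]
    have h5 : l ≤ Real.exp (ε / 40 * l) := by nlinarith only [hl, hl1]
    have h6 : 3 * (x * l) / y ≤ 3 * Real.exp (ν - (3 / 2 - ε / 8) * l) := by
      calc 3 * (x * l) / y ≤ 3 * (x * Real.exp (ε / 40 * l)) / y := by gcongr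
        _ = 3 * (Real.exp (ν - l + ε / 40 * l - (1 / 2 - ε / 10) * l)) := by
            rw [Real.exp_sub, Real.exp_add]; ring
        _ = 3 * Real.exp (ν - (3 / 2 - ε / 8) * l) := by
            congr 2; ring
    linarith only [hm2, h1, h6, hGq, hG2400]
  · have := (Nat.ceil_lt_add_one (by positivity : 0 ≤ ε / 60 * m₀)).le
    linarith only [this, hεm]
  · have := (Nat.ceil_lt_add_one (by positivity : 0 ≤ ε / 60 * L)).le
    linarith only [this, hεL]

/-- The concentration of the number of components beats the second moment ratio, because
`L ≤ exp ((1 / 2 - ε / 10) * l)`. -/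
lemma concentration_error_le {ε l ν M : ℝ} {m₀ m L t : ℕ} (hε : 0 < ε) (hε4 : ε ≤ 1 / 4)
    (hl : 1 ≤ l) (hl1 : l ^ 2 ≤ Real.exp (ε / 40 * l))
    (hl4 : 48 ≤ (ε / 60) ^ 2 * Real.exp (ε / 8 * l)) (hsp : (2 - ε / 10) * l < ν)
    (hN : (3 / 2 - ε / 2) * (Real.exp (ν - l) * l) ≤ m₀ * L) (hL0 : 0 < L)
    (hL : (L : ℝ) ≤ Real.exp ((1 / 2 - ε / 10) * l)) (ht : ε / 60 * m₀ ≤ t)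
    (hm : (m₀ : ℝ) - m = t)
    (hM : M ≤ Real.exp (24 * (m₀ * L : ℕ) * l * Real.exp ((2 * (ε / 40) - 1) * l)) +
      Real.exp (-(ε / 40 / 2 * (m₀ * L : ℕ)))) :
    Real.exp (-(((m₀ : ℝ) - m) ^ 2 / (m₀ * L : ℕ))) * M ≤
      2 * Real.exp (-((ε / 60) ^ 2 / 2 * Real.exp (ε / 20 * ν))) := by
  push_cast at hM ⊢
  set N : ℝ := m₀ * L with hNdef
  have hx0 : 0 < Real.exp (ν - l) := Real.exp_pos _
  have hLr : (0 : ℝ) < L := by exact_mod_cast hL0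
  have hxN : Real.exp (ν - l) ≤ N := by
    refine le_trans ?_ hN
    have h1 : Real.exp (ν - l) ≤ Real.exp (ν - l) * l := le_mul_of_one_le_right hx0.le hl
    nlinarith
  have hN0 : 0 < N := lt_of_lt_of_le hx0 hxN
  set w := Real.exp (-((1 - ε / 5) * l)) with hw
  have hw0 : 0 < w := Real.exp_pos _
  have h1 : (ε / 60) ^ 2 * (N * w) ≤ ((m₀ : ℝ) - m) ^ 2 / N := by
    rw [hm, le_div_iff₀ hN0]
    have h2 : (L : ℝ) ^ 2 * w ≤ 1 := by
      calc (L : ℝ) ^ 2 * w ≤ Real.exp ((1 / 2 - ε / 10) * l) ^ 2 * w := by gcongr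
        _ = 1 := by
          rw [← Real.exp_nat_mul, hw, ← Real.exp_add, Real.exp_eq_one_iff]
          push_cast; ring
    calc (ε / 60) ^ 2 * (N * w) * N = (ε / 60 * m₀) ^ 2 * ((L : ℝ) ^ 2 * w) := by
          rw [hNdef]; ring
      _ ≤ (ε / 60 * m₀) ^ 2 * 1 := by gcongr
      _ ≤ (t : ℝ) ^ 2 := by rw [mul_one]; gcongr
  have h3 : 24 * N * l * Real.exp ((2 * (ε / 40) - 1) * l) ≤ (ε / 60) ^ 2 / 2 * (N * w) := by
    have h4 : l ≤ Real.exp (ε / 40 * l) := by nlinarith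
    calc 24 * N * l * Real.exp ((2 * (ε / 40) - 1) * l)
        ≤ 24 * N * Real.exp (ε / 40 * l) * Real.exp ((2 * (ε / 40) - 1) * l) := by gcongr
      _ = 24 * N * (w * Real.exp (-(ε / 8 * l))) := by
          rw [mul_assoc, ← Real.exp_add, hw, ← Real.exp_add]
          congr 2; ring
      _ = 24 * Real.exp (-(ε / 8 * l)) * (N * w) := by ring
      _ ≤ (ε / 60) ^ 2 / 2 * (N * w) := by
          refine mul_le_mul_of_nonneg_right ?_ (by positivity)
          have h5 : Real.exp (ε / 8 * l) * Real.exp (-(ε / 8 * l)) = 1 := by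
            rw [← Real.exp_add]; simp
          have h6 := mul_le_mul_of_nonneg_right hl4 (Real.exp_pos (-(ε / 8 * l))).le
          nlinarith
  have h7 : Real.exp (ε / 20 * ν) ≤ N * w := by
    calc Real.exp (ε / 20 * ν) ≤ Real.exp (ν - l) * w := by
          rw [hw, ← Real.exp_add, Real.exp_le_exp]
          nlinarith [mul_le_mul_of_nonneg_left hsp.le (by linarith : (0 : ℝ) ≤ 1 - ε / 20),
            mul_nonneg (sq_nonneg ε) (by linarith : (0 : ℝ) ≤ l)]
      _ ≤ N * w := by gcongr
  have hM2 : M ≤ 2 * Real.exp ((ε / 60) ^ 2 / 2 * (N * w)) := by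
    have h8 : Real.exp (24 * N * l * Real.exp ((2 * (ε / 40) - 1) * l)) ≤
        Real.exp ((ε / 60) ^ 2 / 2 * (N * w)) := Real.exp_le_exp.2 h3
    have h9 : Real.exp (-(ε / 40 / 2 * N)) ≤ Real.exp ((ε / 60) ^ 2 / 2 * (N * w)) := by
      rw [Real.exp_le_exp]
      have : 0 ≤ (ε / 60) ^ 2 / 2 * (N * w) := by positivity
      have h10 : 0 ≤ ε / 40 / 2 * N := by positivity
      linarith
    linarith
  calc Real.exp (-(((m₀ : ℝ) - m) ^ 2 / N)) * M
      ≤ Real.exp (-((ε / 60) ^ 2 * (N * w))) * (2 * Real.exp ((ε / 60) ^ 2 / 2 * (N * w))) := by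
        refine (mul_le_mul_of_nonneg_left hM2 (Real.exp_pos _).le).trans ?_
        gcongr
    _ = 2 * Real.exp (-((ε / 60) ^ 2 / 2 * (N * w))) := by
        rw [mul_left_comm, ← Real.exp_add]; congr 2; ring
    _ ≤ _ := by gcongr

/-- There are many more links than components, so that the union bound over all pairs of sets of
components succeeds. -/
lemma linking_error_le {ε l ν p Λ r : ℝ} {n m₀ m L t h R : ℕ} (hε : 0 < ε) (hε4 : ε ≤ 1 / 4)
    (hp : 0 < p) (hpκ : p ≤ ε / 40 / 2) (hn : (n : ℝ) = Real.exp ν)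
    (hpx : p * Real.exp (ν - l) = 1)
    (hl : 1 ≤ l) (hl6 : 960 * Real.exp (ε / 8 * l) ≤ (ε / 60) ^ 4 * Real.exp (ε / 4 * l))
    (hN1 : (3 / 2 - ε / 2) * (Real.exp (ν - l) * l) ≤ m₀ * L)
    (hN2 : m₀ * L ≤ (3 / 2 - 3 * ε / 8) * (Real.exp (ν - l) * l))
    (hG : Real.exp (ν / 5) ≤ m₀)
    (hm₀ : (m₀ : ℝ) ≤ 6 * Real.exp (ν - (3 / 2 - ε / 8) * l)) (ht : ε / 60 * m₀ ≤ t)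
    (hh : ε / 60 * L ≤ h) (hmm : m ≤ m₀) (hR : (n : ℝ) ≤ 4 * R)
    (hr : r = (h : ℝ) ^ 2 * (p ^ 2 * (1 - p) ^ (m * L - 2))) (hΛ : Λ = (t : ℝ) ^ 2 * r * R) :
    3 * 4 ^ m * Real.exp (-(Λ / 10)) ≤ 3 * Real.exp (-Real.exp (ν / 5)) := by
  have hp1 : 0 < 1 - p := by linarith
  have hx0 : 0 < Real.exp (ν - l) := Real.exp_pos _
  have hNp1 : 1 ≤ m₀ * L * p := by
    have h1 : (3 / 2 - ε / 2) * l ≤ m₀ * L * p := by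
      calc (3 / 2 - ε / 2) * l = (3 / 2 - ε / 2) * (Real.exp (ν - l) * l) * p := by
            linear_combination (-(3 / 2 - ε / 2) * l) * hpx
        _ ≤ _ := by gcongr
    nlinarith
  have hNp2 : m₀ * L * p ≤ (3 / 2 - 3 * ε / 8) * l := by
    calc m₀ * L * p ≤ (3 / 2 - 3 * ε / 8) * (Real.exp (ν - l) * l) * p := by gcongr
      _ = (3 / 2 - 3 * ε / 8) * l := by linear_combination ((3 / 2 - 3 * ε / 8) * l) * hpx
  -- the probability that a vertex has no further neighbours in the forest
  have hq : Real.exp (-((3 / 2 - ε / 4) * l)) ≤ (1 - p) ^ (m * L - 2) := by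
    have h1 : Real.exp (-((1 + ε / 40) * p)) ≤ 1 - p := by
      rw [Real.exp_neg, inv_le_comm₀ (Real.exp_pos _) hp1]
      exact inv_one_sub_le_exp hp.le hpκ (by linarith)
    have h2 : m * L - 2 ≤ m₀ * L := (Nat.sub_le _ _).trans (Nat.mul_le_mul_right _ hmm)
    calc Real.exp (-((3 / 2 - ε / 4) * l))
        ≤ Real.exp (((m₀ * L : ℕ) : ℝ) * -((1 + ε / 40) * p)) := by
          rw [Real.exp_le_exp]
          push_cast
          have h3 : (1 + ε / 40) * (m₀ * L * p) ≤ (1 + ε / 40) * ((3 / 2 - 3 * ε / 8) * l) := by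
            gcongr
          nlinarith [mul_nonneg hε.le (by linarith : (0 : ℝ) ≤ l),
            mul_nonneg (sq_nonneg ε) (by linarith : (0 : ℝ) ≤ l)]
      _ = Real.exp (-((1 + ε / 40) * p)) ^ (m₀ * L) := by rw [Real.exp_nat_mul]
      _ ≤ (1 - p) ^ (m₀ * L) := pow_le_pow_left₀ (Real.exp_pos _).le h1 _
      _ ≤ (1 - p) ^ (m * L - 2) := pow_le_pow_of_le_one hp1.le (by linarith) h2
  have hΛ1 : 40 * (m₀ : ℝ) ≤ Λ := by
    have h1 : ε / 60 * m₀ * (ε / 60 * L) * p ≤ t * h * p := by gcongr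
    have h2 : (ε / 60) ^ 2 ≤ t * h * p := by
      refine le_trans ?_ h1
      have : ε / 60 * m₀ * (ε / 60 * L) * p = (ε / 60) ^ 2 * (m₀ * L * p) := by ring
      rw [this]
      exact le_mul_of_one_le_right (by positivity) hNp1
    have h3 : Λ = (t * h * p) ^ 2 * (1 - p) ^ (m * L - 2) * R := by rw [hΛ, hr]; ring
    have h4 : ((ε / 60) ^ 2) ^ 2 * Real.exp (-((3 / 2 - ε / 4) * l)) * (Real.exp ν / 4) ≤ Λ := by
      rw [h3]
      gcongr
      rw [← hn]; linarith
    refine le_trans ?_ h4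
    have h5 : ((ε / 60) ^ 2) ^ 2 * Real.exp (-((3 / 2 - ε / 4) * l)) * (Real.exp ν / 4) =
        (ε / 60) ^ 4 * Real.exp (ε / 4 * l) * Real.exp (ν - 3 / 2 * l) / 4 := by
      have : Real.exp (-((3 / 2 - ε / 4) * l)) * Real.exp ν =
          Real.exp (ε / 4 * l) * Real.exp (ν - 3 / 2 * l) := by
        rw [← Real.exp_add, ← Real.exp_add]; congr 1; ring
      linear_combination (ε / 60) ^ 4 / 4 * this
    have h6 : Real.exp (ν - (3 / 2 - ε / 8) * l) =
        Real.exp (ε / 8 * l) * Real.exp (ν - 3 / 2 * l) := by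
      rw [← Real.exp_add]; congr 1; ring
    rw [h5]
    rw [h6] at hm₀
    have h7 := mul_le_mul_of_nonneg_right hl6 (Real.exp_pos (ν - 3 / 2 * l)).le
    linarith
  have h4 : (4 : ℝ) ^ m ≤ Real.exp (2 * m₀) := by
    have h5 : (4 : ℝ) ≤ Real.exp 2 := by
      have : Real.exp 2 = Real.exp 1 * Real.exp 1 := by rw [← Real.exp_add]; norm_num
      nlinarith [Real.exp_one_gt_d9]
    calc (4 : ℝ) ^ m ≤ 4 ^ m₀ := pow_le_pow_right₀ (by norm_num) hmm
      _ ≤ Real.exp 2 ^ m₀ := pow_le_pow_left₀ (by norm_num) h5 _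
      _ = Real.exp (2 * m₀) := by rw [← Real.exp_nat_mul, mul_comm]
  calc 3 * 4 ^ m * Real.exp (-(Λ / 10))
      ≤ 3 * Real.exp (2 * m₀) * Real.exp (-(4 * m₀)) := by
        gcongr
        linarith
    _ = 3 * Real.exp (-(2 * m₀)) := by
        rw [mul_assoc, ← Real.exp_add]; congr 2; ring
    _ ≤ _ := by
        gcongr
        have : 0 < Real.exp (ν / 5) := Real.exp_pos _
        linarith

/-- The linking vertices span few edges. -/
lemma links_sparse {ε l p r : ℝ} {n m₀ m L t h R : ℕ} (hε : 0 < ε) (hε4 : ε ≤ 1 / 4)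
    (hp : 0 < p) (hpκ : p ≤ ε / 40 / 2) (hd : Real.exp l = p * n)
    (hl : 1 ≤ l) (hl7 : 896 * l ^ 2 * Real.exp (-(l / 4)) ≤ (ε / 60) ^ 2)
    (hN1 : (3 / 2 - ε / 2) * l ≤ m₀ * L * p) (hN2 : m₀ * L * p ≤ 8 / 5 * l)
    (ht : ε / 60 * m₀ ≤ t) (ht2 : (t : ℝ) ≤ ε / 30 * m₀) (hh : (h : ℝ) ≤ L)
    (hm : (m₀ : ℝ) - m = t) (hR : R ≤ n)
    (hr : r = (h : ℝ) ^ 2 * (p ^ 2 * (1 - p) ^ (m * L - 2))) :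
    128 * (p * ((m : ℝ) ^ 2 * r * R) ^ 2) ≤ (t : ℝ) ^ 2 * r * R := by
  have hp1 : 0 < 1 - p := by linarith
  have hr0 : 0 ≤ r := by rw [hr]; positivity
  have hmm : (m : ℝ) ≤ m₀ := by
    have : (0 : ℝ) ≤ t := by positivity
    linarith
  have hRn : (R : ℝ) ≤ n := by exact_mod_cast hR
  have hq : (1 - p) ^ (m * L - 2) ≤ Real.exp (-(5 / 4 * l)) := by
    have h1 : 1 - p ≤ Real.exp (-p) := by linarith [Real.add_one_le_exp (-p)]
    calc (1 - p) ^ (m * L - 2) ≤ Real.exp (-p) ^ (m * L - 2) := pow_le_pow_left₀ hp1.le h1 _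
      _ = Real.exp ((m * L - 2 : ℕ) * -p) := by rw [← Real.exp_nat_mul]
      _ ≤ Real.exp (-(5 / 4 * l)) := by
        rw [Real.exp_le_exp]
        have h2 : (m : ℝ) * L ≤ (m * L - 2 : ℕ) + 2 := by
          have : m * L ≤ (m * L - 2) + 2 := by omega
          exact_mod_cast this
        have h3 : (1 - ε / 30) * (m₀ * L * p) ≤ m * L * p := by
          have h4 : (1 - ε / 30) * m₀ ≤ m := by linarith
          have h5 : 0 ≤ L * p := by positivity
          nlinarith
        have h6 : (1 - ε / 30) * ((3 / 2 - ε / 2) * l) ≤ m * L * p :=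
          le_trans (mul_le_mul_of_nonneg_left hN1 (by linarith)) h3
        have h8 : 13 / 10 * l ≤ (1 - ε / 30) * ((3 / 2 - ε / 2) * l) := by
          nlinarith
        have h7 := mul_le_mul_of_nonneg_right h2 hp.le
        nlinarith
  have hA : 128 * (p * (m : ℝ) ^ 2 * (r * R)) ≤ (ε / 60) ^ 2 := by
    have h1 : (m : ℝ) * h * p ≤ 8 / 5 * l := by
      refine le_trans ?_ hN2
      gcongr
    calc 128 * (p * (m : ℝ) ^ 2 * (r * R))
        = 128 * (p * R) * ((m * h * p) ^ 2 * (1 - p) ^ (m * L - 2)) := by rw [hr]; ring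
      _ ≤ 128 * (p * n) * ((8 / 5 * l) ^ 2 * Real.exp (-(5 / 4 * l))) := by gcongr
      _ = 128 * (8 / 5) ^ 2 * l ^ 2 * (Real.exp l * Real.exp (-(5 / 4 * l))) := by
          rw [hd]; ring
      _ = 128 * (8 / 5) ^ 2 * l ^ 2 * Real.exp (-(l / 4)) := by
          rw [← Real.exp_add]; congr 2; ring
      _ ≤ 896 * l ^ 2 * Real.exp (-(l / 4)) := by
          gcongr; norm_num
      _ ≤ _ := hl7
  have hB : (ε / 60) ^ 2 * (m : ℝ) ^ 2 ≤ (t : ℝ) ^ 2 := by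
    rw [← mul_pow]
    exact pow_le_pow_left₀ (by positivity) (le_trans (by gcongr) ht) 2
  have hrR : 0 ≤ r * R := by positivity
  calc 128 * (p * ((m : ℝ) ^ 2 * r * R) ^ 2)
      = 128 * (p * (m : ℝ) ^ 2 * (r * R)) * ((m : ℝ) ^ 2 * (r * R)) := by ring
    _ ≤ (ε / 60) ^ 2 * ((m : ℝ) ^ 2 * (r * R)) := by gcongr
    _ = (ε / 60) ^ 2 * (m : ℝ) ^ 2 * (r * R) := by ring
    _ ≤ (t : ℝ) ^ 2 * (r * R) := by gcongr
    _ = _ := by ring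

end Sparse

/-! ### The sparse case and the uniform lower bound -/

section Final

/-- The sparse case: almost all components of an induced linear forest are linked. -/
theorem le_probGnp_of_sparse {n k : ℕ} {p : unitInterval} {ε l : ℝ} (hn : 0 < n) (hε : 0 < ε)
    (hε4 : ε ≤ 1 / 4) (hd : Real.exp l = p * n) (hpκ : (p : ℝ) ≤ ε / 40 / 2) (hl : 1 ≤ l)
    (hl1 : l ^ 2 ≤ Real.exp (ε / 40 * l))
    (hl2 : 24 * Real.exp 1 * l * Real.exp (-(l / 10)) ≤ ε / 40 / 2) (hl3 : 7 * l ≤ Real.exp l)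
    (hl4 : 48 ≤ (ε / 60) ^ 2 * Real.exp (ε / 8 * l))
    (hl5 : 2 ≤ ε / 60 * Real.exp ((1 / 2 - ε / 10) * l))
    (hl6 : 960 * Real.exp (ε / 8 * l) ≤ (ε / 60) ^ 4 * Real.exp (ε / 4 * l))
    (hl7 : 896 * l ^ 2 * Real.exp (-(l / 4)) ≤ (ε / 60) ^ 2)
    (hν : 10 ≤ ε / 60 * Real.exp (Real.log n / 5))
    (hsp : (2 - ε / 10) * l < Real.log n)
    (hk : (k : ℝ) ≤ (3 / 2 - ε) * (n / Real.exp l * l) + 1) :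
    1 - 2 * Real.exp (-((ε / 60) ^ 2 / 2 * Real.exp (ε / 20 * Real.log n))) -
        3 * Real.exp (-Real.exp (Real.log n / 5)) ≤
      probGnp n p (fun G => HasInducedPath G k) := by
  have hn' : (0 : ℝ) < n := by exact_mod_cast hn
  have hp0 : 0 < (p : ℝ) := by
    have := Real.exp_pos l
    rw [hd] at this
    exact pos_of_mul_pos_left this hn'.le
  have hxe : n / Real.exp l = Real.exp (Real.log n - l) := by
    rw [Real.exp_sub, Real.exp_log hn']
  have hpx : (p : ℝ) * Real.exp (Real.log n - l) = 1 := by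
    rw [← hxe, hd]; field_simp
  rw [hxe] at hk
  obtain ⟨m₀, L, t, h, hG, hN1, hN2, hm₀, hL0, hL, ht1, ht2, hh0, hh1, hh2⟩ :=
    exists_forest_parameters hε hε4 hl hl1 hl5 hsp hν
  set x := Real.exp (Real.log n - l) with hx
  have hx0 : 0 < x := Real.exp_pos _
  have hm₀R : (0 : ℝ) ≤ m₀ := by positivity
  have hLR : (0 : ℝ) < L := by exact_mod_cast hL0
  have hm₀pos : (0 : ℝ) < m₀ := lt_of_lt_of_le (Real.exp_pos _) hG
  have htm : 100 * (t : ℝ) ≤ m₀ := by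
    have := mul_le_mul_of_nonneg_right hε4 hm₀R
    linarith only [ht2, this]
  have hhL : 100 * (h : ℝ) ≤ L := by
    have := mul_le_mul_of_nonneg_right hε4 hLR.le
    linarith only [hh2, this]
  have ht0 : 0 < t := by
    have : (0 : ℝ) < t := lt_of_lt_of_le (by positivity) ht1
    exact_mod_cast this
  have htm' : 100 * t ≤ m₀ := by exact_mod_cast htm
  have hhL' : 100 * h ≤ L := by exact_mod_cast hhL
  set m := m₀ - t with hm
  have hmcast : (m : ℝ) = m₀ - t := by rw [hm, Nat.cast_sub (by omega)]
  -- the number of vertices of the forest is of order `n * log d / d`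
  have hNp1 : (3 / 2 - ε / 2) * l ≤ (m₀ : ℝ) * L * (p : ℝ) := by
    calc (3 / 2 - ε / 2) * l = (3 / 2 - ε / 2) * (x * l) * (p : ℝ) := by
          linear_combination (-(3 / 2 - ε / 2) * l) * hpx
      _ ≤ _ := by gcongr
  have hNp2 : (m₀ : ℝ) * L * (p : ℝ) ≤ 8 / 5 * l := by
    calc (m₀ : ℝ) * L * (p : ℝ) ≤ (3 / 2 - 3 * ε / 8) * (x * l) * (p : ℝ) := by gcongr
      _ = (3 / 2 - 3 * ε / 8) * l := by linear_combination ((3 / 2 - 3 * ε / 8) * l) * hpx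
      _ ≤ 8 / 5 * l := by
        refine mul_le_mul_of_nonneg_right ?_ (by linarith only [hl])
        linarith only [hε]
  have h4N : 4 * (m₀ * L) ≤ n := by
    have h1 : (m₀ : ℝ) * L * p * 4 ≤ n * p := by
      rw [mul_comm (n : ℝ), ← hd]
      linarith only [hNp2, hl3, hl]
    have h2 : ((4 * (m₀ * L) : ℕ) : ℝ) ≤ n := by
      push_cast
      refine le_of_mul_le_mul_right ?_ hp0
      linarith only [h1]
    exact_mod_cast h2
  have hN0 : 0 < m₀ * L := Nat.mul_pos (by omega) hL0
  obtain ⟨hB, hB1, hB2⟩ := block_size hN0 h4N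
  set B := 3 * n / (4 * (m₀ * L)) with hBdef
  have hkey : k < (m - 2 * t) * (L - 2 * h) := by
    have h1 : ((m - 2 * t : ℕ) : ℝ) = m₀ - 3 * t := by
      rw [Nat.cast_sub (by omega), hmcast]; push_cast; ring
    have h2 : ((L - 2 * h : ℕ) : ℝ) = L - 2 * h := by
      rw [Nat.cast_sub (by omega)]; push_cast; ring
    have h3 : (k : ℝ) < ((m - 2 * t : ℕ) : ℝ) * ((L - 2 * h : ℕ) : ℝ) := by
      rw [h1, h2]
      have e1 : (1 - ε / 10) * (m₀ : ℝ) ≤ m₀ - 3 * t := by linarith only [ht2]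
      have e2 : (1 - ε / 15) * (L : ℝ) ≤ L - 2 * h := by linarith only [hh2]
      have e3 : (1 - ε / 10) * (m₀ : ℝ) * ((1 - ε / 15) * (L : ℝ)) ≤
          (m₀ - 3 * t) * (L - 2 * h) := by
        refine mul_le_mul e1 e2 ?_ ?_
        · exact mul_nonneg (by linarith only [hε4]) hLR.le
        · linarith only [htm, hm₀R]
      have hxl0 : 0 ≤ x * l := mul_nonneg hx0.le (by linarith only [hl])
      have e4 : (1 - ε / 6) * ((m₀ : ℝ) * L) ≤ (1 - ε / 10) * (m₀ : ℝ) * ((1 - ε / 15) * L) := by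
        have : 0 ≤ ε ^ 2 * ((m₀ : ℝ) * L) := by positivity
        linarith only [this]
      have e5 : (1 - ε / 6) * ((3 / 2 - ε / 2) * (x * l)) ≤ (1 - ε / 6) * ((m₀ : ℝ) * L) :=
        mul_le_mul_of_nonneg_left hN1 (by linarith only [hε4])
      have e6 : (3 / 2 - 3 / 4 * ε) * (x * l) ≤ (1 - ε / 6) * ((3 / 2 - ε / 2) * (x * l)) := by
        have : 0 ≤ ε ^ 2 * (x * l) := by positivity
        linarith only [this]
      have e7 : 20 ≤ ε / 4 * (x * l) := by
        have h5 : 1 ≤ ε / 80 * x := by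
          have := mul_le_mul_of_nonneg_right hpκ hx0.le
          rw [hpx] at this
          linarith only [this]
        have h6 : ε / 80 * x * 1 ≤ ε / 80 * x * l :=
          mul_le_mul_of_nonneg_left hl (by positivity)
        linarith only [h5, h6]
      linarith only [hk, e3, e4, e5, e6, e7]
    exact_mod_cast h3
  have hM := second_moment_ratio_le hp0 (by positivity : 0 < ε / 40) (by linarith only [hε4]) hl
    hd hl2 hN0 (by push_cast; exact hNp2) (by exact_mod_cast hB2 : (n : ℝ) ≤ 2 * ((m₀ * L : ℕ) * B))
  have hRle : n ≤ 4 * (n - m₀ * L * B) := by omega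
  have hmain := mul_le_probGnp (n := n) (k := k) (m₀ := m₀) (m := m) (L := L) (B := B) (h := h)
    (t := t) hp0 (by linarith only [hpκ, hε4]) hB (by omega) (by omega) (by omega) hh0 (by omega)
    hkey (Real.exp_pos _).le (Real.exp_pos _).le (Real.exp_pos _).le
    (inv_one_sub_pow_choose_le hp0.le hpκ (by positivity) (by linarith only [hε4]) (m₀ * L)) rfl rfl
    (links_sparse hε hε4 hp0 hpκ hd hl hl7 hNp1 hNp2 ht1 ht2 (by linarith only [hhL, hLR])
      (by rw [hmcast]; ring) (Nat.sub_le _ _) rfl)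
  refine le_trans ?_ hmain
  refine sub_le_sub (sub_le_sub_left ?_ _) ?_
  · exact concentration_error_le hε hε4 hl hl1 hl4 hsp hN1 hL0 hL ht1 (by rw [hmcast]; ring) hM
  · exact linking_error_le hε hε4 hp0 hpκ (Real.exp_log hn').symm hpx hl hl6 hN1 hN2 hG hm₀ ht1
      hh1 (Nat.sub_le _ _) (by exact_mod_cast hRle) rfl rfl

lemma eventually_pow_mul_exp_neg_le (k : ℕ) {c δ : ℝ} (hc : 0 < c) (hδ : 0 < δ) :
    ∀ᶠ l : ℝ in atTop, l ^ k * Real.exp (-(c * l)) ≤ δ := by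
  have h := (Real.tendsto_pow_mul_exp_neg_atTop_nhds_zero k).comp
    (tendsto_id.const_mul_atTop hc)
  have hpos : 0 < c ^ k * δ := by positivity
  filter_upwards [h.eventually (gt_mem_nhds hpos)] with l hl
  simp only [Function.comp_apply, id_eq, mul_pow, mul_assoc] at hl
  exact (lt_of_mul_lt_mul_left hl (by positivity)).le

lemma eventually_le_mul_exp (K : ℝ) {a c : ℝ} (ha : 0 < a) (hc : 0 < c) :
    ∀ᶠ l : ℝ in atTop, K ≤ a * Real.exp (c * l) :=
  ((Real.tendsto_exp_atTop.comp (tendsto_id.const_mul_atTop hc)).const_mul_atTop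
    ha).eventually_ge_atTop K

/-- The lower bound for the probability in both cases, for a large average degree. -/
lemma exists_le_probGnp {ε : ℝ} (hε : 0 < ε) (hε4 : ε ≤ 1 / 4) :
    ∃ l₀ : ℝ, 1 ≤ l₀ ∧ ∀ (n k : ℕ) (p : unitInterval) (l : ℝ), 0 < n → l₀ ≤ l →
      Real.exp l = p * n → (p : ℝ) ≤ ε / 40 / 2 → 10 ≤ ε / 60 * Real.exp (Real.log n / 5) →
      (3 / 2 - ε) * (n / Real.exp l * l) ≤ k →
      (k : ℝ) ≤ (3 / 2 - ε) * (n / Real.exp l * l) + 1 →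
      min (1 - 2 * Real.exp (-((ε / 60) ^ 2 / 2 * Real.exp (ε / 20 * Real.log n))) -
        3 * Real.exp (-Real.exp (Real.log n / 5)))
        (Real.exp (40 * Real.exp (-(ε / 80 * Real.log n))) +
          Real.exp (-(ε / 40 / 2 * (n / Real.exp l))))⁻¹ ≤
      probGnp n p (fun G => HasInducedPath G k) := by
  have h1 := eventually_pow_mul_exp_neg_le 2 (by positivity : 0 < ε / 40) one_pos
  have h2 := eventually_pow_mul_exp_neg_le 1 (by norm_num : (0 : ℝ) < 1 / 10)
    (by positivity : 0 < ε / 40 / 2 / (24 * Real.exp 1))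
  have h3 := eventually_pow_mul_exp_neg_le 1 one_pos (by norm_num : (0 : ℝ) < 1 / 7)
  have h4 := eventually_le_mul_exp 48 (by positivity : 0 < (ε / 60) ^ 2)
    (by positivity : 0 < ε / 8)
  have h5 := eventually_le_mul_exp 2 (by positivity : 0 < ε / 60)
    (by linarith : 0 < 1 / 2 - ε / 10)
  have h6 := eventually_le_mul_exp 960 (by positivity : 0 < (ε / 60) ^ 4)
    (by positivity : 0 < ε / 8)
  have h7 := eventually_pow_mul_exp_neg_le 2 (by norm_num : (0 : ℝ) < 1 / 4)
    (by positivity : 0 < (ε / 60) ^ 2 / 896)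
  obtain ⟨l₁, hl₁⟩ := eventually_atTop.1
    (h1.and (h2.and (h3.and (h4.and (h5.and (h6.and h7))))))
  refine ⟨max l₁ 1, le_max_right _ _, ?_⟩
  intro n k p l hn hl hd hpκ hν hk1 hk2
  obtain ⟨g1, g2, g3, g4, g5, g6, g7⟩ := hl₁ l ((le_max_left _ _).trans hl)
  have hl1 : 1 ≤ l := (le_max_right _ _).trans hl
  have hexp : ∀ c : ℝ, Real.exp c * Real.exp (-c) = 1 := fun c => by
    rw [← Real.exp_add]; simp
  have c1 : l ^ 2 ≤ Real.exp (ε / 40 * l) := by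
    have := mul_le_mul_of_nonneg_left g1 (Real.exp_pos (ε / 40 * l)).le
    linear_combination this - l ^ 2 * hexp (ε / 40 * l)
  have c2 : 24 * Real.exp 1 * l * Real.exp (-(l / 10)) ≤ ε / 40 / 2 := by
    rw [le_div_iff₀ (by positivity)] at g2
    have e : 1 / 10 * l = l / 10 := by ring
    rw [e] at g2
    linarith only [g2]
  have c3 : 7 * l ≤ Real.exp l := by
    rw [one_mul] at g3
    have := mul_le_mul_of_nonneg_left g3 (Real.exp_pos l).le
    linear_combination 7 * this - 7 * l * hexp l
  have c6 : 960 * Real.exp (ε / 8 * l) ≤ (ε / 60) ^ 4 * Real.exp (ε / 4 * l) := by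
    have e : Real.exp (ε / 4 * l) = Real.exp (ε / 8 * l) * Real.exp (ε / 8 * l) := by
      rw [← Real.exp_add]; congr 1; ring
    rw [e, ← mul_assoc]
    exact mul_le_mul_of_nonneg_right g6 (Real.exp_pos _).le
  have c7 : 896 * l ^ 2 * Real.exp (-(l / 4)) ≤ (ε / 60) ^ 2 := by
    rw [le_div_iff₀ (by norm_num)] at g7
    have e : 1 / 4 * l = l / 4 := by ring
    rw [e] at g7
    linarith only [g7]
  rcases le_or_gt (Real.log n) ((2 - ε / 10) * l) with hdense | hsparse
  · refine (min_le_right _ _).trans ?_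
    have hn' : (0 : ℝ) < n := by exact_mod_cast hn
    have hx0 : 0 < n / Real.exp l := by positivity
    have hx80 : 80 ≤ ε * (n / Real.exp l) := by
      have : (p : ℝ) * ((n : ℝ) / Real.exp l) = 1 := by
        rw [hd]
        have := Real.exp_pos l
        rw [hd] at this
        have hp0 : (p : ℝ) ≠ 0 := by
          rintro h
          rw [h, zero_mul] at this
          exact lt_irrefl _ this
        field_simp
      have h8 := mul_le_mul_of_nonneg_right hpκ hx0.le
      rw [this] at h8
      linarith only [h8]
    have hxl : n / Real.exp l ≤ n / Real.exp l * l := le_mul_of_one_le_right hx0.le hl1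
    have hx320 : 320 ≤ n / Real.exp l := by
      have := mul_le_mul_of_nonneg_right hε4 hx0.le
      linarith only [this, hx80]
    have hεx := mul_le_mul_of_nonneg_right hε4 (hx0.le.trans hxl)
    have hεx0 := mul_nonneg hε.le (hx0.le.trans hxl)
    have key := one_le_probGnp_mul_of_dense (n := n) (k := k) (p := p) (κ := ε / 40) (l := l) hn
      (by positivity) (by linarith only [hε4]) hd hpκ hl1 c1 c2 c3
      (by linarith only [hk1, hxl, hεx])
      (by linarith only [hk2, hxl, hx320, hεx0]) (by linarith only [hdense])
    set Y := Real.exp (-(ε / 40 / 2 * (n / Real.exp l)))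
    have hmono : Real.exp (40 * Real.exp (-(ε / 40 * l))) + Y ≤
        Real.exp (40 * Real.exp (-(ε / 80 * Real.log n))) + Y := by
      have h9 : Real.log n ≤ 2 * l := by
        have := mul_nonneg hε.le (by linarith only [hl1] : 0 ≤ l)
        linarith only [this, hdense]
      have h10 := mul_le_mul_of_nonneg_left h9 (by positivity : 0 ≤ ε / 80)
      have h11 : Real.exp (-(ε / 40 * l)) ≤ Real.exp (-(ε / 80 * Real.log n)) :=
        Real.exp_le_exp.2 (by linarith only [h10])
      have h12 := Real.exp_le_exp.2 (mul_le_mul_of_nonneg_left h11 (by norm_num : (0 : ℝ) ≤ 40))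
      linarith only [h12]
    have h11 := key.trans (mul_le_mul_of_nonneg_left hmono
      (MeasureTheory.measureReal_nonneg : 0 ≤ probGnp n p _))
    rwa [inv_le_iff_one_le_mul₀ (by positivity)]
  · exact (min_le_left _ _).trans (le_probGnp_of_sparse hn hε hε4 hd hpκ hl1 c1 c2 c3 g4 g5 c6 c7
      hν hsparse hk2)

lemma HasInducedPath.mono {V : Type*} {G : SimpleGraph V} {k l : ℕ} (h : HasInducedPath G l)
    (hkl : k ≤ l) : HasInducedPath G k := by
  refine SimpleGraph.IsIndContained.trans ⟨⟨Fin.castLEEmb (by omega), ?_⟩⟩ h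
  intro i j
  simp [SimpleGraph.pathGraph_adj]

end Final

theorem theorem1p1 (ε : ℝ) (hε : 0 < ε) :
    ∃ d₀ : ℝ, 0 < d₀ ∧
      ∀ (p : ℕ → unitInterval) (d : ℕ → ℝ),
        (∀ n : ℕ, d n = (p n : ℝ) * n) →
        (∀ᶠ n : ℕ in atTop, d₀ ≤ d n) →
        d =o[atTop] (fun n : ℕ => (n : ℝ)) →
        Tendsto (fun n : ℕ =>
            probGnp n (p n) fun G =>
              HasInducedPath G ⌈(3 / 2 - ε) * ((n : ℝ) / d n) * Real.log (d n)⌉₊)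
          atTop (𝓝 1) := by
  -- a smaller `ε` asks for a longer path, so that `ε ≤ 1 / 4` may be assumed
  obtain ⟨l₀, hl₀, H⟩ := exists_le_probGnp (lt_min hε (by norm_num : (0 : ℝ) < 1 / 4))
    (min_le_right ε (1 / 4))
  set δ := min ε (1 / 4) with hδ
  have hδ0 : 0 < δ := lt_min hε (by norm_num)
  have hδε : δ ≤ ε := min_le_left _ _
  have hδ4 : δ ≤ 1 / 4 := min_le_right _ _
  refine ⟨Real.exp l₀, Real.exp_pos _, fun p d hd hd₀ hdo => ?_⟩
  have hlog : Tendsto (fun n : ℕ => Real.log n) atTop atTop :=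
    Real.tendsto_log_atTop.comp tendsto_natCast_atTop_atTop
  -- the quotient `n / d` tends to infinity
  have hx : Tendsto (fun n : ℕ => (n : ℝ) / d n) atTop atTop := by
    have h1 : Tendsto (fun n : ℕ => d n / n) atTop (𝓝[>] 0) := by
      refine tendsto_nhdsWithin_iff.2 ⟨hdo.tendsto_div_nhds_zero, ?_⟩
      filter_upwards [hd₀, eventually_gt_atTop 0] with n hn hn0
      have : 0 < d n := lt_of_lt_of_le (Real.exp_pos _) hn
      exact div_pos this (by exact_mod_cast hn0)
    refine (tendsto_inv_nhdsGT_zero.comp h1).congr fun n => ?_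
    simp
  have hlim : Tendsto (fun n : ℕ =>
      min (1 - 2 * Real.exp (-((δ / 60) ^ 2 / 2 * Real.exp (δ / 20 * Real.log n))) -
        3 * Real.exp (-Real.exp (Real.log n / 5)))
        (Real.exp (40 * Real.exp (-(δ / 80 * Real.log n))) +
          Real.exp (-(δ / 40 / 2 * (n / d n))))⁻¹) atTop (𝓝 1) := by
    have e1 : Tendsto (fun n : ℕ =>
        Real.exp (-((δ / 60) ^ 2 / 2 * Real.exp (δ / 20 * Real.log n)))) atTop (𝓝 0) :=
      Real.tendsto_exp_neg_atTop_nhds_zero.comp ((Real.tendsto_exp_atTop.comp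
        (hlog.const_mul_atTop (by positivity))).const_mul_atTop (by positivity))
    have e2 : Tendsto (fun n : ℕ => Real.exp (-Real.exp (Real.log n / 5))) atTop (𝓝 0) :=
      Real.tendsto_exp_neg_atTop_nhds_zero.comp (Real.tendsto_exp_atTop.comp
        (hlog.atTop_div_const (by norm_num)))
    have e3 : Tendsto (fun n : ℕ => Real.exp (-(δ / 80 * Real.log n))) atTop (𝓝 0) :=
      Real.tendsto_exp_neg_atTop_nhds_zero.comp (hlog.const_mul_atTop (by positivity))
    have e4 : Tendsto (fun n : ℕ => Real.exp (-(δ / 40 / 2 * (n / d n)))) atTop (𝓝 0) :=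
      Real.tendsto_exp_neg_atTop_nhds_zero.comp (hx.const_mul_atTop (by positivity))
    have e5 : Tendsto (fun n : ℕ => Real.exp (40 * Real.exp (-(δ / 80 * Real.log n)))) atTop
        (𝓝 (Real.exp (40 * 0))) := (Real.continuous_exp.tendsto _).comp (e3.const_mul 40)
    have f1 := ((tendsto_const_nhds (x := (1 : ℝ))).sub (e1.const_mul 2)).sub (e2.const_mul 3)
    have f2 := (e5.add e4).inv₀ (by simp)
    have f3 := f1.min f2
    simpa using f3
  refine tendsto_of_tendsto_of_tendsto_of_le_of_le' hlim tendsto_const_nhds ?_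
    (Eventually.of_forall fun n => MeasureTheory.measureReal_le_one)
  have hG : ∀ᶠ n : ℕ in atTop, 10 ≤ δ / 60 * Real.exp (Real.log n / 5) :=
    ((Real.tendsto_exp_atTop.comp (hlog.atTop_div_const (by norm_num))).const_mul_atTop
      (by positivity)).eventually_ge_atTop 10
  filter_upwards [hd₀, eventually_gt_atTop 0, hG, hx.eventually_ge_atTop (δ / 40 / 2)⁻¹] with
    n hdn hn0 hGn hxn
  have hdpos : 0 < d n := lt_of_lt_of_le (Real.exp_pos _) hdn
  have hn' : (0 : ℝ) < n := by exact_mod_cast hn0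
  set l := Real.log (d n) with hl
  have hexpl : Real.exp l = d n := Real.exp_log hdpos
  have hll : l₀ ≤ l := by rwa [hl, Real.le_log_iff_exp_le hdpos]
  have hpn : (p n : ℝ) ≤ δ / 40 / 2 := by
    have h1 : (p n : ℝ) = ((n : ℝ) / d n)⁻¹ := by
      rw [inv_div, hd n]; field_simp
    rw [h1]
    exact inv_le_of_inv_le₀ (by positivity) hxn
  set Q := (3 / 2 - δ) * ((n : ℝ) / d n * l) with hQ
  have hl0 : 0 ≤ l := by linarith
  have hxl0 : 0 ≤ (n : ℝ) / d n * l := by positivity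
  have hQ0 : 0 ≤ Q := mul_nonneg (by linarith) hxl0
  have key := H n ⌈Q⌉₊ (p n) l hn0 hll (by rw [hexpl, hd n]) hpn hGn
    (by rw [hexpl]; exact Nat.le_ceil Q) (by rw [hexpl]; exact (Nat.ceil_lt_add_one hQ0).le)
  rw [hexpl] at key
  refine key.trans (MeasureTheory.measureReal_mono fun G hGp => ?_)
  refine HasInducedPath.mono hGp (Nat.ceil_mono ?_)
  rw [mul_assoc]
  exact mul_le_mul_of_nonneg_right (by linarith) hxl0
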